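/- **Theorem.** Let $SpecRel^e_{Full}$, $ClassicalKin^{STL}_{Full}$, $Tr_+$, $Tr'_+$ be the theories and translations defined below. $Tr_+$, with inverse $Tr'_+$, is a definitional equivalence between $SpecRel^e_{Full}$ and $ClassicalKin^{STL}_{Full}$; that is, for all formulas $\varphi$ of the language of $SpecRel^e_{Full}$ and $\psi$ of the language of $ClassicalKin^{STL}_{Full}$: 1. if $SpecRel^e_{Full}\vdash\varphi$ then $ClassicalKin^{STL}_{Full}\vdash Tr_+(\varphi)$; 2. if $ClassicalKin^{STL}_{Full}\vdash\psi$ then $SpecRel^e_{Full}\vdash Tr'_+(\psi)$; 3. $SpecRel^e_{Full}\vdash Tr'_+(Tr_+(\varphi))\leftrightarrow\varphi$; 4. $ClassicalKin^{STL}_{Full}\vdash Tr_+(Tr'_+(\psi))\leftrightarrow\psi$. **Logic.** $\vdash$ is provability in classical two-sorted first-order logic with equality, with sorts $B$ (bodies) and $Q$ (quantities), function symbols $+,\cdot$ on $Q$, and relation symbols $\le$ on $Q$, $IOb$ (inertial observers) and $Ph$ (light signals) on $B$, and $W$ on $B^2\times Q^4$ ($W(k,b,\bar x)$: $k$ coordinatizes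 $b$ at $\bar x=(x_0,x_1,x_2,x_3)$, $x_0$ being time); the language of $SpecRel^e_{Full}$ has in addition a unary $E$ on $B$. A translation sends each relation symbol to a formula with the same free variables, and preserves equality, connectives and quantifiers. Partial functions in an atomic formula are eliminated with the convention that the formula asserts that they are defined. **Defined notions.** $space(\bar x,\bar y)=\sqrt{\sum_{i=1}^3(x_i-y_i)^2}$; $time(\bar x,\bar y)=|x_0-y_0|$; $\bar x\in wl_k(b)$ iff $W(k,b,\bar x)$; $ev_k(\bar x)=ev_h(\bar y)$ iff $\forall b\,(W(k,b,\bar x)\leftrightarrow W(h,b,\bar y))$; $w_{kh}$ is the relation $\{(\bar x,\bar y): ev_k(\bar x)=ev_h(\bar y)\}$. $speed_k(b)=v$ (respectively $\bar v_k(b)=\bar v$) iff $wl_k(b)$ has two distinct points and all $\bar x,\bar y\in wl_k(b)$ satisfy $space(\bar x,\bar y)=v\cdot time(\bar x,\bar y)$ (respectively $(y_1-x_1,y_2-x_2,y_3-x_3)=\bar v\,(y_0-x_0)$). Let $Light(k,c)$ say: for all $\bar x,\bar y\in Q^4$, some $p\in Ph$ has $\bar x,\bar y\in wl_k(p)$ iff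 $space(\bar x,\bar y)=c\cdot time(\bar x,\bar y)$. $Ether(e)$ iff $IOb(e)$ and $Light(e,c)$ for some $c>0$. $c=\mathfrak c_e$ iff for every $e\in Ether$, every $p\in Ph$ for which $speed_e(p)$ is defined has $speed_e(p)=c$. $c=\mathfrak c$ iff $c>0$ and $Light(k,c)$ for every $k\in IOb$. $Triv$ is the set of affine maps of $Q^4$ (given by their 20 parameters) that are a translation on the time coordinate and an isometry on the space coordinates: $T(\bar x)_0-T(\bar y)_0=x_0-y_0$ and $space(T\bar x,T\bar y)=space(\bar x,\bar y)$ for all $\bar x,\bar y$. **Radarization.** For $\bar v\in Q^3$ with $v=|\bar v|<c$ let $Rad_{\bar v}=R_{\bar v}^{-1}\circ S_v\circ E_v\circ G_v\circ R_{\bar v}$ with $s=\sqrt{1-v^2/c^2}$, where $G_v(t,x,y,z)=(t,x+vt,y,z)$, $E_v(t,x,y,z)=\big(\tfrac{t-vx/c^2}{s^2},\tfrac{x-vt}{s^2},\tfrac ys,\tfrac zs\big)$, $S_v$ is multiplication by $s$, and $R_{\bar v}$ fixes the time coordinate and acts on space as follows: if $v_y\ne0$ or $v_z\neq 0$, by the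 orthogonal matrix $$\frac1{|\bar v|}\begin{pmatrix}-v_x&-v_y&-v_z\\ v_y&-v_x-\frac{v_z^2(|\bar v|-v_x)}{v_y^2+v_z^2}&\frac{v_yv_z(|\bar v|-v_x)}{v_y^2+v_z^2}\\ v_z&\frac{v_yv_z(|\bar v|-v_x)}{v_y^2+v_z^2}&-v_x-\frac{v_y^2(|\bar v|-v_x)}{v_y^2+v_z^2}\end{pmatrix};$$ if $v_y=v_z=0$, as the identity when $v_x\le0$ and as $-1$ when $v_x>0$. In the classical language $c$ is $\mathfrak c_e$, in the relativistic one it is $\mathfrak c$. **Axioms.** $Kin_{Full}$ consists of - AxEField: $(Q,+,\cdot,\le)$ is a Euclidean field (a linearly ordered field in which every positive element is a square); - AxEv: $\forall k,h\in IOb\ \forall\bar x\ \exists\bar y\ ev_k(\bar x)=ev_h(\bar y)$; - AxSelf: for $k\in IOb$, $W(k,k,\bar x)\leftrightarrow x_1=x_2=x_3=0$; - AxSymD: for $k,k'\in IOb$, if $time(\bar x,\bar y)=time(\bar x',\bar y')=0$, $ev_k(\bar x)=ev_{k'}(\bar x')$ and $ev_k(\bar y)=ev_{k'}(\bar y')$,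 then $space(\bar x,\bar y)=space(\bar x',\bar y')$; - AxLine: for $k,h\in IOb$ and $\bar x,\bar y,\bar z\in wl_k(h)$ there is $a\in Q$ with $\bar z-\bar x=a(\bar y-\bar x)$ or $\bar y-\bar z=a(\bar z-\bar x)$; - AxTriv: $\forall T\in Triv\ \forall k\in IOb\ \exists k'\in IOb\ w_{kk'}=T$; - AxNoAcc: if $W(k,b,\bar x)$ for some $b,\bar x$, then $IOb(k)$. $ClassicalKin^{STL}_{Full}$ is $Kin_{Full}$ together with - AxAbsTime: for $k,k'\in IOb$, if $ev_k(\bar x)=ev_{k'}(\bar x')$ and $ev_k(\bar y)=ev_{k'}(\bar y')$, then $time(\bar x,\bar y)=time(\bar x',\bar y')$; - AxEther: $\exists e\ Ether(e)$; - AxNoFTL: $\forall k\in IOb\ \forall e\in Ether\ speed_e(k)<\mathfrak c_e$; - AxThExp$^{STL}$: $\exists h\ IOb(h)$, and for all $e\in Ether$ and $\bar x,\bar y$, if $space(\bar x,\bar y)<\mathfrak c_e\cdot time(\bar x,\bar y)$ then $\bar x,\bar y\in wl_e(k)$ for some $k\in IOb$. $SpecRel^e_{Full}$ is $Kin_{Full}$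 together with - AxPh$_c$: there is $c>0$ with $Light(k,c)$ for all $k\in IOb$; - AxThExp: $\exists h\ IOb(h)$, and for all $k\in IOb$ and $\bar x,\bar y$, if $space(\bar x,\bar y)<\mathfrak c\cdot time(\bar x,\bar y)$ then $\bar x,\bar y\in wl_k(k')$ for some $k'\in IOb$; - AxPrimitiveEther: there is $e\in IOb$ such that for every body $k$: $E(k)$ iff $IOb(k)$ and $w_{ek}$ is a trivial transformation, possibly composed with the reversal of time $x_0\mapsto-x_0$. **Translations.** Both translate $+,\cdot,\le$ and $Ph$ into themselves. Further - $Tr_+(IOb(k))$ is $IOb(k)\wedge\forall e\in Ether\,[speed_e(k)<\mathfrak c_e]$; - $Tr_+(W(k,b,\bar x))$ is $\forall e\in Ether\,[W(k,b,Rad^{-1}_{\bar v_k(e)}(\bar x))]$; - $Tr_+(E(k))$ is $Ether(k)$; - $Tr'_+(IOb(k))$ is $IOb(k)$; - $Tr'_+(W(k,b,\bar x))$ is $\forall e\in E\,[W(k,b,Rad_{\bar v_k(e)}(\bar x))]$. -/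

import Mathlib

namespace Kinematics

/-! ## Two-sorted first-order logic

There are two sorts: bodies `B`, whose only terms are variables, and quantities `Q`, whose terms are
built from variables with `+` and `·`. Each sort has its own variables, numbered by de Bruijn
indices: a quantifier of a sort binds the variable `0` of that sort and shifts the others of that
sort by one. `R m n` is the type of relation symbols with `m` body places and `n` quantity places;
the two equalities and `≤` are always present. -/

/-- Quantity terms. -/
inductive QTerm : Type
  | var (i : ℕ) : QTerm
  | add (s t : QTerm) : QTerm
  | mul (s t : QTerm) : QTerm

/-- Simultaneous substitution in quantity terms. -/
def QTerm.subst (σ : ℕ → QTerm) : QTerm → QTerm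
  | .var i => σ i
  | .add s t => .add (s.subst σ) (t.subst σ)
  | .mul s t => .mul (s.subst σ) (t.subst σ)

/-- All variables of the term are smaller than `d`. -/
def QTerm.closedAt (d : ℕ) : QTerm → Bool
  | .var i => decide (i < d)
  | .add s t => s.closedAt d && t.closedAt d
  | .mul s t => s.closedAt d && t.closedAt d

/-- Formulas. -/
inductive Form (R : ℕ → ℕ → Type) : Type
  | falsum : Form R
  | eqB (k b : ℕ) : Form R
  | eqQ (s t : QTerm) : Form R
  | le (s t : QTerm) : Form R
  | rel {m n : ℕ} (r : R m n) (bs : Fin m → ℕ) (qs : Fin n → QTerm) : Form R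
  | imp (φ ψ : Form R) : Form R
  | allB (φ : Form R) : Form R
  | allQ (φ : Form R) : Form R

namespace Form

variable {R : ℕ → ℕ → Type}

def neg (φ : Form R) : Form R := imp φ falsum
def or (φ ψ : Form R) : Form R := imp (neg φ) ψ
def and (φ ψ : Form R) : Form R := neg (imp φ (neg ψ))
def iff (φ ψ : Form R) : Form R := and (imp φ ψ) (imp ψ φ)
def exB (φ : Form R) : Form R := neg (allB (neg φ))
def exQ (φ : Form R) : Form R := neg (allQ (neg φ))

/-- Passing a body substitution under a body quantifier. -/
def upB (σ : ℕ → ℕ) : ℕ → ℕ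
  | 0 => 0
  | i + 1 => σ i + 1

/-- Passing a quantity substitution under a quantity quantifier. -/
def upQ (σ : ℕ → QTerm) : ℕ → QTerm
  | 0 => .var 0
  | i + 1 => (σ i).subst fun j => .var (j + 1)

/-- Simultaneous capture-avoiding substitution for the free variables of both sorts. -/
def subst (σ : ℕ → ℕ) (τ : ℕ → QTerm) : Form R → Form R
  | falsum => falsum
  | eqB k b => eqB (σ k) (σ b)
  | eqQ s t => eqQ (s.subst τ) (t.subst τ)
  | le s t => le (s.subst τ) (t.subst τ)
  | rel r bs qs => rel r (fun i => σ (bs i)) (fun i => (qs i).subst τ)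
  | imp φ ψ => imp (φ.subst σ τ) (ψ.subst σ τ)
  | allB φ => allB (φ.subst (upB σ) τ)
  | allQ φ => allQ (φ.subst σ (upQ τ))

/-- The formula with all its free body variables renamed so that variable `0` becomes unused. -/
def liftB (φ : Form R) : Form R := φ.subst (fun i => i + 1) .var

/-- The formula with all its free quantity variables renamed so that variable `0` becomes unused. -/
def liftQ (φ : Form R) : Form R := φ.subst id fun i => .var (i + 1)

/-- `φ[k]`: the body `k` for the body variable `0` (the variable of an outer quantifier). -/
def instB (k : ℕ) (φ : Form R) : Form R :=
  φ.subst (fun i => match i with | 0 => k | j + 1 => j) .var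

/-- `φ[t]`: the term `t` for the quantity variable `0` (the variable of an outer quantifier). -/
def instQ (t : QTerm) (φ : Form R) : Form R :=
  φ.subst id (fun i => match i with | 0 => t | j + 1 => .var j)

/-- All free body variables are smaller than `m`, all free quantity variables smaller than `n`. -/
def closedAt : ℕ → ℕ → Form R → Bool
  | _, _, falsum => true
  | m, _, eqB k b => decide (k < m) && decide (b < m)
  | _, n, eqQ s t => s.closedAt n && t.closedAt n
  | _, n, le s t => s.closedAt n && t.closedAt n
  | m, n, rel _ bs qs =>
      (List.ofFn bs).all (fun k => decide (k < m)) && (List.ofFn qs).all (QTerm.closedAt n)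
  | m, n, imp φ ψ => φ.closedAt m n && ψ.closedAt m n
  | m, n, allB φ => φ.closedAt (m + 1) n
  | m, n, allQ φ => φ.closedAt m (n + 1)

end Form

/-- Syntactic consequence `Γ ⊢ φ`: classical natural deduction for two-sorted first-order logic
with equality. -/
inductive Proves {R : ℕ → ℕ → Type} : Set (Form R) → Form R → Prop
  | hyp {Γ : Set (Form R)} {φ : Form R} : φ ∈ Γ → Proves Γ φ
  | impI {Γ : Set (Form R)} {φ ψ : Form R} : Proves (insert φ Γ) ψ → Proves Γ (.imp φ ψ)
  | impE {Γ : Set (Form R)} {φ ψ : Form R} : Proves Γ (.imp φ ψ) → Proves Γ φ → Proves Γ ψ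
  | raa {Γ : Set (Form R)} {φ : Form R} : Proves (insert (.neg φ) Γ) .falsum → Proves Γ φ
  | allBI {Γ : Set (Form R)} {φ : Form R} : Proves (Form.liftB '' Γ) φ → Proves Γ (.allB φ)
  | allBE {Γ : Set (Form R)} {φ : Form R} (k : ℕ) : Proves Γ (.allB φ) → Proves Γ (φ.instB k)
  | allQI {Γ : Set (Form R)} {φ : Form R} : Proves (Form.liftQ '' Γ) φ → Proves Γ (.allQ φ)
  | allQE {Γ : Set (Form R)} {φ : Form R} (t : QTerm) : Proves Γ (.allQ φ) → Proves Γ (φ.instQ t)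
  | reflB {Γ : Set (Form R)} (k : ℕ) : Proves Γ (.eqB k k)
  | reflQ {Γ : Set (Form R)} (t : QTerm) : Proves Γ (.eqQ t t)
  | substB {Γ : Set (Form R)} {k b : ℕ} (φ : Form R) :
      Proves Γ (.eqB k b) → Proves Γ (φ.instB k) → Proves Γ (φ.instB b)
  | substQ {Γ : Set (Form R)} {s t : QTerm} (φ : Form R) :
      Proves Γ (.eqQ s t) → Proves Γ (φ.instQ s) → Proves Γ (φ.instQ t)

/-- A translation assigns to every relation symbol a formula whose free variables are its places.
Place number `i` of a sort is the free variable that is `i`-th counted from the outside, so index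
`m - 1 - i` if the symbol has `m` places of that sort. -/
structure Translation (R R' : ℕ → ℕ → Type) where
  form : ∀ {m n : ℕ}, R m n → Form R'
  closedAt : ∀ {m n : ℕ} (r : R m n), (form r).closedAt m n = true

/-- The translation of formulas: equalities and the mathematical symbols are translated into
themselves, connectives and quantifiers are preserved. -/
def Translation.tr {R R' : ℕ → ℕ → Type} (T : Translation R R') : Form R → Form R'
  | .falsum => .falsum
  | .eqB k b => .eqB k b
  | .eqQ s t => .eqQ s t
  | .le s t => .le s t
  | .rel (m := m) (n := n) r bs qs =>
      (T.form r).subst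
        (fun i => if h : i < m then bs (Fin.rev ⟨i, h⟩) else i)
        (fun i => if h : i < n then qs (Fin.rev ⟨i, h⟩) else .var i)
  | .imp φ ψ => .imp (T.tr φ) (T.tr ψ)
  | .allB φ => .allB (T.tr φ)
  | .allQ φ => .allQ (T.tr φ)

/-- `T` is an interpretation of `Th₁` in `Th₂`. -/
def IsInterpretation {R₁ R₂ : ℕ → ℕ → Type} (Th₁ : Set (Form R₁)) (Th₂ : Set (Form R₂))
    (T : Translation R₁ R₂) : Prop :=
  ∀ φ : Form R₁, Proves Th₁ φ → Proves Th₂ (T.tr φ)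

/-- The interpretation `T` of `Th₁` in `Th₂` is a definitional equivalence with inverse `T'`. -/
def IsDefinitionalEquivalenceWith {R₁ R₂ : ℕ → ℕ → Type} (Th₁ : Set (Form R₁))
    (Th₂ : Set (Form R₂)) (T : Translation R₁ R₂) (T' : Translation R₂ R₁) : Prop :=
  IsInterpretation Th₁ Th₂ T ∧ IsInterpretation Th₂ Th₁ T' ∧
    (∀ φ : Form R₁, Proves Th₁ (.iff (T'.tr (T.tr φ)) φ)) ∧
    (∀ ψ : Form R₂, Proves Th₂ (.iff (T.tr (T'.tr ψ)) ψ))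

/-! ## Writing formulas

To write formulas with readable variables we use `Pre R`: a formula that is waiting for the numbers
`d`, `q` of body and quantity variables in whose scope it stands. Here variables are levels, that is,
they are counted from the outside: at depth `d` the variable of level `l` has index `d - 1 - l`, and
a new quantifier at depth `d` binds level `d`. So `Pre.allB fun k => …` binds `k`. -/

/-- A formula waiting for its depths. -/
abbrev Pre (R : ℕ → ℕ → Type) : Type := ℕ → ℕ → Form R

/-- A body variable, given by its level. -/
structure BVar where
  lvl : ℕ

/-- Expressions for quantities, with the partial operations that are definable in a Euclidean
field; the variables are levels. -/
inductive Expr : Type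
  | var (l : ℕ) : Expr
  | zero : Expr
  | one : Expr
  | add (a b : Expr) : Expr
  | sub (a b : Expr) : Expr
  | mul (a b : Expr) : Expr
  | div (a b : Expr) : Expr
  | sqrt (a : Expr) : Expr
  | abs (a : Expr) : Expr

instance : Zero Expr := ⟨.zero⟩
instance : One Expr := ⟨.one⟩
instance : Add Expr := ⟨.add⟩
instance : Sub Expr := ⟨.sub⟩
instance : Mul Expr := ⟨.mul⟩
instance : Div Expr := ⟨.div⟩

namespace Pre

variable {R : ℕ → ℕ → Type}

def neg (φ : Pre R) : Pre R := fun d q => (φ d q).neg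
def imp (φ ψ : Pre R) : Pre R := fun d q => (φ d q).imp (ψ d q)
def and (φ ψ : Pre R) : Pre R := fun d q => (φ d q).and (ψ d q)
def or (φ ψ : Pre R) : Pre R := fun d q => (φ d q).or (ψ d q)
def iff (φ ψ : Pre R) : Pre R := fun d q => (φ d q).iff (ψ d q)
def allB (f : BVar → Pre R) : Pre R := fun d q => .allB (f ⟨d⟩ (d + 1) q)
def exB (f : BVar → Pre R) : Pre R := fun d q => .exB (f ⟨d⟩ (d + 1) q)
def allQ (f : Expr → Pre R) : Pre R := fun d q => .allQ (f (.var q) d (q + 1))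
def exQ (f : Expr → Pre R) : Pre R := fun d q => .exQ (f (.var q) d (q + 1))

/-- The index of a body variable at depth `d`. -/
def idxB (d : ℕ) (k : BVar) : ℕ := d - 1 - k.lvl

/-- A term whose variables are levels, with indices at depth `q`. -/
def idxQ (q : ℕ) (t : QTerm) : QTerm := t.subst fun l => .var (q - 1 - l)

/-- Atomic formulas about terms whose variables are levels. -/
def eqT (s t : QTerm) : Pre R := fun _ q => .eqQ (idxQ q s) (idxQ q t)
def leT (s t : QTerm) : Pre R := fun _ q => .le (idxQ q s) (idxQ q t)

/-- `∃ z, …` with a term instead of an expression. -/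
def exT (f : QTerm → Pre R) : Pre R := fun d q => .exQ (f (.var q) d (q + 1))

/-- The term is `0`. -/
def isZero (t : QTerm) : Pre R := eqT (.add t t) t

/-- The term is `1`. -/
def isOne (t : QTerm) : Pre R := and (eqT (.mul t t) t) (neg (isZero t))

/-- The term is `≥ 0`. -/
def nonnegT (t : QTerm) : Pre R := exT fun z => and (isZero z) (leT z t)

end Pre

open Pre in
/-- `a.elim K` says: the value of `a` is defined and satisfies `K`. This is how partial functions
are eliminated from atomic formulas. -/
def Expr.elim {R : ℕ → ℕ → Type} : Expr → (QTerm → Pre R) → Pre R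
  | .var l, K => K (.var l)
  | .zero, K => exT fun z => and (isZero z) (K z)
  | .one, K => exT fun u => and (isOne u) (K u)
  | .add a b, K => a.elim fun s => b.elim fun t => K (.add s t)
  | .sub a b, K => a.elim fun s => b.elim fun t => exT fun r => and (eqT (.add r t) s) (K r)
  | .mul a b, K => a.elim fun s => b.elim fun t => K (.mul s t)
  | .div a b, K => a.elim fun s => b.elim fun t => exT fun r =>
      and (and (neg (isZero t)) (eqT (.mul r t) s)) (K r)
  | .sqrt a, K => a.elim fun s => exT fun r =>
      and (and (nonnegT r) (eqT (.mul r r) s)) (K r)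
  | .abs a, K => a.elim fun s => exT fun r =>
      and (and (nonnegT r) (or (eqT r s) (isZero (.add r s)))) (K r)

namespace Pre

variable {R : ℕ → ℕ → Type}

def eq (a b : Expr) : Pre R := a.elim fun s => b.elim fun t => eqT s t
def le (a b : Expr) : Pre R := a.elim fun s => b.elim fun t => leT s t
def lt (a b : Expr) : Pre R := a.elim fun s => b.elim fun t => and (leT s t) (neg (eqT s t))

end Pre

infixr:30 " ⇒' " => Pre.imp
infix:28 " ⇔' " => Pre.iff
infixr:35 " ∧' " => Pre.and
infixr:33 " ∨' " => Pre.or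
prefix:40 "¬' " => Pre.neg
infix:50 " =' " => Pre.eq
infix:50 " ≤' " => Pre.le
infix:50 " <' " => Pre.lt

/-! ## The languages and the defined notions -/

/-- The relation symbols `IOb`, `Ph`, `W` of the language of kinematics, and for `ε = true` in
addition `E`. -/
inductive Sym : Bool → ℕ → ℕ → Type
  | IOb {ε : Bool} : Sym ε 1 0
  | Ph {ε : Bool} : Sym ε 1 0
  | W {ε : Bool} : Sym ε 2 4
  | E : Sym true 1 0

/-- Elements of `Q⁴`; coordinate `0` is time. -/
abbrev Pt : Type := Fin 4 → Expr

/-- Elements of `Q³`. -/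
abbrev Vec : Type := Fin 3 → Expr

open Pre

variable {ε : Bool}

/-- `k` is an inertial observer. -/
def IOb (k : BVar) : Pre (Sym ε) := fun d _ => .rel Sym.IOb ![idxB d k] ![]

/-- `p` is a light signal. -/
def Ph (p : BVar) : Pre (Sym ε) := fun d _ => .rel Sym.Ph ![idxB d p] ![]

/-- `k` is a primitive ether observer. -/
def E (k : BVar) : Pre (Sym true) := fun d _ => .rel Sym.E ![idxB d k] ![]

/-- `W(k,b,x)`: the observer `k` coordinatizes the body `b` at `x`. -/
def W (k b : BVar) (x : Pt) : Pre (Sym ε) :=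
  (x 0).elim fun t₀ => (x 1).elim fun t₁ => (x 2).elim fun t₂ => (x 3).elim fun t₃ =>
    fun d q => .rel Sym.W ![idxB d k, idxB d b] ![idxQ q t₀, idxQ q t₁, idxQ q t₂, idxQ q t₃]

def allPt (f : Pt → Pre (Sym ε)) : Pre (Sym ε) :=
  allQ fun x₀ => allQ fun x₁ => allQ fun x₂ => allQ fun x₃ => f ![x₀, x₁, x₂, x₃]

def exPt (f : Pt → Pre (Sym ε)) : Pre (Sym ε) :=
  exQ fun x₀ => exQ fun x₁ => exQ fun x₂ => exQ fun x₃ => f ![x₀, x₁, x₂, x₃]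

def exVec (f : Vec → Pre (Sym ε)) : Pre (Sym ε) :=
  exQ fun v₁ => exQ fun v₂ => exQ fun v₃ => f ![v₁, v₂, v₃]

/-- Quantifiers bounded by inertial observers. -/
def allIOb (f : BVar → Pre (Sym ε)) : Pre (Sym ε) := allB fun k => IOb k ⇒' f k
def exIOb (f : BVar → Pre (Sym ε)) : Pre (Sym ε) := exB fun k => IOb k ∧' f k

/-- Equality of points. -/
def eqPt (x y : Pt) : Pre (Sym ε) :=
  (x 0 =' y 0) ∧' (x 1 =' y 1) ∧' (x 2 =' y 2) ∧' (x 3 =' y 3)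

def space (x y : Pt) : Expr :=
  .sqrt ((x 1 - y 1) * (x 1 - y 1) + (x 2 - y 2) * (x 2 - y 2) + (x 3 - y 3) * (x 3 - y 3))

def time (x y : Pt) : Expr := .abs (x 0 - y 0)

/-- `ev_k(x) = ev_h(y)`: the same bodies are coordinatized. As a relation between `x` and `y` this
is the worldview transformation `w_{kh}`. -/
def sameEvent (k h : BVar) (x y : Pt) : Pre (Sym ε) := allB fun b => W k b x ⇔' W h b y

/-- `speed_k(b) = v`. -/
def speed (k b : BVar) (v : Expr) : Pre (Sym ε) :=
  (exPt fun x => exPt fun y => W k b x ∧' W k b y ∧' ¬' eqPt x y) ∧'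
  (allPt fun x => allPt fun y => (W k b x ∧' W k b y) ⇒' (space x y =' v * time x y))

/-- `v_k(b) = v`. -/
def velocity (k b : BVar) (v : Vec) : Pre (Sym ε) :=
  (exPt fun x => exPt fun y => W k b x ∧' W k b y ∧' ¬' eqPt x y) ∧'
  (allPt fun x => allPt fun y => (W k b x ∧' W k b y) ⇒'
    ((y 1 - x 1 =' v 0 * (y 0 - x 0)) ∧' (y 2 - x 2 =' v 1 * (y 0 - x 0)) ∧'
      (y 3 - x 3 =' v 2 * (y 0 - x 0))))

/-- For `k` the light signals move with speed `c` in every direction everywhere. -/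
def lightSpeed (k : BVar) (c : Expr) : Pre (Sym ε) :=
  allPt fun x => allPt fun y =>
    (exB fun p => Ph p ∧' W k p x ∧' W k p y) ⇔' (space x y =' c * time x y)

/-- `e` is an ether observer. -/
def Ether (e : BVar) : Pre (Sym ε) := IOb e ∧' exQ fun c => (0 <' c) ∧' lightSpeed e c

/-- `c = 𝔠ₑ`: `c` is the speed of light for ether observers, that is, it is the speed, for every
ether observer, of every light signal that has a speed. -/
def isCe (c : Expr) : Pre (Sym ε) :=
  allB fun e => Ether e ⇒' allB fun p => Ph p ⇒' allQ fun v => speed e p v ⇒' (v =' c)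

/-- `c = 𝔠`: `c` is the speed of light of special relativity. -/
def isC (c : Expr) : Pre (Sym ε) := (0 <' c) ∧' allIOb fun k => lightSpeed k c

/-! ### Trivial transformations -/

/-- The affine map with matrix rows `M 0`, …, `M 3` and translation vector `z`. -/
def affine (M : Fin 4 → Pt) (z : Pt) (x : Pt) : Pt := fun i =>
  M i 0 * x 0 + M i 1 * x 1 + M i 2 * x 2 + M i 3 * x 3 + z i

/-- Quantification over affine maps, by their 20 parameters. -/
def allAffine (f : (Pt → Pt) → Pre (Sym ε)) : Pre (Sym ε) :=
  allPt fun m₀ => allPt fun m₁ => allPt fun m₂ => allPt fun m₃ => allPt fun z =>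
    f (affine ![m₀, m₁, m₂, m₃] z)

def exAffine (f : (Pt → Pt) → Pre (Sym ε)) : Pre (Sym ε) :=
  exPt fun m₀ => exPt fun m₁ => exPt fun m₂ => exPt fun m₃ => exPt fun z =>
    f (affine ![m₀, m₁, m₂, m₃] z)

/-- The affine map `T` is trivial: a translation along the time axis and an isometry of space. -/
def Triv (T : Pt → Pt) : Pre (Sym ε) :=
  allPt fun x => allPt fun y =>
    (T x 0 - T y 0 =' x 0 - y 0) ∧' (space (T x) (T y) =' space x y)

/-- The affine map `T` is the composition of the reversal of time `x₀ ↦ -x₀` and a trivial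
transformation. -/
def TrivReversed (T : Pt → Pt) : Pre (Sym ε) :=
  allPt fun x => allPt fun y =>
    (T x 0 - T y 0 =' y 0 - x 0) ∧' (space (T x) (T y) =' space x y)

/-- `w_{kh} = T`. -/
def worldviewIs (k h : BVar) (T : Pt → Pt) : Pre (Sym ε) :=
  allPt fun x => allPt fun y => sameEvent k h x y ⇔' eqPt y (T x)

/-! ### Radarization -/

/-- The matrix of the spatial orthogonal map `R_v` in the case `v_y ≠ 0` or `v_z ≠ 0`; `u` is `|v|`. -/
def rotMatrix (u : Expr) (v : Vec) (x : Pt) : Pt :=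
  let r := v 1 * v 1 + v 2 * v 2
  let a := u - v 0
  ![x 0,
    (0 - v 0 * x 1 - v 1 * x 2 - v 2 * x 3) / u,
    (v 1 * x 1 + (0 - v 0 - v 2 * v 2 * a / r) * x 2 + v 1 * v 2 * a / r * x 3) / u,
    (v 2 * x 1 + v 1 * v 2 * a / r * x 2 + (0 - v 0 - v 1 * v 1 * a / r) * x 3) / u]

/-- `R_v(x) = y`, where `u` is `|v|`. -/
def Rot (u : Expr) (v : Vec) (x y : Pt) : Pre (Sym ε) :=
  (¬' ((v 1 =' 0) ∧' (v 2 =' 0)) ∧' eqPt y (rotMatrix u v x)) ∨'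
  ((v 0 ≤' 0) ∧' (v 1 =' 0) ∧' (v 2 =' 0) ∧' eqPt y x) ∨'
  ((0 <' v 0) ∧' (v 1 =' 0) ∧' (v 2 =' 0) ∧' eqPt y ![x 0, 0 - x 1, 0 - x 2, 0 - x 3])

/-- The Galilean boost `G_v`, for a speed `u`. -/
def boostG (u : Expr) (x : Pt) : Pt := ![x 0, u * x 0 + x 1, x 2, x 3]

/-- The synchronisation map `E_v`, for a speed `u`. -/
def syncE (c u : Expr) (x : Pt) : Pt :=
  let a := 1 - u * u / (c * c)
  ![x 0 / a - u / (c * c) / a * x 1, x 1 / a - u / a * x 0, x 2 / .sqrt a, x 3 / .sqrt a]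

/-- The scaling `S_v`, for a speed `u`. -/
def scaleS (c u : Expr) (x : Pt) : Pt := fun i => .sqrt (1 - u * u / (c * c)) * x i

/-- `Rad_v(x) = y` for light speed `c`, where `Rad_v = R_v⁻¹ ∘ S_v ∘ E_v ∘ G_v ∘ R_v` is defined
for `|v| < c`. -/
def Rad (c : Expr) (v : Vec) (x y : Pt) : Pre (Sym ε) :=
  exQ fun u => (u =' .sqrt (v 0 * v 0 + v 1 * v 1 + v 2 * v 2)) ∧' (u <' c) ∧'
    exPt fun x₁ => exPt fun x₂ => exPt fun x₃ => exPt fun x₄ =>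
      Rot u v x x₁ ∧' eqPt x₂ (boostG u x₁) ∧' eqPt x₃ (syncE c u x₂) ∧'
        eqPt x₄ (scaleS c u x₃) ∧' Rot u v y x₄

/-- `Rad_{v_k(e)}(x) = y` (or `Rad_{v_k(e)}⁻¹(y) = x`), for the light speed defined by `isLight`. -/
def RadAt (isLight : Expr → Pre (Sym ε)) (k e : BVar) (x y : Pt) : Pre (Sym ε) :=
  exVec fun v => velocity k e v ∧' exQ fun c => isLight c ∧' Rad c v x y

/-! ## The axioms -/

def AxEField : Pre (Sym ε) :=
  exQ fun o => exQ fun i =>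
    (allQ fun x => allQ fun y => allQ fun z => (x + y) + z =' x + (y + z)) ∧'
    (allQ fun x => allQ fun y => x + y =' y + x) ∧'
    (allQ fun x => x + o =' x) ∧'
    (allQ fun x => exQ fun y => x + y =' o) ∧'
    (allQ fun x => allQ fun y => allQ fun z => (x * y) * z =' x * (y * z)) ∧'
    (allQ fun x => allQ fun y => x * y =' y * x) ∧'
    (allQ fun x => x * i =' x) ∧'
    (¬' (i =' o)) ∧'
    (allQ fun x => ¬' (x =' o) ⇒' exQ fun y => x * y =' i) ∧'
    (allQ fun x => allQ fun y => allQ fun z => x * (y + z) =' x * y + x * z) ∧'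
    (allQ fun x => x ≤' x) ∧'
    (allQ fun x => allQ fun y => ((x ≤' y) ∧' (y ≤' x)) ⇒' (x =' y)) ∧'
    (allQ fun x => allQ fun y => allQ fun z => ((x ≤' y) ∧' (y ≤' z)) ⇒' (x ≤' z)) ∧'
    (allQ fun x => allQ fun y => (x ≤' y) ∨' (y ≤' x)) ∧'
    (allQ fun x => allQ fun y => allQ fun z => (x ≤' y) ⇒' (x + z ≤' y + z)) ∧'
    (allQ fun x => allQ fun y => ((o ≤' x) ∧' (o ≤' y)) ⇒' (o ≤' x * y)) ∧'
    (allQ fun x => (o <' x) ⇒' exQ fun y => y * y =' x)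

def AxEv : Pre (Sym ε) :=
  allIOb fun k => allIOb fun h => allPt fun x => exPt fun y => sameEvent k h x y

def AxLine : Pre (Sym ε) :=
  allIOb fun k => allIOb fun h => allPt fun x => allPt fun y => allPt fun z =>
    (W k h x ∧' W k h y ∧' W k h z) ⇒' exQ fun a =>
      eqPt (fun i => z i - x i) (fun i => a * (y i - x i)) ∨'
      eqPt (fun i => y i - z i) (fun i => a * (z i - x i))

def AxSelf : Pre (Sym ε) :=
  allIOb fun k => allPt fun x => W k k x ⇔' ((x 1 =' 0) ∧' (x 2 =' 0) ∧' (x 3 =' 0))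

def AxSymD : Pre (Sym ε) :=
  allIOb fun k => allIOb fun k' =>
    allPt fun x => allPt fun y => allPt fun x' => allPt fun y' =>
      ((time x y =' 0) ∧' (time x' y' =' 0) ∧' sameEvent k k' x x' ∧' sameEvent k k' y y') ⇒'
        (space x y =' space x' y')

def AxTriv : Pre (Sym ε) :=
  allAffine fun T => Triv T ⇒' allIOb fun k => exIOb fun k' => worldviewIs k k' T

/-- Every body that coordinatizes some body somewhere is an inertial observer. -/
def AxNoAcc : Pre (Sym ε) :=
  allB fun k => (exB fun b => exPt fun x => W k b x) ⇒' IOb k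

def AxAbsTime : Pre (Sym ε) :=
  allIOb fun k => allIOb fun k' =>
    allPt fun x => allPt fun y => allPt fun x' => allPt fun y' =>
      (sameEvent k k' x x' ∧' sameEvent k k' y y') ⇒' (time x y =' time x' y')

def AxEther : Pre (Sym ε) := exB fun e => Ether e

def AxNoFTL : Pre (Sym ε) :=
  allIOb fun k => allB fun e => Ether e ⇒'
    exQ fun v => speed e k v ∧' exQ fun c => isCe c ∧' (v <' c)

def AxThExpSTL : Pre (Sym ε) :=
  (exB fun h => IOb h) ∧'
  (allB fun e => Ether e ⇒' allPt fun x => allPt fun y =>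
    (exQ fun c => isCe c ∧' (space x y <' c * time x y)) ⇒'
      exIOb fun k => W e k x ∧' W e k y)

def AxPhc : Pre (Sym ε) := exQ fun c => (0 <' c) ∧' allIOb fun k => lightSpeed k c

def AxThExp : Pre (Sym ε) :=
  (exB fun h => IOb h) ∧'
  (allIOb fun k => allPt fun x => allPt fun y =>
    (exQ fun c => isC c ∧' (space x y <' c * time x y)) ⇒'
      exIOb fun k' => W k k' x ∧' W k k' y)

/-- The primitive ether is the class of all inertial observers that are stationary with respect to
some inertial observer `e`: their worldview transformation from `e` is trivial up to the direction
of time. -/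
def AxPrimitiveEther : Pre (Sym true) :=
  exIOb fun e => allB fun k =>
    (IOb k ∧' exAffine fun T => (Triv T ∨' TrivReversed T) ∧' worldviewIs e k T) ⇔' E k

/-- The sentence written by a `Pre`. -/
def sentence {R : ℕ → ℕ → Type} (φ : Pre R) : Form R := φ 0 0

/-- `Kin_Full`. -/
def KinFull (ε : Bool) : Set (Form (Sym ε)) :=
  {sentence AxEField, sentence AxEv, sentence AxSelf, sentence AxSymD, sentence AxLine,
    sentence AxTriv, sentence AxNoAcc}

/-- `ClassicalKin^STL_Full`. -/
def ClassicalKinSTL : Set (Form (Sym false)) :=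
  KinFull false ∪ {sentence AxAbsTime, sentence AxEther, sentence AxNoFTL, sentence AxThExpSTL}

/-- `SpecRel^e_Full`. -/
def SpecRelE : Set (Form (Sym true)) :=
  KinFull true ∪ {sentence AxPhc, sentence AxThExp, sentence AxPrimitiveEther}

/-! ## The translations -/

/-- The formulas that `Tr₊` assigns to the relation symbols. -/
def trPlusForm : {m n : ℕ} → Sym true m n → Form (Sym false)
  | _, _, .IOb => (IOb ⟨0⟩ ∧' allB fun e => Ether e ⇒'
      exQ fun v => speed e ⟨0⟩ v ∧' exQ fun c => isCe c ∧' (v <' c)) 1 0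
  | _, _, .Ph => Ph ⟨0⟩ 1 0
  | _, _, .W => (allB fun e => Ether e ⇒' exPt fun y =>
      RadAt isCe ⟨0⟩ e y ![.var 0, .var 1, .var 2, .var 3] ∧' W ⟨0⟩ ⟨1⟩ y) 2 4
  | _, _, .E => Ether ⟨0⟩ 1 0

/-- The formulas that `Tr₊'` assigns to the relation symbols. -/
def trPlusForm' : {m n : ℕ} → Sym false m n → Form (Sym true)
  | _, _, .IOb => IOb ⟨0⟩ 1 0
  | _, _, .Ph => Ph ⟨0⟩ 1 0
  | _, _, .W => (allB fun e => E e ⇒' exPt fun y =>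
      RadAt isC ⟨0⟩ e ![.var 0, .var 1, .var 2, .var 3] y ∧' W ⟨0⟩ ⟨1⟩ y) 2 4

/-- `Tr₊`. -/
def TrPlus : Translation (Sym true) (Sym false) where
  form := trPlusForm
  closedAt := by
    intro m n r
    cases r <;> decide +kernel

/-- `Tr₊'`. -/
def TrPlus' : Translation (Sym false) (Sym true) where
  form := trPlusForm'
  closedAt := by
    intro m n r
    cases r <;> decide +kernel

end Kinematics

/-! Soundness and completeness turn the statement about provability into one about models. A
translation `T` defines, in every structure `M` for its target language, a structure `T.pull M` for
its source language, and `M` satisfies `T.tr φ` exactly if `T.pull M` satisfies `φ`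
(`Translation.sat_tr`). So it suffices that both pulls take models to models and that pulling twice
gives back the relations of the model one started from (`isDefinitionalEquivalenceWith_of_models`).
Completeness is Henkin's argument: the languages are countable, and free variables serve as
witnesses because the axioms are sentences. In a model the quantities form a Euclidean field, over
which formulas, with their partial functions eliminated, are evaluated to ordinary statements.

The geometric reason is that models of the two theories are the same data read through different
boosts. Fix a suitable ether observer `e`. The worldview transformation from `e` to an observer `k`
has the form `L v ∘ T`, where `T` is trivial up to reversal of time, `v` is the velocity of `e` as
seen by `k`, slower than light, and `L v` is a boost: the Galilean one, `gam v`, in classical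
kinematics, the Lorentz boost `lor c v` in relativity. The family of all `v` and `T`, together with
the events of `e`, does not mention the boost. It is recorded as a `Skel`, and `IsRep N K L` says
that the kinematics `K` is the skeleton `N` read with the boosts `L`.

Radarization is `lor c v ∘ gam (-v)` (`radRel_iff`): the rotations in its definition only bring `v`
to the first axis, and cancel. Therefore each of the two translations exchanges one kind of boost
for the other and leaves the skeleton alone (`IsRep.pullPlus`, `IsRep.pullPlus'`), and both in
succession restore the model. Conversely the axioms hold in everything that a skeleton represents
(`IsRep.isClassical`, `IsRep.isRelativistic`).

It remains to find a skeleton for each model (`exists_isRep_gam`, `exists_isRep_lor`). Classically,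
absolute time and the axiom of symmetric distance make a worldview transformation an isometry on
each time slice, and lines at rest in the ether go to straight lines, so the transformation is a
Galilean boost of a trivial map. In relativity, a Lorentz boost first brings `e` to rest. What is
left preserves light cones and a time axis, and a radar argument shows that it is trivial: light
signals single out antipodal points of a sphere, and the axiom of symmetric distance, applied across
the direction of motion, fixes the scale. -/

namespace Kinematics

/-! ## Semantics of two-sorted first-order logic -/

/-- Two-sorted structures. -/
structure Struc (R : ℕ → ℕ → Type) where
  B : Type
  Q : Type
  add : Q → Q → Q
  mul : Q → Q → Q
  le : Q → Q → Prop
  rel : ∀ {m n : ℕ}, R m n → (Fin m → B) → (Fin n → Q) → Prop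

/-- Put a value in front of a sequence. -/
def scons {α : Type*} (a : α) (ρ : ℕ → α) : ℕ → α
  | 0 => a
  | i + 1 => ρ i

@[simp] theorem scons_zero {α : Type*} (a : α) (ρ : ℕ → α) : scons a ρ 0 = a := rfl
@[simp] theorem scons_succ {α : Type*} (a : α) (ρ : ℕ → α) (i : ℕ) :
    scons a ρ (i + 1) = ρ i := rfl

/-- The value of a quantity term. -/
def QTerm.eval {Q : Type} (add mul : Q → Q → Q) (ρ : ℕ → Q) : QTerm → Q
  | .var i => ρ i
  | .add s t => add (s.eval add mul ρ) (t.eval add mul ρ)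
  | .mul s t => mul (s.eval add mul ρ) (t.eval add mul ρ)

/-- Satisfaction of a formula in a structure. -/
def Sat {R : ℕ → ℕ → Type} (M : Struc R) : (ℕ → M.B) → (ℕ → M.Q) → Form R → Prop
  | _, _, .falsum => False
  | ρ, _, .eqB k b => ρ k = ρ b
  | _, κ, .eqQ s t => s.eval M.add M.mul κ = t.eval M.add M.mul κ
  | _, κ, .le s t => M.le (s.eval M.add M.mul κ) (t.eval M.add M.mul κ)
  | ρ, κ, .rel r bs qs => M.rel r (fun i => ρ (bs i)) (fun i => (qs i).eval M.add M.mul κ)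
  | ρ, κ, .imp φ ψ => Sat M ρ κ φ → Sat M ρ κ ψ
  | ρ, κ, .allB φ => ∀ b, Sat M (scons b ρ) κ φ
  | ρ, κ, .allQ φ => ∀ x, Sat M ρ (scons x κ) φ

/-! ### Substitution -/

theorem QTerm.subst_subst (σ τ : ℕ → QTerm) (t : QTerm) :
    (t.subst σ).subst τ = t.subst fun i => (σ i).subst τ := by
  induction t <;> simp_all [QTerm.subst]

@[simp] theorem QTerm.subst_var (t : QTerm) : t.subst .var = t := by
  induction t <;> simp_all [QTerm.subst]

theorem QTerm.eval_subst {Q : Type} (add mul : Q → Q → Q) (κ : ℕ → Q) (τ : ℕ → QTerm)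
    (t : QTerm) : (t.subst τ).eval add mul κ = t.eval add mul fun i => (τ i).eval add mul κ := by
  induction t <;> simp_all [QTerm.subst, QTerm.eval]

theorem QTerm.subst_congr {n : ℕ} {τ τ' : ℕ → QTerm} (h : ∀ i < n, τ i = τ' i) {t : QTerm}
    (ht : t.closedAt n = true) : t.subst τ = t.subst τ' := by
  induction t <;> simp_all [QTerm.subst, QTerm.closedAt]

theorem QTerm.eval_congr {Q : Type} {add mul : Q → Q → Q} {n : ℕ} {κ κ' : ℕ → Q}
    (h : ∀ i < n, κ i = κ' i) {t : QTerm} (ht : t.closedAt n = true) :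
    t.eval add mul κ = t.eval add mul κ' := by
  induction t <;> simp_all [QTerm.eval, QTerm.closedAt]

theorem QTerm.closedAt_mono {n n' : ℕ} (h : n ≤ n') {t : QTerm} (ht : t.closedAt n = true) :
    t.closedAt n' = true := by
  induction t <;> simp_all [QTerm.closedAt]
  omega

theorem QTerm.exists_closedAt (t : QTerm) : ∃ n, t.closedAt n = true := by
  induction t with
  | var i => exact ⟨i + 1, by simp [QTerm.closedAt]⟩
  | add s t hs ht =>
    obtain ⟨n, hn⟩ := hs
    obtain ⟨m, hm⟩ := ht
    exact ⟨max n m, by simp [QTerm.closedAt, closedAt_mono (le_max_left n m) hn,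
      closedAt_mono (le_max_right n m) hm]⟩
  | mul s t hs ht =>
    obtain ⟨n, hn⟩ := hs
    obtain ⟨m, hm⟩ := ht
    exact ⟨max n m, by simp [QTerm.closedAt, closedAt_mono (le_max_left n m) hn,
      closedAt_mono (le_max_right n m) hm]⟩

namespace Form

variable {R : ℕ → ℕ → Type}

theorem upB_comp (σ σ' : ℕ → ℕ) : upB σ' ∘ upB σ = upB (σ' ∘ σ) := by
  funext i; cases i <;> rfl

theorem upQ_comp (τ τ' : ℕ → QTerm) (i : ℕ) :
    (upQ τ i).subst (upQ τ') = upQ (fun i => (τ i).subst τ') i := by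
  cases i with
  | zero => rfl
  | succ i => simp only [upQ, QTerm.subst_subst]; rfl

theorem subst_subst (φ : Form R) (σ σ' : ℕ → ℕ) (τ τ' : ℕ → QTerm) :
    (φ.subst σ τ).subst σ' τ' = φ.subst (σ' ∘ σ) fun i => (τ i).subst τ' := by
  induction φ generalizing σ σ' τ τ' with
  | allQ φ ih => simp only [subst, ih]; congr 2; funext i; exact upQ_comp τ τ' i
  | allB φ ih => simp only [subst, ih, upB_comp]
  | _ => simp_all [subst, QTerm.subst_subst]

@[simp] theorem upB_id : upB id = id := by funext i; cases i <;> rfl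
@[simp] theorem upQ_var : upQ .var = .var := by funext i; cases i <;> rfl

@[simp] theorem subst_id (φ : Form R) : φ.subst id .var = φ := by
  induction φ <;> simp_all [subst]

theorem subst_congr {m n : ℕ} {φ : Form R} (hφ : φ.closedAt m n = true) {σ σ' : ℕ → ℕ}
    {τ τ' : ℕ → QTerm} (hσ : ∀ i < m, σ i = σ' i) (hτ : ∀ i < n, τ i = τ' i) :
    φ.subst σ τ = φ.subst σ' τ' := by
  induction φ generalizing m n σ σ' τ τ' with
  | falsum => rfl
  | eqB k b => simp_all [subst, closedAt]
  | eqQ s t =>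
    simp only [closedAt, Bool.and_eq_true] at hφ
    simp [subst, QTerm.subst_congr hτ hφ.1, QTerm.subst_congr hτ hφ.2]
  | le s t =>
    simp only [closedAt, Bool.and_eq_true] at hφ
    simp [subst, QTerm.subst_congr hτ hφ.1, QTerm.subst_congr hτ hφ.2]
  | rel r bs qs =>
    simp only [closedAt, Bool.and_eq_true, List.all_eq_true, List.mem_ofFn,
      forall_exists_index, forall_apply_eq_imp_iff, decide_eq_true_eq] at hφ
    simp only [subst]
    congr 1
    · funext i; exact hσ _ (hφ.1 i)
    · funext i; exact QTerm.subst_congr hτ (hφ.2 i)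
  | imp φ ψ ih ih' =>
    simp only [closedAt, Bool.and_eq_true] at hφ
    simp only [subst, ih hφ.1 hσ hτ, ih' hφ.2 hσ hτ]
  | allB φ ih =>
    simp only [subst]
    rw [ih hφ (σ := upB σ) (σ' := upB σ') _ hτ]
    intro i hi
    cases i with
    | zero => rfl
    | succ i => simp [upB, hσ i (by omega)]
  | allQ φ ih =>
    simp only [subst]
    rw [ih hφ (τ := upQ τ) (τ' := upQ τ') hσ]
    intro i hi
    cases i with
    | zero => rfl
    | succ i => simp [upQ, hτ i (by omega)]

theorem closedAt_mono {m n m' n' : ℕ} (hm : m ≤ m') (hn : n ≤ n') {φ : Form R}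
    (hφ : φ.closedAt m n = true) : φ.closedAt m' n' = true := by
  induction φ generalizing m n m' n' with
  | falsum => rfl
  | eqB k b => simp_all only [closedAt, Bool.and_eq_true, decide_eq_true_eq]; omega
  | eqQ s t =>
    simp only [closedAt, Bool.and_eq_true] at hφ ⊢
    exact ⟨QTerm.closedAt_mono hn hφ.1, QTerm.closedAt_mono hn hφ.2⟩
  | le s t =>
    simp only [closedAt, Bool.and_eq_true] at hφ ⊢
    exact ⟨QTerm.closedAt_mono hn hφ.1, QTerm.closedAt_mono hn hφ.2⟩
  | rel r bs qs =>
    simp only [closedAt, Bool.and_eq_true, List.all_eq_true, List.mem_ofFn,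
      forall_exists_index, forall_apply_eq_imp_iff, decide_eq_true_eq] at hφ ⊢
    exact ⟨fun i => (hφ.1 i).trans_le hm, fun i => QTerm.closedAt_mono hn (hφ.2 i)⟩
  | imp φ ψ ih ih' =>
    simp only [closedAt, Bool.and_eq_true] at hφ ⊢
    exact ⟨ih hm hn hφ.1, ih' hm hn hφ.2⟩
  | allB φ ih => exact ih (by omega) hn hφ
  | allQ φ ih => exact ih hm (by omega) hφ

theorem exists_closedAt (φ : Form R) : ∃ n, φ.closedAt n n = true := by
  induction φ with
  | falsum => exact ⟨0, rfl⟩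
  | eqB k b => exact ⟨k + b + 1, by simp only [closedAt, Bool.and_eq_true, decide_eq_true_eq]; omega⟩
  | eqQ s t =>
    obtain ⟨n, hn⟩ := s.exists_closedAt
    obtain ⟨m, hm⟩ := t.exists_closedAt
    exact ⟨max n m, by simp [closedAt, QTerm.closedAt_mono (le_max_left n m) hn,
      QTerm.closedAt_mono (le_max_right n m) hm]⟩
  | le s t =>
    obtain ⟨n, hn⟩ := s.exists_closedAt
    obtain ⟨m, hm⟩ := t.exists_closedAt
    exact ⟨max n m, by simp [closedAt, QTerm.closedAt_mono (le_max_left n m) hn,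
      QTerm.closedAt_mono (le_max_right n m) hm]⟩
  | rel r bs qs =>
    choose f hf using fun i => (qs i).exists_closedAt
    refine ⟨max (Finset.univ.sup bs + 1) (Finset.univ.sup f), ?_⟩
    simp only [closedAt, Bool.and_eq_true, List.all_eq_true, List.mem_ofFn,
      forall_exists_index, forall_apply_eq_imp_iff, decide_eq_true_eq]
    refine ⟨fun i => ?_, fun i => ?_⟩
    · have := Finset.le_sup (f := bs) (Finset.mem_univ i)
      exact lt_of_le_of_lt this (lt_of_lt_of_le (Nat.lt_succ_self _) (le_max_left _ _))
    · exact QTerm.closedAt_mono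
        ((Finset.le_sup (f := f) (Finset.mem_univ i)).trans (le_max_right _ _)) (hf i)
  | imp φ ψ ih ih' =>
    obtain ⟨n, hn⟩ := ih
    obtain ⟨m, hm⟩ := ih'
    exact ⟨max n m, by simp [closedAt, closedAt_mono (le_max_left n m) (le_max_left n m) hn,
      closedAt_mono (le_max_right n m) (le_max_right n m) hm]⟩
  | allB φ ih =>
    obtain ⟨n, hn⟩ := ih
    exact ⟨n, closedAt_mono (φ := φ) (Nat.le_succ n) le_rfl hn⟩
  | allQ φ ih =>
    obtain ⟨n, hn⟩ := ih
    exact ⟨n, closedAt_mono (φ := φ) le_rfl (Nat.le_succ n) hn⟩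

theorem instB_eq (k : ℕ) (φ : Form R) : φ.instB k = φ.subst (scons k id) .var := by
  unfold instB; congr 1

theorem instQ_eq (t : QTerm) (φ : Form R) : φ.instQ t = φ.subst id (scons t .var) := by
  unfold instQ; congr 1

theorem liftB_subst (φ : Form R) (σ : ℕ → ℕ) (τ : ℕ → QTerm) :
    φ.liftB.subst (upB σ) τ = (φ.subst σ τ).liftB := by
  simp only [liftB, subst_subst]
  congr 1
  funext i; simp [QTerm.subst]

theorem liftQ_subst (φ : Form R) (σ : ℕ → ℕ) (τ : ℕ → QTerm) :
    φ.liftQ.subst σ (upQ τ) = (φ.subst σ τ).liftQ := by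
  simp only [liftQ, subst_subst]
  congr 1

theorem instB_subst (φ : Form R) (k : ℕ) (σ : ℕ → ℕ) (τ : ℕ → QTerm) :
    (φ.instB k).subst σ τ = (φ.subst (upB σ) τ).instB (σ k) := by
  simp only [instB_eq, subst_subst]
  congr 1
  · funext i; cases i <;> rfl
  · funext i; simp [QTerm.subst]

theorem instQ_subst (φ : Form R) (t : QTerm) (σ : ℕ → ℕ) (τ : ℕ → QTerm) :
    (φ.instQ t).subst σ τ = (φ.subst σ (upQ τ)).instQ (t.subst τ) := by
  simp only [instQ_eq, subst_subst]
  congr 1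
  funext i; cases i with
  | zero => rfl
  | succ i => simp only [upQ, scons_succ, QTerm.subst_subst, QTerm.subst, QTerm.subst_var]

theorem subst_upB_instB (φ : Form R) (k : ℕ) (σ : ℕ → ℕ) (τ : ℕ → QTerm) :
    (φ.subst (upB σ) τ).instB k = φ.subst (scons k σ) τ := by
  simp only [instB_eq, subst_subst]
  congr 1
  · funext i; cases i <;> rfl
  · funext i; simp

theorem subst_upQ_instQ (φ : Form R) (t : QTerm) (σ : ℕ → ℕ) (τ : ℕ → QTerm) :
    (φ.subst σ (upQ τ)).instQ t = φ.subst σ (scons t τ) := by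
  simp only [instQ_eq, subst_subst]
  congr 1
  funext i; cases i with
  | zero => rfl
  | succ i => simp [upQ, QTerm.subst_subst, QTerm.subst]

end Form

/-! ### Satisfaction under substitution, and soundness. -/

section Semantics

variable {R : ℕ → ℕ → Type} (M : Struc R)

theorem sat_subst (φ : Form R) (σ : ℕ → ℕ) (τ : ℕ → QTerm) (ρ : ℕ → M.B) (κ : ℕ → M.Q) :
    Sat M ρ κ (φ.subst σ τ) ↔ Sat M (ρ ∘ σ) (fun i => (τ i).eval M.add M.mul κ) φ := by
  induction φ generalizing σ τ ρ κ with
  | falsum => rfl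
  | eqB k b => rfl
  | eqQ s t => simp [Form.subst, Sat, QTerm.eval_subst]
  | le s t => simp [Form.subst, Sat, QTerm.eval_subst]
  | rel r bs qs => simp [Form.subst, Sat, QTerm.eval_subst]
  | imp φ ψ ih ih' => simp [Form.subst, Sat, ih, ih']
  | allB φ ih =>
    simp only [Form.subst, Sat, ih]
    refine forall_congr' fun b => ?_
    have : scons b ρ ∘ Form.upB σ = scons b (ρ ∘ σ) := by funext i; cases i <;> rfl
    rw [this]
  | allQ φ ih =>
    simp only [Form.subst, Sat, ih]
    refine forall_congr' fun x => ?_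
    have : (fun i => (Form.upQ τ i).eval M.add M.mul (scons x κ)) =
        scons x fun i => (τ i).eval M.add M.mul κ := by
      funext i
      cases i with
      | zero => rfl
      | succ i => simp only [Form.upQ, QTerm.eval_subst, QTerm.eval, scons_succ]
    rw [this]

theorem sat_congr {m n : ℕ} {φ : Form R} (hφ : φ.closedAt m n = true) {ρ ρ' : ℕ → M.B}
    {κ κ' : ℕ → M.Q} (hρ : ∀ i < m, ρ i = ρ' i) (hκ : ∀ i < n, κ i = κ' i) :
    Sat M ρ κ φ ↔ Sat M ρ' κ' φ := by
  induction φ generalizing m n ρ ρ' κ κ' with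
  | falsum => rfl
  | eqB k b =>
    simp only [Form.closedAt, Bool.and_eq_true, decide_eq_true_eq] at hφ
    simp [Sat, hρ _ hφ.1, hρ _ hφ.2]
  | eqQ s t =>
    simp only [Form.closedAt, Bool.and_eq_true] at hφ
    simp [Sat, QTerm.eval_congr hκ hφ.1, QTerm.eval_congr hκ hφ.2]
  | le s t =>
    simp only [Form.closedAt, Bool.and_eq_true] at hφ
    simp [Sat, QTerm.eval_congr hκ hφ.1, QTerm.eval_congr hκ hφ.2]
  | rel r bs qs =>
    simp only [Form.closedAt, Bool.and_eq_true, List.all_eq_true, List.mem_ofFn,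
      forall_exists_index, forall_apply_eq_imp_iff, decide_eq_true_eq] at hφ
    simp [Sat, hρ _ (hφ.1 _), QTerm.eval_congr hκ (hφ.2 _)]
  | imp φ ψ ih ih' =>
    simp only [Form.closedAt, Bool.and_eq_true] at hφ
    simp only [Sat, ih hφ.1 hρ hκ, ih' hφ.2 hρ hκ]
  | allB φ ih =>
    refine forall_congr' fun b => ih hφ ?_ hκ
    intro i hi
    cases i with
    | zero => rfl
    | succ i => simp [hρ i (by omega)]
  | allQ φ ih =>
    refine forall_congr' fun b => ih hφ hρ ?_
    intro i hi
    cases i with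
    | zero => rfl
    | succ i => simp [hκ i (by omega)]

theorem sat_liftB (φ : Form R) (b : M.B) (ρ : ℕ → M.B) (κ : ℕ → M.Q) :
    Sat M (scons b ρ) κ φ.liftB ↔ Sat M ρ κ φ := by
  rw [Form.liftB, sat_subst]; rfl

theorem sat_liftQ (φ : Form R) (x : M.Q) (ρ : ℕ → M.B) (κ : ℕ → M.Q) :
    Sat M ρ (scons x κ) φ.liftQ ↔ Sat M ρ κ φ := by
  rw [Form.liftQ, sat_subst]; rfl

theorem sat_instB (φ : Form R) (k : ℕ) (ρ : ℕ → M.B) (κ : ℕ → M.Q) :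
    Sat M ρ κ (φ.instB k) ↔ Sat M (scons (ρ k) ρ) κ φ := by
  rw [Form.instB_eq, sat_subst]
  have : ρ ∘ scons k id = scons (ρ k) ρ := by funext i; cases i <;> rfl
  rw [this]; rfl

theorem sat_instQ (φ : Form R) (t : QTerm) (ρ : ℕ → M.B) (κ : ℕ → M.Q) :
    Sat M ρ κ (φ.instQ t) ↔ Sat M ρ (scons (t.eval M.add M.mul κ) κ) φ := by
  rw [Form.instQ_eq, sat_subst]
  have : (fun i => (scons t QTerm.var i).eval M.add M.mul κ) =
      scons (t.eval M.add M.mul κ) κ := by funext i; cases i <;> rfl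
  rw [this]; rfl

end Semantics

theorem Proves.sound {R : ℕ → ℕ → Type} {Γ : Set (Form R)} {φ : Form R} (h : Proves Γ φ)
    (M : Struc R) (ρ : ℕ → M.B) (κ : ℕ → M.Q) (hΓ : ∀ γ ∈ Γ, Sat M ρ κ γ) : Sat M ρ κ φ := by
  induction h generalizing ρ κ with
  | hyp h => exact hΓ _ h
  | impI _ ih =>
    intro h
    refine ih ρ κ ?_
    rintro γ (rfl | hγ)
    exacts [h, hΓ γ hγ]
  | impE _ _ ih ih' => exact ih ρ κ hΓ (ih' ρ κ hΓ)
  | raa _ ih =>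
    by_contra h
    refine ih ρ κ ?_
    rintro γ (rfl | hγ)
    exacts [h, hΓ γ hγ]
  | allBI _ ih =>
    intro b
    refine ih _ _ ?_
    rintro _ ⟨γ, hγ, rfl⟩
    exact (sat_liftB M γ b ρ κ).2 (hΓ γ hγ)
  | allBE k _ ih => exact (sat_instB M _ k ρ κ).2 (ih ρ κ hΓ _)
  | allQI _ ih =>
    intro b
    refine ih _ _ ?_
    rintro _ ⟨γ, hγ, rfl⟩
    exact (sat_liftQ M γ b ρ κ).2 (hΓ γ hγ)
  | allQE t _ ih => exact (sat_instQ M _ t ρ κ).2 (ih ρ κ hΓ _)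
  | reflB => rfl
  | reflQ => rfl
  | substB φ _ _ ih ih' =>
    have h1 := (sat_instB M φ _ ρ κ).1 (ih' ρ κ hΓ)
    have h2 : ρ _ = ρ _ := ih ρ κ hΓ
    rw [h2] at h1
    exact (sat_instB M φ _ ρ κ).2 h1
  | substQ φ _ _ ih ih' =>
    have h1 := (sat_instQ M φ _ ρ κ).1 (ih' ρ κ hΓ)
    have h2 : QTerm.eval _ _ κ _ = QTerm.eval _ _ κ _ := ih ρ κ hΓ
    rw [h2] at h1
    exact (sat_instQ M φ _ ρ κ).2 h1

/-! ### Structural properties of derivations. -/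

namespace Proves

variable {R : ℕ → ℕ → Type}

theorem mono {Γ Δ : Set (Form R)} {φ : Form R} (h : Proves Γ φ) (hs : Γ ⊆ Δ) : Proves Δ φ := by
  induction h generalizing Δ with
  | hyp h => exact hyp (hs h)
  | impI _ ih => exact impI (ih (Set.insert_subset_insert hs))
  | impE _ _ ih ih' => exact impE (ih hs) (ih' hs)
  | raa _ ih => exact raa (ih (Set.insert_subset_insert hs))
  | allBI _ ih => exact allBI (ih (Set.image_mono hs))
  | allBE k _ ih => exact allBE k (ih hs)
  | allQI _ ih => exact allQI (ih (Set.image_mono hs))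
  | allQE t _ ih => exact allQE t (ih hs)
  | reflB k => exact reflB k
  | reflQ t => exact reflQ t
  | substB φ _ _ ih ih' => exact substB φ (ih hs) (ih' hs)
  | substQ φ _ _ ih ih' => exact substQ φ (ih hs) (ih' hs)

/-- Substitution in a whole derivation is what allows a free variable that is fresh to be turned
into the bound variable of a generalization. -/
theorem subst {Γ : Set (Form R)} {φ : Form R} (h : Proves Γ φ) (σ : ℕ → ℕ) (τ : ℕ → QTerm) :
    Proves (Form.subst σ τ '' Γ) (φ.subst σ τ) := by
  induction h generalizing σ τ with
  | hyp h => exact hyp (Set.mem_image_of_mem _ h)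
  | impI _ ih => exact impI (by simpa only [Set.image_insert_eq] using ih σ τ)
  | impE _ _ ih ih' => exact impE (ih σ τ) (ih' σ τ)
  | raa _ ih =>
    have := ih σ τ
    rw [Set.image_insert_eq] at this
    exact raa this
  | allBI _ ih =>
    refine allBI ?_
    have := ih (Form.upB σ) τ
    simpa only [Set.image_image, Form.liftB_subst] using this
  | allBE k _ ih => rw [Form.instB_subst]; exact allBE _ (ih σ τ)
  | allQI _ ih =>
    refine allQI ?_
    have := ih σ (Form.upQ τ)
    simpa only [Set.image_image, Form.liftQ_subst] using this
  | allQE t _ ih => rw [Form.instQ_subst]; exact allQE _ (ih σ τ)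
  | reflB k => exact reflB _
  | reflQ t => exact reflQ _
  | substB φ _ _ ih ih' =>
    rw [Form.instB_subst]
    exact substB _ (ih σ τ) (by simpa only [Form.instB_subst] using ih' σ τ)
  | substQ φ _ _ ih ih' =>
    rw [Form.instQ_subst]
    exact substQ _ (ih σ τ) (by simpa only [Form.instQ_subst] using ih' σ τ)

/-- Each rule uses finitely many hypotheses. This keeps the union of the Henkin chain consistent. -/
theorem exists_finite {Γ : Set (Form R)} {φ : Form R} (h : Proves Γ φ) :
    ∃ Δ ⊆ Γ, Δ.Finite ∧ Proves Δ φ := by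
  have key : ∀ {Γ : Set (Form R)} {χ φ : Form R},
      (∃ Δ ⊆ insert χ Γ, Δ.Finite ∧ Proves Δ φ) → ∃ Δ ⊆ Γ, Δ.Finite ∧ Proves (insert χ Δ) φ := by
    rintro Γ χ φ ⟨Δ, hs, hf, hp⟩
    exact ⟨Δ \ {χ}, by simpa [Set.sdiff_singleton_subset_iff] using hs, hf.sdiff,
      hp.mono (by simp)⟩
  have key2 : ∀ {Γ : Set (Form R)} {φ ψ : Form R},
      (∃ Δ ⊆ Γ, Δ.Finite ∧ Proves Δ φ) → (∃ Δ ⊆ Γ, Δ.Finite ∧ Proves Δ ψ) →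
      ∃ Δ ⊆ Γ, Δ.Finite ∧ Proves Δ φ ∧ Proves Δ ψ := by
    rintro Γ φ ψ ⟨Δ, hs, hf, hp⟩ ⟨Δ', hs', hf', hp'⟩
    exact ⟨Δ ∪ Δ', Set.union_subset hs hs', hf.union hf', hp.mono Set.subset_union_left,
      hp'.mono Set.subset_union_right⟩
  induction h with
  | hyp h => exact ⟨{_}, Set.singleton_subset_iff.2 h, Set.finite_singleton _, hyp rfl⟩
  | impI _ ih => obtain ⟨Δ, hs, hf, hp⟩ := key ih; exact ⟨Δ, hs, hf, impI hp⟩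
  | impE _ _ ih ih' =>
    obtain ⟨Δ, hs, hf, hp, hp'⟩ := key2 ih ih'
    exact ⟨Δ, hs, hf, impE hp hp'⟩
  | raa _ ih => obtain ⟨Δ, hs, hf, hp⟩ := key ih; exact ⟨Δ, hs, hf, raa hp⟩
  | allBI _ ih =>
    obtain ⟨Δ, hs, hf, hp⟩ := ih
    -- A finite set of lifted hypotheses is the lift of a finite set.
    obtain ⟨Δ', hs', hf', rfl⟩ := (Set.exists_subset_image_finite_and
      (p := fun s => s = Δ)).1 ⟨Δ, hs, hf, rfl⟩
    exact ⟨Δ', hs', hf', allBI hp⟩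
  | allBE k _ ih => obtain ⟨Δ, hs, hf, hp⟩ := ih; exact ⟨Δ, hs, hf, allBE k hp⟩
  | allQI _ ih =>
    obtain ⟨Δ, hs, hf, hp⟩ := ih
    obtain ⟨Δ', hs', hf', rfl⟩ := (Set.exists_subset_image_finite_and
      (p := fun s => s = Δ)).1 ⟨Δ, hs, hf, rfl⟩
    exact ⟨Δ', hs', hf', allQI hp⟩
  | allQE t _ ih => obtain ⟨Δ, hs, hf, hp⟩ := ih; exact ⟨Δ, hs, hf, allQE t hp⟩
  | reflB k => exact ⟨∅, Set.empty_subset _, Set.finite_empty, reflB k⟩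
  | reflQ t => exact ⟨∅, Set.empty_subset _, Set.finite_empty, reflQ t⟩
  | substB φ _ _ ih ih' =>
    obtain ⟨Δ, hs, hf, hp, hp'⟩ := key2 ih ih'
    exact ⟨Δ, hs, hf, substB φ hp hp'⟩
  | substQ φ _ _ ih ih' =>
    obtain ⟨Δ, hs, hf, hp, hp'⟩ := key2 ih ih'
    exact ⟨Δ, hs, hf, substQ φ hp hp'⟩

end Proves

end Kinematics

namespace Kinematics

/-! ## Completeness -/

/-! ### Countability of the set of formulas. -/

section Countable

/-- Terms are the union of the layers `F n` of bounded depth, each of which is countable. -/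
theorem QTerm.countable : Countable QTerm := by
  let F : ℕ → Set QTerm := fun n => Nat.rec (Set.range QTerm.var)
    (fun _ S => S ∪ Set.image2 QTerm.add S S ∪ Set.image2 QTerm.mul S S) n
  have hmono : ∀ n, F n ⊆ F (n + 1) := fun n =>
    Set.subset_union_left.trans Set.subset_union_left
  have hmono' : Monotone F := monotone_nat_of_le_succ hmono
  have hc : ∀ n, (F n).Countable := by
    intro n
    induction n with
    | zero => exact Set.countable_range _
    | succ n ih => exact (ih.union (ih.image2 ih _)).union (ih.image2 ih _)
  have hall : ∀ t, ∃ n, t ∈ F n := by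
    intro t
    induction t with
    | var i => exact ⟨0, i, rfl⟩
    | add s t hs ht =>
      obtain ⟨n, hn⟩ := hs
      obtain ⟨m, hm⟩ := ht
      exact ⟨max n m + 1, Or.inl (Or.inr ⟨s, hmono' (le_max_left n m) hn, t,
        hmono' (le_max_right n m) hm, rfl⟩)⟩
    | mul s t hs ht =>
      obtain ⟨n, hn⟩ := hs
      obtain ⟨m, hm⟩ := ht
      exact ⟨max n m + 1, Or.inr ⟨s, hmono' (le_max_left n m) hn, t,
        hmono' (le_max_right n m) hm, rfl⟩⟩
  rw [← Set.countable_univ_iff]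
  exact (Set.countable_iUnion hc).mono fun t _ => Set.mem_iUnion.2 (hall t)

theorem Form.countable {R : ℕ → ℕ → Type} (hR : ∀ m n, Countable (R m n)) :
    Countable (Form R) := by
  have := QTerm.countable
  let A : Set (Form R) := {falsum} ∪ Set.range (fun p : ℕ × ℕ => eqB p.1 p.2) ∪
    Set.range (fun p : QTerm × QTerm => eqQ p.1 p.2) ∪
    Set.range (fun p : QTerm × QTerm => le p.1 p.2) ∪
    Set.range (fun p : (Σ m n : ℕ, R m n × (Fin m → ℕ) × (Fin n → QTerm)) =>
      rel p.2.2.1 p.2.2.2.1 p.2.2.2.2)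
  have hA : A.Countable := by
    refine Set.Countable.union (Set.Countable.union (Set.Countable.union (Set.Countable.union
      (Set.countable_singleton _) ?_) ?_) ?_) ?_ <;> exact Set.countable_range _
  let F : ℕ → Set (Form R) := fun n => Nat.rec A
    (fun _ S => S ∪ Set.image2 imp S S ∪ (allB '' S ∪ allQ '' S)) n
  have hmono : ∀ n, F n ⊆ F (n + 1) := fun n =>
    Set.subset_union_left.trans Set.subset_union_left
  have hmono' : Monotone F := monotone_nat_of_le_succ hmono
  have hc : ∀ n, (F n).Countable := by
    intro n
    induction n with
    | zero => exact hA
    | succ n ih => exact (ih.union (ih.image2 ih _)).union ((ih.image _).union (ih.image _))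
  have hall : ∀ t, ∃ n, t ∈ F n := by
    intro φ
    induction φ with
    | falsum => exact ⟨0, Or.inl (Or.inl (Or.inl (Or.inl rfl)))⟩
    | eqB k b => exact ⟨0, Or.inl (Or.inl (Or.inl (Or.inr ⟨(k, b), rfl⟩)))⟩
    | eqQ s t => exact ⟨0, Or.inl (Or.inl (Or.inr ⟨(s, t), rfl⟩))⟩
    | le s t => exact ⟨0, Or.inl (Or.inr ⟨(s, t), rfl⟩)⟩
    | rel r bs qs => exact ⟨0, Or.inr ⟨⟨_, _, r, bs, qs⟩, rfl⟩⟩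
    | imp s t hs ht =>
      obtain ⟨n, hn⟩ := hs
      obtain ⟨m, hm⟩ := ht
      exact ⟨max n m + 1, Or.inl (Or.inr ⟨s, hmono' (le_max_left n m) hn, t,
        hmono' (le_max_right n m) hm, rfl⟩)⟩
    | allB φ ih => obtain ⟨n, hn⟩ := ih; exact ⟨n + 1, Or.inr (Or.inl ⟨φ, hn, rfl⟩)⟩
    | allQ φ ih => obtain ⟨n, hn⟩ := ih; exact ⟨n + 1, Or.inr (Or.inr ⟨φ, hn, rfl⟩)⟩
  rw [← Set.countable_univ_iff]
  exact (Set.countable_iUnion hc).mono fun t _ => Set.mem_iUnion.2 (hall t)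

end Countable

/-! ### Henkin extensions and the canonical structure. -/

section Henkin

variable {R : ℕ → ℕ → Type}

namespace Proves

theorem falsumE {Γ : Set (Form R)} (h : Proves Γ .falsum) (φ : Form R) : Proves Γ φ :=
  raa (h.mono (Set.subset_insert _ _))

theorem insert_cut {Γ : Set (Form R)} {φ ψ : Form R} (h : Proves Γ φ)
    (h' : Proves (insert φ Γ) ψ) : Proves Γ ψ := impE (impI h') h

/-- Generalization over a fresh body variable. -/
theorem allBI_of_fresh {Γ : Set (Form R)} {φ : Form R} {n : ℕ}
    (hΓ : ∀ γ ∈ Γ, γ.closedAt n n = true) (hφ : φ.closedAt (n + 1) (n + 1) = true)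
    (h : Proves Γ (φ.instB n)) : Proves Γ (.allB φ) := by
  refine allBI ?_
  -- The fresh variable `n` becomes `0` and all other variables are shifted; since `n` does not
  -- occur in `Γ`, this acts on `Γ` as the lift.
  have h1 := h.subst (fun i => if i = n then 0 else i + 1) .var
  have h2 : Form.subst (fun i => if i = n then 0 else i + 1) .var '' Γ = Form.liftB '' Γ := by
    refine Set.image_congr fun γ hγ => ?_
    exact Form.subst_congr (hΓ γ hγ) (fun i hi => by simp [hi.ne]) fun _ _ => rfl
  have h3 : (φ.instB n).subst (fun i => if i = n then 0 else i + 1) .var = φ := by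
    rw [Form.instB_eq, Form.subst_subst]
    conv_rhs => rw [← Form.subst_id φ]
    refine Form.subst_congr hφ (fun i hi => ?_) fun _ _ => rfl
    cases i with
    | zero => simp
    | succ i => simp [show i ≠ n by omega]
  rwa [h2, h3] at h1

/-- Generalization over a fresh quantity variable. -/
theorem allQI_of_fresh {Γ : Set (Form R)} {φ : Form R} {n : ℕ}
    (hΓ : ∀ γ ∈ Γ, γ.closedAt n n = true) (hφ : φ.closedAt (n + 1) (n + 1) = true)
    (h : Proves Γ (φ.instQ (.var n))) : Proves Γ (.allQ φ) := by
  refine allQI ?_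
  have h1 := h.subst id (fun i => if i = n then .var 0 else .var (i + 1))
  have h2 : Form.subst id (fun i => if i = n then .var 0 else .var (i + 1)) '' Γ =
      Form.liftQ '' Γ := by
    refine Set.image_congr fun γ hγ => ?_
    exact Form.subst_congr (hΓ γ hγ) (fun _ _ => rfl) fun i hi => by simp [hi.ne]
  have h3 : (φ.instQ (.var n)).subst id (fun i => if i = n then .var 0 else .var (i + 1)) = φ := by
    rw [Form.instQ_eq, Form.subst_subst]
    conv_rhs => rw [← Form.subst_id φ]
    refine Form.subst_congr hφ (fun _ _ => rfl) fun i hi => ?_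
    cases i with
    | zero => simp [QTerm.subst]
    | succ i => simp [QTerm.subst, show i ≠ n by omega]
  rwa [h2, h3] at h1

end Proves

/-- A set of formulas from which no contradiction follows. -/
def Consistent (Γ : Set (Form R)) : Prop := ¬ Proves Γ .falsum

theorem Consistent.insert_or {Γ : Set (Form R)} (h : Consistent Γ) (φ : Form R) :
    Consistent (insert φ Γ) ∨ Consistent (insert φ.neg Γ) := by
  by_contra! hc
  obtain ⟨h1, h2⟩ := hc
  simp only [Consistent, not_not] at h1 h2
  exact h (Proves.insert_cut (.raa h2) h1)

/-- `Δ` decides `φ`, and if it refutes a generalization, then also an instance of it. -/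
def Decides (Δ : Set (Form R)) (φ : Form R) : Prop :=
  φ ∈ Δ ∨ φ.neg ∈ Δ ∧ (∀ ψ, φ = .allB ψ → ∃ k, (ψ.instB k).neg ∈ Δ) ∧
    ∀ ψ, φ = .allQ ψ → ∃ t, (ψ.instQ t).neg ∈ Δ

theorem Decides.mono {Δ Δ' : Set (Form R)} {φ : Form R} (h : Decides Δ φ) (hs : Δ ⊆ Δ') :
    Decides Δ' φ := by
  rcases h with h | ⟨h, h1, h2⟩
  · exact Or.inl (hs h)
  · exact Or.inr ⟨hs h, fun ψ e => (h1 ψ e).imp fun _ h => hs h,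
      fun ψ e => (h2 ψ e).imp fun _ h => hs h⟩

/-- The theory has only sentences as its members. -/
def IsClosedTheory (Γ : Set (Form R)) : Prop := ∀ γ ∈ Γ, γ.closedAt 0 0 = true

theorem IsClosedTheory.exists_closedAt {Γ Δ : Set (Form R)} (hΓ : IsClosedTheory Γ)
    (hΔ : Δ.Finite) : ∃ n, ∀ γ ∈ Γ ∪ Δ, γ.closedAt n n = true := by
  choose f hf using Form.exists_closedAt (R := R)
  refine ⟨hΔ.toFinset.sup f, ?_⟩
  rintro γ (hγ | hγ)
  · exact Form.closedAt_mono (Nat.zero_le _) (Nat.zero_le _) (hΓ γ hγ)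
  · have := Finset.le_sup (f := f) (hΔ.mem_toFinset.2 hγ)
    exact Form.closedAt_mono this this (hf γ)

/-- One Henkin step: `φ` or its negation is added, and a negated generalization comes with a
counterexample in a variable `n` that is free nowhere. Such an `n` exists since the members of `Γ`
are sentences and `Δ` is finite. -/
theorem Consistent.exists_decides {Γ Δ : Set (Form R)} (hΓ : IsClosedTheory Γ)
    (hf : Δ.Finite) (hc : Consistent (Γ ∪ Δ)) (φ : Form R) :
    ∃ Δ', Δ ⊆ Δ' ∧ Δ'.Finite ∧ Consistent (Γ ∪ Δ') ∧ Decides Δ' φ := by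
  rcases hc.insert_or φ with h | h
  · exact ⟨insert φ Δ, Set.subset_insert _ _, hf.insert _, by rwa [Set.union_insert],
      Or.inl (Set.mem_insert _ _)⟩
  rw [← Set.union_insert] at h
  obtain ⟨n, hn⟩ := hΓ.exists_closedAt (hf.insert φ.neg)
  have hφ : φ.neg.closedAt n n = true := hn _ (Or.inr (Set.mem_insert _ _))
  simp only [Form.neg, Form.closedAt, Bool.and_true] at hφ
  have hφmem : Proves (Γ ∪ insert φ.neg Δ) φ.neg := .hyp (Or.inr (Set.mem_insert _ _))
  -- If adding `¬χ` were contradictory, `χ` would be provable, hence `φ`, against `¬φ`.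
  have aux : ∀ χ : Form R, (Proves (Γ ∪ insert φ.neg Δ) χ → Proves (Γ ∪ insert φ.neg Δ) φ) →
      Consistent (Γ ∪ insert χ.neg (insert φ.neg Δ)) := by
    intro χ hχ hcon
    rw [Set.union_insert] at hcon
    exact h (.impE hφmem (hχ (.raa hcon)))
  cases φ with
  | allB ψ =>
    refine ⟨insert (ψ.instB n).neg (insert (Form.allB ψ).neg Δ),
      (Set.subset_insert _ _).trans (Set.subset_insert _ _), (hf.insert _).insert _,
      aux _ ?_, Or.inr ⟨Or.inr (Or.inl rfl), ?_, ?_⟩⟩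
    · exact Proves.allBI_of_fresh hn
        (Form.closedAt_mono (φ := ψ) (m := n + 1) (n := n) le_rfl (Nat.le_succ n) hφ)
    · rintro _ ⟨⟩; exact ⟨n, Or.inl rfl⟩
    · rintro _ ⟨⟩
  | allQ ψ =>
    refine ⟨insert (ψ.instQ (.var n)).neg (insert (Form.allQ ψ).neg Δ),
      (Set.subset_insert _ _).trans (Set.subset_insert _ _), (hf.insert _).insert _,
      aux _ ?_, Or.inr ⟨Or.inr (Or.inl rfl), ?_, ?_⟩⟩
    · exact Proves.allQI_of_fresh hn
        (Form.closedAt_mono (φ := ψ) (m := n) (n := n + 1) (Nat.le_succ n) le_rfl hφ)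
    · rintro _ ⟨⟩
    · rintro _ ⟨⟩; exact ⟨_, Or.inl rfl⟩
  | _ =>
    exact ⟨_, Set.subset_insert _ _, hf.insert _, h, Or.inr ⟨Set.mem_insert _ _,
      by rintro _ ⟨⟩, by rintro _ ⟨⟩⟩⟩

/-- A consistent set of formulas that decides every formula. -/
structure IsHenkin (Θ : Set (Form R)) : Prop where
  consistent : Consistent Θ
  decides : ∀ φ, Decides Θ φ

/-- Decide all formulas one after the other along an enumeration and take the union; a contradiction
would already follow at a finite stage. -/
theorem Consistent.exists_isHenkin [Countable (Form R)] {Γ Δ : Set (Form R)}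
    (hΓ : IsClosedTheory Γ) (hf : Δ.Finite) (hc : Consistent (Γ ∪ Δ)) :
    ∃ Θ, Γ ∪ Δ ⊆ Θ ∧ IsHenkin Θ := by
  have : Nonempty (Form R) := ⟨.falsum⟩
  obtain ⟨e, he⟩ := exists_surjective_nat (Form R)
  let S := {Δ : Set (Form R) // Δ.Finite ∧ Consistent (Γ ∪ Δ)}
  have step : ∀ (s : S) (φ : Form R), ∃ s' : S, s.1 ⊆ s'.1 ∧ Decides s'.1 φ := fun s φ => by
    obtain ⟨Δ', h1, h2, h3, h4⟩ := s.2.2.exists_decides hΓ s.2.1 φ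
    exact ⟨⟨Δ', h2, h3⟩, h1, h4⟩
  choose f hf1 hf2 using step
  let s : ℕ → S := fun n => Nat.rec ⟨Δ, hf, hc⟩ (fun n s => f s (e n)) n
  have hmono : Monotone fun n => Γ ∪ (s n).1 :=
    monotone_nat_of_le_succ fun n => Set.union_subset_union_right _ (hf1 (s n) (e n))
  refine ⟨⋃ n, Γ ∪ (s n).1, Set.subset_iUnion (fun n => Γ ∪ (s n).1) 0, ?_, ?_⟩
  · intro h
    obtain ⟨D, hD, hDf, hDp⟩ := h.exists_finite
    have hdir : Directed (· ⊆ ·) fun n => Γ ∪ (s n).1 := hmono.directed_le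
    obtain ⟨n, hn⟩ := hdir.exists_mem_subset_of_finset_subset_biUnion
      (s := hDf.toFinset) (by simpa using hD)
    exact (s n).2.2 (hDp.mono (by simpa using hn))
  · intro φ
    obtain ⟨n, rfl⟩ := he φ
    exact (hf2 (s n) (e n)).mono ((Set.subset_union_right (s := Γ)).trans
      (Set.subset_iUnion (fun n => Γ ∪ (s n).1) (n + 1)))

namespace IsHenkin

variable {Θ : Set (Form R)} (hΘ : IsHenkin Θ)
include hΘ

theorem proves_imp_iff (φ ψ : Form R) :
    Proves Θ (.imp φ ψ) ↔ (Proves Θ φ → Proves Θ ψ) := by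
  refine ⟨fun h h' => h.impE h', fun h => ?_⟩
  rcases hΘ.decides φ with h1 | ⟨h1, -⟩
  · exact .impI ((h (.hyp h1)).mono (Set.subset_insert _ _))
  · exact .impI (Proves.falsumE (.impE ((Proves.hyp h1).mono (Set.subset_insert _ _))
      (.hyp (Set.mem_insert _ _))) _)

/-- A generalization that is not in `Θ` has a refuted instance in `Θ`, by the witnesses built into
`Decides`. -/
theorem proves_allB_iff (φ : Form R) :
    Proves Θ (.allB φ) ↔ ∀ k, Proves Θ (φ.instB k) := by
  refine ⟨fun h k => h.allBE k, fun h => ?_⟩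
  rcases hΘ.decides (.allB φ) with h1 | ⟨-, h1, -⟩
  · exact .hyp h1
  · obtain ⟨k, hk⟩ := h1 φ rfl
    exact absurd ((Proves.hyp hk).impE (h k)) hΘ.consistent

theorem proves_allQ_iff (φ : Form R) :
    Proves Θ (.allQ φ) ↔ ∀ t, Proves Θ (φ.instQ t) := by
  refine ⟨fun h k => h.allQE k, fun h => ?_⟩
  rcases hΘ.decides (.allQ φ) with h1 | ⟨-, -, h1⟩
  · exact .hyp h1
  · obtain ⟨k, hk⟩ := h1 φ rfl
    exact absurd ((Proves.hyp hk).impE (h k)) hΘ.consistent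

end IsHenkin

section Congruence

variable (Θ : Set (Form R))

/-- The rule `substB` replaces only variable `0`; so the variable `i` is renamed to `0`, and the
terms put for the others are shifted out of the way. -/
theorem proves_subst_update_B {Θ : Set (Form R)} (φ : Form R) (σ σ' : ℕ → ℕ) (τ : ℕ → QTerm)
    (i : ℕ) (h : ∀ j, j ≠ i → σ j = σ' j) (hi : Proves Θ (.eqB (σ i) (σ' i)))
    (hφ : Proves Θ (φ.subst σ τ)) : Proves Θ (φ.subst σ' τ) := by
  have key : ∀ σ'' : ℕ → ℕ, (∀ j, j ≠ i → σ j = σ'' j) →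
      (φ.subst (fun j => if j = i then 0 else σ j + 1) τ).instB (σ'' i) = φ.subst σ'' τ := by
    intro σ'' h
    rw [Form.instB_eq, Form.subst_subst]
    congr 1
    · funext j
      by_cases hj : j = i
      · simp [hj]
      · simp [hj, h]
    · funext j; simp
  rw [← key σ' h]
  refine Proves.substB _ hi ?_
  rwa [key σ fun _ _ => rfl]

theorem proves_subst_update_Q {Θ : Set (Form R)} (φ : Form R) (σ : ℕ → ℕ) (τ τ' : ℕ → QTerm)
    (i : ℕ) (h : ∀ j, j ≠ i → τ j = τ' j) (hi : Proves Θ (.eqQ (τ i) (τ' i)))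
    (hφ : Proves Θ (φ.subst σ τ)) : Proves Θ (φ.subst σ τ') := by
  have key : ∀ τ'' : ℕ → QTerm, (∀ j, j ≠ i → τ j = τ'' j) →
      (φ.subst σ (fun j => if j = i then .var 0 else (τ j).subst fun l => .var (l + 1))).instQ
        (τ'' i) = φ.subst σ τ'' := by
    intro τ'' h
    rw [Form.instQ_eq, Form.subst_subst]
    congr 1
    funext j
    by_cases hj : j = i
    · simp [hj, QTerm.subst]
    · simp [hj, h, QTerm.subst_subst, QTerm.subst]
  rw [← key τ' h]
  refine Proves.substQ _ hi ?_
  rwa [key τ fun _ _ => rfl]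

/-- Variables are exchanged one at a time; only finitely many occur in `φ`. -/
theorem proves_subst_congr {Θ : Set (Form R)} (φ : Form R) (σ σ' : ℕ → ℕ) (τ τ' : ℕ → QTerm)
    (hσ : ∀ i, Proves Θ (.eqB (σ i) (σ' i))) (hτ : ∀ i, Proves Θ (.eqQ (τ i) (τ' i)))
    (hφ : Proves Θ (φ.subst σ τ)) : Proves Θ (φ.subst σ' τ') := by
  obtain ⟨n, hn⟩ := φ.exists_closedAt
  have key : ∀ l, Proves Θ (φ.subst (fun i => if i < l then σ' i else σ i)
      (fun i => if i < l then τ' i else τ i)) := by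
    intro l
    induction l with
    | zero => simpa using hφ
    | succ l ih =>
      have h1 := proves_subst_update_B φ _ (fun i => if i < l + 1 then σ' i else σ i) _ l
        (fun j hj => ?_) (by simpa using hσ l) ih
      · refine proves_subst_update_Q φ _ _ _ l (fun j hj => ?_) (by simpa using hτ l) h1
        simp [show j < l + 1 ↔ j < l by omega]
      · simp [show j < l + 1 ↔ j < l by omega]
  rw [Form.subst_congr hn (σ' := fun i => if i < n then σ' i else σ i)
    (τ' := fun i => if i < n then τ' i else τ i)]
  · exact key n
  · intro i hi; simp [hi]
  · intro i hi; simp [hi]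

/-- Provable equality of bodies. -/
def bodySetoid : Setoid ℕ where
  r k b := Proves Θ (.eqB k b)
  iseqv :=
    { refl := fun k => .reflB k
      symm := fun {k b} h => by
        have := proves_subst_update_B (Θ := Θ) (.eqB 0 1) (fun _ => k)
          (fun i => if i = 0 then b else k) .var 0 (by intro j hj; simp [hj]) (by simpa using h)
          (.reflB k)
        simpa [Form.subst] using this
      trans := fun {k b c} h h' => by
        have := proves_subst_update_B (Θ := Θ) (.eqB 0 1) (fun i => if i = 0 then k else b)
          (fun i => if i = 1 then c else if i = 0 then k else b) .var 1 (by intro j hj; simp [hj])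
          (by simpa using h') (by simpa [Form.subst] using h)
        simpa [Form.subst] using this }

/-- Provable equality of quantity terms. -/
def termSetoid : Setoid QTerm where
  r s t := Proves Θ (.eqQ s t)
  iseqv :=
    { refl := fun k => .reflQ k
      symm := fun {k b} h => by
        have := proves_subst_update_Q (Θ := Θ) (.eqQ (.var 0) (.var 1)) id (fun _ => k)
          (fun i => if i = 0 then b else k) 0 (by intro j hj; simp [hj]) (by simpa using h)
          (.reflQ k)
        simpa [Form.subst, QTerm.subst] using this
      trans := fun {k b c} h h' => by
        have := proves_subst_update_Q (Θ := Θ) (.eqQ (.var 0) (.var 1)) id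
          (fun i => if i = 0 then k else b)
          (fun i => if i = 1 then c else if i = 0 then k else b) 1 (by intro j hj; simp [hj])
          (by simpa using h') (by simpa [Form.subst, QTerm.subst] using h)
        simpa [Form.subst, QTerm.subst] using this }

theorem proves_eqQ_congr {Θ : Set (Form R)} (t : QTerm) (τ τ' : ℕ → QTerm)
    (h : ∀ i, Proves Θ (.eqQ (τ i) (τ' i))) : Proves Θ (.eqQ (t.subst τ) (t.subst τ')) := by
  -- The two sides of `t = t` get disjoint variables, even ones on the left and odd ones on the
  -- right, so that only the right side is changed.
  have h1 := proves_subst_congr (Θ := Θ)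
    (.eqQ (t.subst fun i => .var (2 * i)) (t.subst fun i => .var (2 * i + 1)))
    id id (fun i => τ (i / 2)) (fun i => if i % 2 = 0 then τ (i / 2) else τ' (i / 2))
    (fun i => .reflB _) (fun i => ?_) ?_
  · simpa [Form.subst, QTerm.subst_subst, QTerm.subst, Nat.add_div] using h1
  · split_ifs
    exacts [.reflQ _, h _]
  · have : ∀ i, (2 * i + 1) / 2 = i := by omega
    simp only [Form.subst, QTerm.subst_subst, QTerm.subst, this]
    simpa using Proves.reflQ _

/-- The structure of provable equality classes. -/
def canonical : Struc R where
  B := Quotient (bodySetoid Θ)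
  Q := Quotient (termSetoid Θ)
  add := Quotient.map₂ .add fun s s' h t t' h' => by
    have := proves_eqQ_congr (Θ := Θ) (.add (.var 0) (.var 1)) (fun i => if i = 0 then s else t)
      (fun i => if i = 0 then s' else t') (fun i => by split_ifs; exacts [h, h'])
    exact this
  mul := Quotient.map₂ .mul fun s s' h t t' h' => by
    have := proves_eqQ_congr (Θ := Θ) (.mul (.var 0) (.var 1)) (fun i => if i = 0 then s else t)
      (fun i => if i = 0 then s' else t') (fun i => by split_ifs; exacts [h, h'])
    exact this
  le x y := ∃ s t, x = ⟦s⟧ ∧ y = ⟦t⟧ ∧ Proves Θ (.le s t)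
  rel r bs qs := ∃ ks ts, (∀ i, bs i = ⟦ks i⟧) ∧ (∀ i, qs i = ⟦ts i⟧) ∧ Proves Θ (.rel r ks ts)

theorem canonical_eval (t : QTerm) (τ : ℕ → QTerm) :
    t.eval (canonical Θ).add (canonical Θ).mul (fun i => (⟦τ i⟧ : Quotient (termSetoid Θ))) =
      (⟦t.subst τ⟧ : Quotient (termSetoid Θ)) := by
  induction t with
  | var i => rfl
  | add s t hs ht => simp only [QTerm.eval, hs, ht]; rfl
  | mul s t hs ht => simp only [QTerm.eval, hs, ht]; rfl

variable {Θ}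

theorem canonical_le_iff (s t : QTerm) :
    (canonical Θ).le (⟦s⟧ : Quotient (termSetoid Θ)) (⟦t⟧ : Quotient (termSetoid Θ)) ↔
      Proves Θ (.le s t) := by
  refine ⟨?_, fun h => ⟨s, t, rfl, rfl, h⟩⟩
  rintro ⟨s', t', hs, ht, h⟩
  have hs : Proves Θ (.eqQ s s') := Quotient.exact hs
  have ht : Proves Θ (.eqQ t t') := Quotient.exact ht
  have := proves_subst_congr (Θ := Θ) (.le (.var 0) (.var 1)) id id
    (fun i => if i = 0 then s' else t') (fun i => if i = 0 then s else t) (fun i => .reflB _)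
    (fun i => by
      split_ifs
      exacts [(termSetoid Θ).symm hs, (termSetoid Θ).symm ht])
    (by simpa [Form.subst, QTerm.subst] using h)
  simpa [Form.subst, QTerm.subst] using this

theorem canonical_rel_iff {m n : ℕ} (r : R m n) (ks : Fin m → ℕ) (ts : Fin n → QTerm) :
    (canonical Θ).rel r (fun i => (⟦ks i⟧ : Quotient (bodySetoid Θ)))
      (fun i => (⟦ts i⟧ : Quotient (termSetoid Θ))) ↔ Proves Θ (.rel r ks ts) := by
  refine ⟨?_, fun h => ⟨ks, ts, fun _ => rfl, fun _ => rfl, h⟩⟩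
  rintro ⟨ks', ts', hs, ht, h⟩
  have hs : ∀ i, Proves Θ (.eqB (ks i) (ks' i)) := fun i => Quotient.exact (hs i)
  have ht : ∀ i, Proves Θ (.eqQ (ts i) (ts' i)) := fun i => Quotient.exact (ht i)
  have := proves_subst_congr (Θ := Θ) (.rel r (fun i => i) (fun i => .var i))
    (fun i => if h : i < m then ks' ⟨i, h⟩ else i) (fun i => if h : i < m then ks ⟨i, h⟩ else i)
    (fun i => if h : i < n then ts' ⟨i, h⟩ else .var i)
    (fun i => if h : i < n then ts ⟨i, h⟩ else .var i)
    (fun i => by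
      split_ifs
      exacts [(bodySetoid Θ).symm (hs _), .reflB _])
    (fun i => by
      split_ifs
      exacts [(termSetoid Θ).symm (ht _), .reflQ _])
    (by simpa [Form.subst, QTerm.subst] using h)
  simpa [Form.subst, QTerm.subst] using this

/-- The truth lemma. All elements of the canonical structure are named by variables and terms, so a
quantifier over it is a conjunction of instances, which `IsHenkin` controls. -/
theorem IsHenkin.sat_canonical (hΘ : IsHenkin Θ) (φ : Form R) (σ : ℕ → ℕ) (τ : ℕ → QTerm) :
    Sat (canonical Θ) (fun i => (⟦σ i⟧ : Quotient (bodySetoid Θ)))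
      (fun i => (⟦τ i⟧ : Quotient (termSetoid Θ))) φ ↔ Proves Θ (φ.subst σ τ) := by
  induction φ generalizing σ τ with
  | falsum => exact ⟨False.elim, fun h => hΘ.consistent h⟩
  | eqB k b => exact Quotient.eq (r := bodySetoid Θ)
  | eqQ s t =>
    simp only [Sat, canonical_eval]
    exact Quotient.eq (r := termSetoid Θ)
  | le s t =>
    simp only [Sat, canonical_eval]
    exact canonical_le_iff _ _
  | rel r bs qs =>
    simp only [Sat, canonical_eval]
    exact canonical_rel_iff _ _ _
  | imp φ ψ ih ih' => simp only [Sat, Form.subst, hΘ.proves_imp_iff, ih, ih']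
  | allB φ ih =>
    simp only [Sat, Form.subst, hΘ.proves_allB_iff, Form.subst_upB_instB, ← ih]
    refine Iff.trans (Quotient.forall (s := bodySetoid Θ)) (forall_congr' fun k => ?_)
    have : scons (⟦k⟧ : Quotient (bodySetoid Θ)) (fun i => ⟦σ i⟧) = fun i => ⟦scons k σ i⟧ := by
      funext i; cases i <;> rfl
    exact iff_of_eq (congrArg (fun ρ => Sat (canonical Θ) ρ _ φ) this)
  | allQ φ ih =>
    simp only [Sat, Form.subst, hΘ.proves_allQ_iff, Form.subst_upQ_instQ, ← ih]
    refine Iff.trans (Quotient.forall (s := termSetoid Θ)) (forall_congr' fun k => ?_)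
    have : scons (⟦k⟧ : Quotient (termSetoid Θ)) (fun i => ⟦τ i⟧) = fun i => ⟦scons k τ i⟧ := by
      funext i; cases i <;> rfl
    exact iff_of_eq (congrArg (fun ρ => Sat (canonical Θ) _ ρ φ) this)

end Congruence

/-- Completeness for countable languages and theories that consist of sentences. -/
theorem Proves.complete [Countable (Form R)] {Γ : Set (Form R)} (hΓ : IsClosedTheory Γ)
    {φ : Form R} (h : ∀ (M : Struc R) (ρ : ℕ → M.B) (κ : ℕ → M.Q),
      (∀ γ ∈ Γ, Sat M ρ κ γ) → Sat M ρ κ φ) : Proves Γ φ := by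
  by_contra hφ
  have hc : Consistent (Γ ∪ {φ.neg}) := by
    intro hc
    rw [Set.union_singleton] at hc
    exact hφ (.raa hc)
  obtain ⟨Θ, hs, hΘ⟩ := hc.exists_isHenkin hΓ (Set.finite_singleton _)
  have key := fun χ => hΘ.sat_canonical χ id .var
  simp only [Form.subst_id] at key
  have h1 := h (canonical Θ) _ _ fun γ hγ => (key γ).2 (.hyp (hs (Or.inl hγ)))
  exact hΘ.consistent ((Proves.hyp (hs (Or.inr rfl))).impE ((key φ).1 h1))

end Henkin

/-! ## Translations and structures -/

section Translation

variable {R R' : ℕ → ℕ → Type}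

/-- The structure that the translation `T` defines in `M`. -/
def Translation.pull (T : Translation R R') (M : Struc R') : Struc R where
  B := M.B
  Q := M.Q
  add := M.add
  mul := M.mul
  le := M.le
  rel {m n} r bs qs := ∀ (ρ : ℕ → M.B) (κ : ℕ → M.Q), (∀ i : Fin m, ρ i = bs i.rev) →
    (∀ i : Fin n, κ i = qs i.rev) → Sat M ρ κ (T.form r)

/-- The free variables of `T.form r` are only its places, so one assignment with the right values
decides for all. The reversal appears because places are counted from the outside and indices from
the inside. -/
theorem Translation.pull_rel_iff (T : Translation R R') (M : Struc R') {m n : ℕ} (r : R m n)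
    (bs : Fin m → M.B) (qs : Fin n → M.Q) (ρ : ℕ → M.B) (κ : ℕ → M.Q)
    (hρ : ∀ i : Fin m, ρ i = bs i.rev) (hκ : ∀ i : Fin n, κ i = qs i.rev) :
    (T.pull M).rel r bs qs ↔ Sat M ρ κ (T.form r) := by
  refine ⟨fun h => h ρ κ hρ hκ, fun h ρ' κ' hρ' hκ' => ?_⟩
  refine (sat_congr M (T.closedAt r) (fun i hi => ?_) fun i hi => ?_).1 h
  · exact (hρ ⟨i, hi⟩).trans (hρ' ⟨i, hi⟩).symm
  · exact (hκ ⟨i, hi⟩).trans (hκ' ⟨i, hi⟩).symm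

theorem Translation.sat_tr (T : Translation R R') (M : Struc R') (φ : Form R) (ρ : ℕ → M.B)
    (κ : ℕ → M.Q) : Sat M ρ κ (T.tr φ) ↔ Sat (T.pull M) ρ κ φ := by
  induction φ generalizing ρ κ with
  | falsum => rfl
  | eqB k b => rfl
  | eqQ s t => rfl
  | le s t => rfl
  | rel r bs qs =>
    simp only [Translation.tr, sat_subst]
    refine (T.pull_rel_iff M r _ _ _ _ (fun i => ?_) fun i => ?_).symm
    · simp
    · simp; rfl
  | imp φ ψ ih ih' => simp only [Sat, Translation.tr, ih, ih']
  | allB φ ih => exact forall_congr' fun b => ih _ _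
  | allQ φ ih => exact forall_congr' fun b => ih _ _

/-- `M` is a model of the theory `Γ`; both sorts are nonempty. -/
structure IsModel (M : Struc R) (Γ : Set (Form R)) : Prop where
  nonempty_B : Nonempty M.B
  nonempty_Q : Nonempty M.Q
  sat : ∀ γ ∈ Γ, ∀ ρ κ, Sat M ρ κ γ

theorem isModel_of_sat {M : Struc R} {Γ : Set (Form R)} (hΓ : IsClosedTheory Γ) (ρ : ℕ → M.B)
    (κ : ℕ → M.Q) (h : ∀ γ ∈ Γ, Sat M ρ κ γ) : IsModel M Γ := ⟨⟨ρ 0⟩, ⟨κ 0⟩, fun γ hγ _ _ =>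
  (sat_congr M (hΓ γ hγ) (fun _ hi => absurd hi (Nat.not_lt_zero _))
    fun _ hi => absurd hi (Nat.not_lt_zero _)).1 (h γ hγ)⟩

theorem sat_iff (M : Struc R) (ρ : ℕ → M.B) (κ : ℕ → M.Q) (φ ψ : Form R) :
    Sat M ρ κ (.iff φ ψ) ↔ (Sat M ρ κ φ ↔ Sat M ρ κ ψ) := by
  simp only [Form.iff, Form.and, Form.neg, Sat]
  tauto

theorem sat_rel_congr (M : Struc R) {rel : ∀ {m n : ℕ}, R m n → (Fin m → M.B) → (Fin n → M.Q) → Prop}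
    (h : ∀ {m n : ℕ} (r : R m n) bs qs, rel r bs qs ↔ M.rel r bs qs) (ρ : ℕ → M.B)
    (κ : ℕ → M.Q) (φ : Form R) : Sat { M with rel := rel } ρ κ φ ↔ Sat M ρ κ φ := by
  have : @rel = @M.rel := by
    funext m n r bs qs
    exact propext (h r bs qs)
  subst this
  rfl

/-- Definitional equivalence follows from a correspondence of models. -/
theorem isDefinitionalEquivalenceWith_of_models [Countable (Form R)] [Countable (Form R')]
    {Th : Set (Form R)} {Th' : Set (Form R')} {T : Translation R R'} {T' : Translation R' R}
    (hTh : IsClosedTheory Th) (hTh' : IsClosedTheory Th')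
    (h1 : ∀ M, IsModel M Th' → IsModel (T.pull M) Th)
    (h2 : ∀ M, IsModel M Th → IsModel (T'.pull M) Th')
    (h3 : ∀ M : Struc R, IsModel M Th → ∀ {m n : ℕ} (r : R m n) (bs : Fin m → M.B)
      (qs : Fin n → M.Q), (T.pull (T'.pull M)).rel r bs qs ↔ M.rel r bs qs)
    (h4 : ∀ M : Struc R', IsModel M Th' → ∀ {m n : ℕ} (r : R' m n) (bs : Fin m → M.B)
      (qs : Fin n → M.Q), (T'.pull (T.pull M)).rel r bs qs ↔ M.rel r bs qs) :
    IsDefinitionalEquivalenceWith Th Th' T T' := by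
  refine ⟨fun φ hφ => ?_, fun φ hφ => ?_, fun φ => ?_, fun φ => ?_⟩
  · refine Proves.complete hTh' fun M ρ κ hM => (T.sat_tr M φ ρ κ).2 ?_
    exact hφ.sound _ _ _ fun γ hγ => (h1 M (isModel_of_sat hTh' ρ κ hM)).sat γ hγ _ _
  · refine Proves.complete hTh fun M ρ κ hM => (T'.sat_tr M φ ρ κ).2 ?_
    exact hφ.sound _ _ _ fun γ hγ => (h2 M (isModel_of_sat hTh ρ κ hM)).sat γ hγ _ _
  · refine Proves.complete hTh fun M ρ κ hM => (sat_iff M ρ κ _ _).2 ?_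
    refine ((T'.sat_tr M _ ρ κ).trans (T.sat_tr (T'.pull M) φ ρ κ)).trans ?_
    exact sat_rel_congr M (h3 M (isModel_of_sat hTh ρ κ hM)) ρ κ φ
  · refine Proves.complete hTh' fun M ρ κ hM => (sat_iff M ρ κ _ _).2 ?_
    refine ((T.sat_tr M _ ρ κ).trans (T'.sat_tr (T.pull M) φ ρ κ)).trans ?_
    exact sat_rel_congr M (h4 M (isModel_of_sat hTh' ρ κ hM)) ρ κ φ

end Translation

end Kinematics

namespace Kinematics

/-! ## Semantics of the formulas over Euclidean fields -/

/-- Interpretations of the relation symbols on given sets of bodies and quantities. -/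
abbrev RelOn (ε : Bool) (B Q : Type) : Type :=
  ∀ {m n : ℕ}, Sym ε m n → (Fin m → B) → (Fin n → Q) → Prop

/-- Nonnegative elements are squares of nonnegative elements. -/
class HasSqrt (Q : Type) [Field Q] [LinearOrder Q] : Prop where
  exists_sqrt : ∀ x : Q, 0 ≤ x → ∃ r : Q, 0 ≤ r ∧ r * r = x

set_option linter.unusedSectionVars false

variable {ε : Bool} {B Q : Type} [Field Q] [LinearOrder Q]

/-- The structure with the given ordered field of quantities. -/
abbrev fieldStruc (rel : RelOn ε B Q) : Struc (Sym ε) where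
  B := B
  Q := Q
  add x y := x + y
  mul x y := x * y
  le x y := x ≤ y
  rel := rel

/-- Values for variables, with the depth at which a formula is written. -/
structure Ctx (B Q : Type) where
  ρ : ℕ → B
  d : ℕ
  κ : ℕ → Q
  q : ℕ

/-- The value of the body variable `k` is `b`. -/
def BV (Γ : Ctx B Q) (k : BVar) (b : B) : Prop := k.lvl < Γ.d ∧ Γ.ρ (Γ.d - 1 - k.lvl) = b

/-- The value of the quantity variable of level `l` is `x`. -/
def QV (Γ : Ctx B Q) (l : ℕ) (x : Q) : Prop := l < Γ.q ∧ Γ.κ (Γ.q - 1 - l) = x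

namespace Ctx

/-- The context `Γ'` extends `Γ`. -/
structure Le (Γ Γ' : Ctx B Q) : Prop where
  body : ∀ k b, BV Γ k b → BV Γ' k b
  quantity : ∀ l x, QV Γ l x → QV Γ' l x

theorem Le.refl (Γ : Ctx B Q) : Γ.Le Γ := ⟨fun _ _ h => h, fun _ _ h => h⟩

theorem Le.trans {Γ Γ' Γ'' : Ctx B Q} (h : Γ.Le Γ') (h' : Γ'.Le Γ'') : Γ.Le Γ'' :=
  ⟨fun k b hk => h'.body k b (h.body k b hk), fun l x hl => h'.quantity l x (h.quantity l x hl)⟩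

/-- Extension by a body. -/
def pushB (Γ : Ctx B Q) (b : B) : Ctx B Q := { Γ with ρ := scons b Γ.ρ, d := Γ.d + 1 }

/-- Extension by a quantity. -/
def pushQ (Γ : Ctx B Q) (x : Q) : Ctx B Q := { Γ with κ := scons x Γ.κ, q := Γ.q + 1 }

/-- A new quantifier raises the index of an older variable and the depth by one, and so leaves its
level and its value fixed. This is why values of expressions persist under quantifiers. -/
theorem le_pushB (Γ : Ctx B Q) (b : B) : Γ.Le (Γ.pushB b) := by
  refine ⟨fun k c hk => ⟨Nat.lt_succ_of_lt hk.1, ?_⟩, fun _ _ h => h⟩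
  obtain ⟨h1, h2⟩ := hk
  have : Γ.d + 1 - 1 - k.lvl = (Γ.d - 1 - k.lvl) + 1 := by omega
  simp only [pushB, this, scons_succ, h2]

theorem le_pushQ (Γ : Ctx B Q) (x : Q) : Γ.Le (Γ.pushQ x) := by
  refine ⟨fun _ _ h => h, fun l c hk => ⟨Nat.lt_succ_of_lt hk.1, ?_⟩⟩
  obtain ⟨h1, h2⟩ := hk
  have : Γ.q + 1 - 1 - l = (Γ.q - 1 - l) + 1 := by omega
  simp only [pushQ, this, scons_succ, h2]

theorem pushB_top (Γ : Ctx B Q) (b : B) : BV (Γ.pushB b) ⟨Γ.d⟩ b := by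
  refine ⟨Nat.lt_succ_self _, ?_⟩
  simp [pushB]

theorem pushQ_top (Γ : Ctx B Q) (x : Q) : QV (Γ.pushQ x) Γ.q x := by
  refine ⟨Nat.lt_succ_self _, ?_⟩
  simp [pushQ]

end Ctx

/-- The value of a term whose variables are levels. -/
def TDen (Γ : Ctx B Q) : QTerm → Q → Prop
  | .var l, x => QV Γ l x
  | .add s t, x => ∃ y z, TDen Γ s y ∧ TDen Γ t z ∧ x = y + z
  | .mul s t, x => ∃ y z, TDen Γ s y ∧ TDen Γ t z ∧ x = y * z

/-- The value of an expression. -/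
def Den (Γ : Ctx B Q) : Expr → Q → Prop
  | .var l, x => QV Γ l x
  | .zero, x => x = 0
  | .one, x => x = 1
  | .add a b, x => ∃ y z, Den Γ a y ∧ Den Γ b z ∧ x = y + z
  | .sub a b, x => ∃ y z, Den Γ a y ∧ Den Γ b z ∧ x = y - z
  | .mul a b, x => ∃ y z, Den Γ a y ∧ Den Γ b z ∧ x = y * z
  | .div a b, x => ∃ y z, Den Γ a y ∧ Den Γ b z ∧ z ≠ 0 ∧ x = y / z
  | .sqrt a, x => ∃ y, Den Γ a y ∧ 0 ≤ x ∧ x * x = y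
  | .abs a, x => ∃ y, Den Γ a y ∧ x = |y|

theorem TDen.mono {Γ Γ' : Ctx B Q} {t : QTerm} {x : Q} (h : TDen Γ t x) (hΓ : Γ.Le Γ') :
    TDen Γ' t x := by
  induction t generalizing x with
  | var l => exact hΓ.quantity _ _ h
  | add s t ih ih' => obtain ⟨y, z, hy, hz, e⟩ := h; exact ⟨y, z, ih hy, ih' hz, e⟩
  | mul s t ih ih' => obtain ⟨y, z, hy, hz, e⟩ := h; exact ⟨y, z, ih hy, ih' hz, e⟩

theorem Den.mono {Γ Γ' : Ctx B Q} {a : Expr} {x : Q} (h : Den Γ a x) (hΓ : Γ.Le Γ') :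
    Den Γ' a x := by
  induction a generalizing x with
  | var l => exact hΓ.quantity _ _ h
  | zero => exact h
  | one => exact h
  | add a b ih ih' => obtain ⟨y, z, hy, hz, e⟩ := h; exact ⟨y, z, ih hy, ih' hz, e⟩
  | sub a b ih ih' => obtain ⟨y, z, hy, hz, e⟩ := h; exact ⟨y, z, ih hy, ih' hz, e⟩
  | mul a b ih ih' => obtain ⟨y, z, hy, hz, e⟩ := h; exact ⟨y, z, ih hy, ih' hz, e⟩
  | div a b ih ih' => obtain ⟨y, z, hy, hz, e⟩ := h; exact ⟨y, z, ih hy, ih' hz, e⟩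
  | sqrt a ih => obtain ⟨y, hy, e⟩ := h; exact ⟨y, ih hy, e⟩
  | abs a ih => obtain ⟨y, hy, e⟩ := h; exact ⟨y, ih hy, e⟩

theorem TDen.eval_eq {Γ : Ctx B Q} {t : QTerm} {x : Q} (h : TDen Γ t x) :
    (Pre.idxQ Γ.q t).eval (fun x y => x + y) (fun x y => x * y) Γ.κ = x := by
  induction t generalizing x with
  | var l => exact h.2
  | add s t ih ih' => obtain ⟨y, z, hy, hz, rfl⟩ := h; exact congrArg₂ _ (ih hy) (ih' hz)
  | mul s t ih ih' => obtain ⟨y, z, hy, hz, rfl⟩ := h; exact congrArg₂ _ (ih hy) (ih' hz)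

theorem TDen.add {Γ : Ctx B Q} {s t : QTerm} {x y : Q} (h : TDen Γ s x) (h' : TDen Γ t y) :
    TDen Γ (.add s t) (x + y) := ⟨x, y, h, h', rfl⟩

theorem TDen.mul {Γ : Ctx B Q} {s t : QTerm} {x y : Q} (h : TDen Γ s x) (h' : TDen Γ t y) :
    TDen Γ (.mul s t) (x * y) := ⟨x, y, h, h', rfl⟩

section DenOps

variable {Γ : Ctx B Q} {a b : Expr} {x y : Q}

theorem Den.zero : Den Γ 0 (0 : Q) := rfl
theorem Den.one : Den Γ 1 (1 : Q) := rfl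
theorem Den.add (h : Den Γ a x) (h' : Den Γ b y) : Den Γ (a + b) (x + y) := ⟨x, y, h, h', rfl⟩
theorem Den.sub (h : Den Γ a x) (h' : Den Γ b y) : Den Γ (a - b) (x - y) := ⟨x, y, h, h', rfl⟩
theorem Den.mul (h : Den Γ a x) (h' : Den Γ b y) : Den Γ (a * b) (x * y) := ⟨x, y, h, h', rfl⟩
theorem Den.div (h : Den Γ a x) (h' : Den Γ b y) (hy : y ≠ 0) : Den Γ (a / b) (x / y) :=
  ⟨x, y, h, h', hy, rfl⟩
theorem Den.abs (h : Den Γ a x) : Den Γ (.abs a) |x| := ⟨x, h, rfl⟩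

/-- The square root. -/
noncomputable def rt [HasSqrt Q] (x : Q) : Q :=
  if h : 0 ≤ x then (HasSqrt.exists_sqrt x h).choose else 0

theorem rt_nonneg [HasSqrt Q] (x : Q) : 0 ≤ rt x := by
  unfold rt
  split_ifs with h
  exacts [(HasSqrt.exists_sqrt x h).choose_spec.1, le_rfl]

theorem rt_mul_self [HasSqrt Q] {x : Q} (h : 0 ≤ x) : rt x * rt x = x := by
  rw [rt, dif_pos h]
  exact (HasSqrt.exists_sqrt x h).choose_spec.2

theorem Den.sqrt [HasSqrt Q] (h : Den Γ a x) (hx : 0 ≤ x) : Den Γ (.sqrt a) (rt x) :=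
  ⟨x, h, rt_nonneg x, rt_mul_self hx⟩

end DenOps

/-- The formula holds in the context `Γ`. -/
def Holds (rel : RelOn ε B Q) (Γ : Ctx B Q) (φ : Pre (Sym ε)) : Prop :=
  Sat (fieldStruc rel) Γ.ρ Γ.κ (φ Γ.d Γ.q)

section Holds

variable {rel : RelOn ε B Q} {Γ : Ctx B Q} {φ ψ : Pre (Sym ε)}

theorem holds_imp {p q : Prop} (h : Holds rel Γ φ ↔ p) (h' : Holds rel Γ ψ ↔ q) :
    Holds rel Γ (φ ⇒' ψ) ↔ (p → q) := imp_congr h h'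

theorem holds_neg {p : Prop} (h : Holds rel Γ φ ↔ p) : Holds rel Γ (¬' φ) ↔ ¬ p :=
  imp_congr h Iff.rfl

/-- The second conjunct is evaluated under the first, which may be what makes its divisions and
roots defined. -/
theorem holds_and' {p q : Prop} (h : Holds rel Γ φ ↔ p) (h' : p → (Holds rel Γ ψ ↔ q)) :
    Holds rel Γ (φ ∧' ψ) ↔ p ∧ q := by
  have : Holds rel Γ (φ ∧' ψ) ↔ Holds rel Γ φ ∧ Holds rel Γ ψ := by
    simp only [Holds, Pre.and, Form.and, Form.neg, Sat]
    tauto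
  rw [this, h]
  exact and_congr_right h'

theorem holds_and {p q : Prop} (h : Holds rel Γ φ ↔ p) (h' : Holds rel Γ ψ ↔ q) :
    Holds rel Γ (φ ∧' ψ) ↔ p ∧ q := holds_and' h fun _ => h'

theorem holds_or {p q : Prop} (h : Holds rel Γ φ ↔ p) (h' : Holds rel Γ ψ ↔ q) :
    Holds rel Γ (φ ∨' ψ) ↔ p ∨ q := by
  rw [← h, ← h']
  simp only [Holds, Pre.or, Form.or, Form.neg, Sat]
  tauto

theorem holds_iff {p q : Prop} (h : Holds rel Γ φ ↔ p) (h' : Holds rel Γ ψ ↔ q) :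
    Holds rel Γ (φ ⇔' ψ) ↔ (p ↔ q) := by
  rw [← h, ← h']
  simp only [Holds, Pre.iff, Form.iff, Form.and, Form.neg, Sat]
  tauto

theorem holds_allB {f : BVar → Pre (Sym ε)} {p : B → Prop}
    (h : ∀ Γ', Γ.Le Γ' → ∀ k b, BV Γ' k b → (Holds rel Γ' (f k) ↔ p b)) :
    Holds rel Γ (Pre.allB f) ↔ ∀ b, p b :=
  forall_congr' fun b => h (Γ.pushB b) (Γ.le_pushB b) ⟨Γ.d⟩ b (Γ.pushB_top b)

theorem holds_exB {f : BVar → Pre (Sym ε)} {p : B → Prop}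
    (h : ∀ Γ', Γ.Le Γ' → ∀ k b, BV Γ' k b → (Holds rel Γ' (f k) ↔ p b)) :
    Holds rel Γ (Pre.exB f) ↔ ∃ b, p b := by
  have h1 : Holds rel Γ (Pre.exB f) ↔ ∃ b, Holds rel (Γ.pushB b) (f ⟨Γ.d⟩) := not_forall_not
  exact h1.trans (exists_congr fun b => h (Γ.pushB b) (Γ.le_pushB b) ⟨Γ.d⟩ b (Γ.pushB_top b))

theorem holds_allQ {f : Expr → Pre (Sym ε)} {p : Q → Prop}
    (h : ∀ Γ', Γ.Le Γ' → ∀ a x, Den Γ' a x → (Holds rel Γ' (f a) ↔ p x)) :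
    Holds rel Γ (Pre.allQ f) ↔ ∀ x, p x :=
  forall_congr' fun x => h (Γ.pushQ x) (Γ.le_pushQ x) (.var Γ.q) x (Γ.pushQ_top x)

theorem holds_exQ {f : Expr → Pre (Sym ε)} {p : Q → Prop}
    (h : ∀ Γ', Γ.Le Γ' → ∀ a x, Den Γ' a x → (Holds rel Γ' (f a) ↔ p x)) :
    Holds rel Γ (Pre.exQ f) ↔ ∃ x, p x := by
  have h1 : Holds rel Γ (Pre.exQ f) ↔ ∃ x, Holds rel (Γ.pushQ x) (f (.var Γ.q)) := not_forall_not
  exact h1.trans (exists_congr fun x => h (Γ.pushQ x) (Γ.le_pushQ x) (.var Γ.q) x (Γ.pushQ_top x))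

theorem holds_exT {f : QTerm → Pre (Sym ε)} {p : Q → Prop}
    (h : ∀ Γ', Γ.Le Γ' → ∀ t x, TDen Γ' t x → (Holds rel Γ' (f t) ↔ p x)) :
    Holds rel Γ (Pre.exT f) ↔ ∃ x, p x := by
  have h1 : Holds rel Γ (Pre.exT f) ↔ ∃ x, Holds rel (Γ.pushQ x) (f (.var Γ.q)) := not_forall_not
  exact h1.trans (exists_congr fun x => h (Γ.pushQ x) (Γ.le_pushQ x) (.var Γ.q) x (Γ.pushQ_top x))

theorem holds_eqT {s t : QTerm} {x y : Q} (hs : TDen Γ s x) (ht : TDen Γ t y) :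
    Holds rel Γ (Pre.eqT s t) ↔ x = y := by
  show _ = _ ↔ _
  rw [hs.eval_eq, ht.eval_eq]

theorem holds_leT {s t : QTerm} {x y : Q} (hs : TDen Γ s x) (ht : TDen Γ t y) :
    Holds rel Γ (Pre.leT s t) ↔ x ≤ y := by
  show _ ≤ _ ↔ _
  rw [hs.eval_eq, ht.eval_eq]

variable [IsStrictOrderedRing Q]

theorem holds_isZero {t : QTerm} {x : Q} (ht : TDen Γ t x) :
    Holds rel Γ (Pre.isZero t) ↔ x = 0 :=
  (holds_eqT (ht.add ht) ht).trans (by simp)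

theorem holds_isOne {t : QTerm} {x : Q} (ht : TDen Γ t x) :
    Holds rel Γ (Pre.isOne t) ↔ x = 1 := by
  refine (holds_and (holds_eqT (ht.mul ht) ht) (holds_neg (holds_isZero ht))).trans ?_
  constructor
  · rintro ⟨h1, h2⟩
    exact mul_right_cancel₀ h2 (by rw [h1, one_mul])
  · rintro rfl; simp

theorem holds_nonnegT {t : QTerm} {x : Q} (ht : TDen Γ t x) :
    Holds rel Γ (Pre.nonnegT t) ↔ 0 ≤ x := by
  refine (holds_exT fun Γ' hΓ s y hs =>
    holds_and (holds_isZero hs) (holds_leT hs (ht.mono hΓ))).trans ?_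
  simp

/-- Elimination of an expression that has a value. -/
theorem holds_elim {a : Expr} {x : Q} (ha : Den Γ a x) {K : QTerm → Pre (Sym ε)} {p : Q → Prop}
    (h : ∀ Γ', Γ.Le Γ' → ∀ t x, TDen Γ' t x → (Holds rel Γ' (K t) ↔ p x)) :
    Holds rel Γ (a.elim K) ↔ p x := by
  induction a generalizing Γ x K p with
  | var l => exact h Γ (.refl Γ) (.var l) x ha
  | zero =>
    obtain rfl : x = 0 := ha
    exact (holds_exT fun Γ' hΓ s y hs => holds_and (holds_isZero hs) (h Γ' hΓ s y hs)).trans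
      (by simp)
  | one =>
    obtain rfl : x = 1 := ha
    exact (holds_exT fun Γ' hΓ s y hs => holds_and (holds_isOne hs) (h Γ' hΓ s y hs)).trans
      (by simp)
  | add a b ih ih' =>
    obtain ⟨y, z, hy, hz, rfl⟩ := ha
    exact ih hy (p := fun y => p (y + z)) fun Γ1 h1 s y hs => ih' (hz.mono h1)
      (p := fun z => p (y + z)) fun Γ2 h2 t z ht =>
      h Γ2 (h1.trans h2) _ _ ((hs.mono h2).add ht)
  | mul a b ih ih' =>
    obtain ⟨y, z, hy, hz, rfl⟩ := ha
    exact ih hy (p := fun y => p (y * z)) fun Γ1 h1 s y hs => ih' (hz.mono h1)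
      (p := fun z => p (y * z)) fun Γ2 h2 t z ht =>
      h Γ2 (h1.trans h2) _ _ ((hs.mono h2).mul ht)
  | sub a b ih ih' =>
    obtain ⟨y, z, hy, hz, rfl⟩ := ha
    refine ih hy (p := fun y => p (y - z)) fun Γ1 h1 s y hs => ih' (hz.mono h1)
      (p := fun z => p (y - z)) fun Γ2 h2 t z ht =>
      (holds_exT fun Γ3 h3 r w hr => holds_and (holds_eqT (hr.add (ht.mono h3))
        (hs.mono (h2.trans h3))) (h Γ3 (h1.trans (h2.trans h3)) r w hr)).trans ?_
    simp only [← eq_sub_iff_add_eq, exists_eq_left]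
  | div a b ih ih' =>
    obtain ⟨y, z, hy, hz, h0, rfl⟩ := ha
    -- The induction hypotheses quantify over all values of the subterms, so the condition that the
    -- divisor is nonzero has to travel inside the predicate.
    have key := ih hy (K := fun s => b.elim fun t => Pre.exT fun r =>
      Pre.and (Pre.and (Pre.neg (Pre.isZero t)) (Pre.eqT (.mul r t) s)) (K r))
      (p := fun y => z ≠ 0 ∧ p (y / z)) fun Γ1 h1 s y hs => ih' (hz.mono h1)
      (p := fun z => z ≠ 0 ∧ p (y / z)) fun Γ2 h2 t z ht =>
      (holds_exT fun Γ3 h3 r w hr => holds_and (holds_and (holds_neg (holds_isZero (ht.mono h3)))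
        (holds_eqT (hr.mul (ht.mono h3))
        (hs.mono (h2.trans h3)))) (h Γ3 (h1.trans (h2.trans h3)) r w hr)).trans ?_
    · exact key.trans (and_iff_right h0)
    · constructor
      · rintro ⟨w, ⟨h1, rfl⟩, h2⟩
        exact ⟨h1, by rwa [mul_div_cancel_right₀ _ h1]⟩
      · rintro ⟨h1, h2⟩
        exact ⟨_, ⟨h1, div_mul_cancel₀ _ h1⟩, h2⟩
  | sqrt a ih =>
    obtain ⟨y, hy, h0, rfl⟩ := ha
    have key := ih hy (K := fun s => Pre.exT fun r =>
      Pre.and (Pre.and (Pre.nonnegT r) (Pre.eqT (.mul r r) s)) (K r))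
      (p := fun y => ∃ w, (0 ≤ w ∧ w * w = y) ∧ p w) fun Γ1 h1 s y hs =>
      (holds_exT fun Γ3 h3 r w hr => holds_and (holds_and (holds_nonnegT hr)
        (holds_eqT (hr.mul hr)
        (hs.mono h3))) (h Γ3 (h1.trans h3) r w hr))
    refine key.trans ⟨?_, fun hp => ⟨x, ⟨h0, rfl⟩, hp⟩⟩
    rintro ⟨w, ⟨hw, e⟩, hp⟩
    -- A nonnegative root is unique.
    rwa [← (mul_self_inj hw h0).1 e]
  | abs a ih =>
    obtain ⟨y, hy, rfl⟩ := ha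
    have key := ih hy (K := fun s => Pre.exT fun r =>
      Pre.and (Pre.and (Pre.nonnegT r) (Pre.or (Pre.eqT r s) (Pre.isZero (.add r s)))) (K r))
      (p := fun y => ∃ w, (0 ≤ w ∧ (w = y ∨ w + y = 0)) ∧ p w) fun Γ1 h1 s y hs =>
      (holds_exT fun Γ3 h3 r w hr => holds_and (holds_and (holds_nonnegT hr)
        (holds_or (holds_eqT hr (hs.mono h3)) (holds_isZero (hr.add (hs.mono h3)))))
        (h Γ3 (h1.trans h3) r w hr))
    refine key.trans ⟨?_, fun hp => ⟨_, ⟨abs_nonneg _, ?_⟩, hp⟩⟩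
    · rintro ⟨w, ⟨hw, rfl | e⟩, hp⟩
      · rwa [abs_of_nonneg hw]
      · obtain rfl : y = -w := by linear_combination e
        rwa [abs_neg, abs_of_nonneg hw]
    · rcases abs_choice y with h | h
      · exact Or.inl h
      · exact Or.inr (by rw [h]; ring)

variable {a b : Expr} {x y : Q}

theorem holds_eq (ha : Den Γ a x) (hb : Den Γ b y) : Holds rel Γ (a =' b) ↔ x = y :=
  holds_elim ha (p := fun x => x = y) fun _ h1 _ x hs => holds_elim (hb.mono h1)
    (p := fun y => x = y) fun _ h2 _ _ ht => holds_eqT (hs.mono h2) ht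

theorem holds_le (ha : Den Γ a x) (hb : Den Γ b y) : Holds rel Γ (a ≤' b) ↔ x ≤ y :=
  holds_elim ha (p := fun x => x ≤ y) fun _ h1 _ x hs => holds_elim (hb.mono h1)
    (p := fun y => x ≤ y) fun _ h2 _ _ ht => holds_leT (hs.mono h2) ht

theorem holds_lt (ha : Den Γ a x) (hb : Den Γ b y) : Holds rel Γ (a <' b) ↔ x < y :=
  holds_elim ha (p := fun x => x < y) fun _ h1 _ x hs => holds_elim (hb.mono h1)
    (p := fun y => x < y) fun _ h2 _ _ ht =>
    (holds_and (holds_leT (hs.mono h2) ht) (holds_neg (holds_eqT (hs.mono h2) ht))).trans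
      lt_iff_le_and_ne.symm

end Holds

end Kinematics

namespace Kinematics

set_option linter.unusedSectionVars false

/-- Events: a time and a place. -/
abbrev Ev (Q : Type) : Type := Q × (Fin 3 → Q)

/-- The interpretations of the symbols of kinematics, with `Q⁴` as `Q × Q³`. -/
structure Kin (B Q : Type) where
  IOb : B → Prop
  Ph : B → Prop
  W : B → B → Ev Q → Prop

/-- The kinematics given by an interpretation of the symbols. -/
def kin {ε : Bool} {B Q : Type} (rel : RelOn ε B Q) : Kin B Q where
  IOb k := rel Sym.IOb ![k] ![]
  Ph p := rel Sym.Ph ![p] ![]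
  W k b X := rel Sym.W ![k, b] ![X.1, X.2 0, X.2 1, X.2 2]

/-! ### Kinematic notions and axioms as statements about a structure. -/

section Notions

variable {B Q : Type} [Field Q] [LinearOrder Q] [IsStrictOrderedRing Q] [HasSqrt Q]

/-- Spatial distance. -/
noncomputable def sp (X Y : Ev Q) : Q := rt ((X.2 - Y.2) ⬝ᵥ (X.2 - Y.2))

/-- Affine maps of `Q⁴`. -/
def aff (m₀ m₁ m₂ m₃ z : Ev Q) (X : Ev Q) : Ev Q :=
  (m₀.1 * X.1 + m₀.2 ⬝ᵥ X.2 + z.1,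
    ![m₁.1 * X.1 + m₁.2 ⬝ᵥ X.2 + z.2 0, m₂.1 * X.1 + m₂.2 ⬝ᵥ X.2 + z.2 1,
      m₃.1 * X.1 + m₃.2 ⬝ᵥ X.2 + z.2 2])

/-- The map is affine. -/
def IsAff (T : Ev Q → Ev Q) : Prop := ∃ m₀ m₁ m₂ m₃ z, T = aff m₀ m₁ m₂ m₃ z

/-- The map is a translation of time and an isometry of space. -/
def IsTriv (T : Ev Q → Ev Q) : Prop :=
  ∀ X Y, (T X).1 - (T Y).1 = X.1 - Y.1 ∧ sp (T X) (T Y) = sp X Y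

/-- The map is a reversal of time with a translation, and an isometry of space. -/
def IsTrivReversed (T : Ev Q → Ev Q) : Prop :=
  ∀ X Y, (T X).1 - (T Y).1 = Y.1 - X.1 ∧ sp (T X) (T Y) = sp X Y

namespace Kin

variable (K : Kin B Q)

def SameEv (k h : B) (X Y : Ev Q) : Prop := ∀ b, K.W k b X ↔ K.W h b Y

def Speed (k b : B) (v : Q) : Prop :=
  (∃ X Y, K.W k b X ∧ K.W k b Y ∧ ¬ X = Y) ∧
    ∀ X Y, K.W k b X ∧ K.W k b Y → sp X Y = v * |X.1 - Y.1|

def Velocity (k b : B) (v : Fin 3 → Q) : Prop :=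
  (∃ X Y, K.W k b X ∧ K.W k b Y ∧ ¬ X = Y) ∧
    ∀ X Y, K.W k b X ∧ K.W k b Y → Y.2 - X.2 = (Y.1 - X.1) • v

def Light (k : B) (c : Q) : Prop :=
  ∀ X Y, (∃ p, K.Ph p ∧ K.W k p X ∧ K.W k p Y) ↔ sp X Y = c * |X.1 - Y.1|

def Ether (e : B) : Prop := K.IOb e ∧ ∃ c, 0 < c ∧ K.Light e c

def IsCe (c : Q) : Prop := ∀ e, K.Ether e → ∀ p, K.Ph p → ∀ v, K.Speed e p v → v = c

def IsC (c : Q) : Prop := 0 < c ∧ ∀ k, K.IOb k → K.Light k c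

def WorldviewIs (k h : B) (T : Ev Q → Ev Q) : Prop := ∀ X Y, K.SameEv k h X Y ↔ Y = T X

end Kin

/-- The spatial map of the definition of radarization. -/
def rot (u : Q) (v : Fin 3 → Q) (X : Ev Q) : Ev Q :=
  (X.1,
    ![(0 - v 0 * X.2 0 - v 1 * X.2 1 - v 2 * X.2 2) / u,
      (v 1 * X.2 0 + (0 - v 0 - v 2 * v 2 * (u - v 0) / (v 1 * v 1 + v 2 * v 2)) * X.2 1 +
        v 1 * v 2 * (u - v 0) / (v 1 * v 1 + v 2 * v 2) * X.2 2) / u,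
      (v 2 * X.2 0 + v 1 * v 2 * (u - v 0) / (v 1 * v 1 + v 2 * v 2) * X.2 1 +
        (0 - v 0 - v 1 * v 1 * (u - v 0) / (v 1 * v 1 + v 2 * v 2)) * X.2 2) / u])

/-- The graph of `R_v`. -/
def RotRel (u : Q) (v : Fin 3 → Q) (X Y : Ev Q) : Prop :=
  (¬ (v 1 = 0 ∧ v 2 = 0) ∧ Y = rot u v X) ∨ (v 0 ≤ 0 ∧ v 1 = 0 ∧ v 2 = 0 ∧ Y = X) ∨
    (0 < v 0 ∧ v 1 = 0 ∧ v 2 = 0 ∧ Y = (X.1, -X.2))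

/-- The graph of radarization, for a light speed `c`. -/
def RadRel (c : Q) (v : Fin 3 → Q) (X Y : Ev Q) : Prop :=
  ∃ u, u = rt (v ⬝ᵥ v) ∧ u < c ∧ ∃ X₁ X₂ X₃ X₄ : Ev Q, RotRel u v X X₁ ∧
    X₂ = (X₁.1, ![u * X₁.1 + X₁.2 0, X₁.2 1, X₁.2 2]) ∧
    X₃ = (X₂.1 / (1 - u * u / (c * c)) - u / (c * c) / (1 - u * u / (c * c)) * X₂.2 0,
      ![X₂.2 0 / (1 - u * u / (c * c)) - u / (1 - u * u / (c * c)) * X₂.1,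
        X₂.2 1 / rt (1 - u * u / (c * c)), X₂.2 2 / rt (1 - u * u / (c * c))]) ∧
    X₄ = rt (1 - u * u / (c * c)) • X₃ ∧ RotRel u v Y X₄

/-- The axioms that both theories share, except the one about quantities. -/
structure IsKinFull (K : Kin B Q) : Prop where
  ev : ∀ k, K.IOb k → ∀ h, K.IOb h → ∀ X, ∃ Y, K.SameEv k h X Y
  self : ∀ k, K.IOb k → ∀ X, K.W k k X ↔ X.2 0 = 0 ∧ X.2 1 = 0 ∧ X.2 2 = 0
  symD : ∀ k, K.IOb k → ∀ k', K.IOb k' → ∀ X Y X' Y', |X.1 - Y.1| = 0 ∧ |X'.1 - Y'.1| = 0 ∧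
    K.SameEv k k' X X' ∧ K.SameEv k k' Y Y' → sp X Y = sp X' Y'
  line : ∀ k, K.IOb k → ∀ h, K.IOb h → ∀ X Y Z, K.W k h X ∧ K.W k h Y ∧ K.W k h Z →
    ∃ a : Q, Z - X = a • (Y - X) ∨ Y - Z = a • (Z - X)
  triv : ∀ T, IsAff T → IsTriv T → ∀ k, K.IOb k → ∃ k', K.IOb k' ∧ K.WorldviewIs k k' T
  noAcc : ∀ k, (∃ b X, K.W k b X) → K.IOb k

/-- The axioms of classical kinematics with slower than light observers. -/
structure IsClassical (K : Kin B Q) : Prop extends IsKinFull K where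
  absTime : ∀ k, K.IOb k → ∀ k', K.IOb k' → ∀ X Y X' Y',
    K.SameEv k k' X X' ∧ K.SameEv k k' Y Y' → |X.1 - Y.1| = |X'.1 - Y'.1|
  ether : ∃ e, K.Ether e
  noFTL : ∀ k, K.IOb k → ∀ e, K.Ether e → ∃ v, K.Speed e k v ∧ ∃ c, K.IsCe c ∧ v < c
  inhabited : ∃ h, K.IOb h
  thExp : ∀ e, K.Ether e → ∀ X Y, (∃ c, K.IsCe c ∧ sp X Y < c * |X.1 - Y.1|) →
    ∃ k, K.IOb k ∧ K.W e k X ∧ K.W e k Y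

/-- The axioms of special relativity with primitive ether. -/
structure IsRelativistic (K : Kin B Q) (E : B → Prop) : Prop extends IsKinFull K where
  phc : ∃ c, 0 < c ∧ ∀ k, K.IOb k → K.Light k c
  inhabited : ∃ h, K.IOb h
  thExp : ∀ k, K.IOb k → ∀ X Y, (∃ c, K.IsC c ∧ sp X Y < c * |X.1 - Y.1|) →
    ∃ k', K.IOb k' ∧ K.W k k' X ∧ K.W k k' Y
  primitiveEther : ∃ e, K.IOb e ∧ ∀ k, (K.IOb k ∧ ∃ T, IsAff T ∧
    (IsTriv T ∨ IsTrivReversed T) ∧ K.WorldviewIs e k T) ↔ E k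

end Notions

/-! ### Evaluation of the formulas for these notions. -/

section Evaluation

variable {ε : Bool} {B Q : Type} [Field Q] [LinearOrder Q] [IsStrictOrderedRing Q]
variable {rel : RelOn ε B Q} {Γ : Ctx B Q}

/-- The value of a point. -/
structure DenPt (Γ : Ctx B Q) (p : Pt) (X : Ev Q) : Prop where
  t : Den Γ (p 0) X.1
  x : Den Γ (p 1) (X.2 0)
  y : Den Γ (p 2) (X.2 1)
  z : Den Γ (p 3) (X.2 2)

/-- The value of a vector. -/
structure DenVec (Γ : Ctx B Q) (v : Vec) (V : Fin 3 → Q) : Prop where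
  x : Den Γ (v 0) (V 0)
  y : Den Γ (v 1) (V 1)
  z : Den Γ (v 2) (V 2)

theorem DenPt.mono {Γ' : Ctx B Q} {x : Pt} {X : Ev Q} (h : DenPt Γ x X) (hΓ : Γ.Le Γ') :
    DenPt Γ' x X := ⟨h.t.mono hΓ, h.x.mono hΓ, h.y.mono hΓ, h.z.mono hΓ⟩

theorem DenVec.mono {Γ' : Ctx B Q} {x : Vec} {X : Fin 3 → Q} (h : DenVec Γ x X)
    (hΓ : Γ.Le Γ') : DenVec Γ' x X := ⟨h.x.mono hΓ, h.y.mono hΓ, h.z.mono hΓ⟩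

theorem BV.mono {Γ' : Ctx B Q} {k : BVar} {b : B} (h : BV Γ k b) (hΓ : Γ.Le Γ') : BV Γ' k b :=
  hΓ.body k b h

theorem forall_ev {p : Ev Q → Prop} : (∀ X, p X) ↔ ∀ t x y z : Q, p (t, ![x, y, z]) := by
  refine ⟨fun h t x y z => h _, fun h X => ?_⟩
  have : X = (X.1, ![X.2 0, X.2 1, X.2 2]) := by
    ext i
    · rfl
    · fin_cases i <;> rfl
  rw [this]
  exact h _ _ _ _

theorem exists_ev {p : Ev Q → Prop} : (∃ X, p X) ↔ ∃ t x y z : Q, p (t, ![x, y, z]) := by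
  have := not_congr (forall_ev (p := fun X => ¬ p X))
  simpa only [not_forall, not_not] using this

theorem holds_allPt {f : Pt → Pre (Sym ε)} {p : Ev Q → Prop}
    (h : ∀ Γ', Γ.Le Γ' → ∀ x X, DenPt Γ' x X → (Holds rel Γ' (f x) ↔ p X)) :
    Holds rel Γ (allPt f) ↔ ∀ X, p X := by
  rw [forall_ev]
  exact holds_allQ fun Γ1 h1 a t ha => holds_allQ fun Γ2 h2 b x hb => holds_allQ fun Γ3 h3 c y hc =>
    holds_allQ fun Γ4 h4 d z hd => h Γ4 (h1.trans (h2.trans (h3.trans h4))) _ _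
      ⟨ha.mono (h2.trans (h3.trans h4)), hb.mono (h3.trans h4), hc.mono h4, hd⟩

theorem holds_exPt {f : Pt → Pre (Sym ε)} {p : Ev Q → Prop}
    (h : ∀ Γ', Γ.Le Γ' → ∀ x X, DenPt Γ' x X → (Holds rel Γ' (f x) ↔ p X)) :
    Holds rel Γ (exPt f) ↔ ∃ X, p X := by
  rw [exists_ev]
  exact holds_exQ fun Γ1 h1 a t ha => holds_exQ fun Γ2 h2 b x hb => holds_exQ fun Γ3 h3 c y hc =>
    holds_exQ fun Γ4 h4 d z hd => h Γ4 (h1.trans (h2.trans (h3.trans h4))) _ _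
      ⟨ha.mono (h2.trans (h3.trans h4)), hb.mono (h3.trans h4), hc.mono h4, hd⟩

theorem holds_exVec {f : Vec → Pre (Sym ε)} {p : (Fin 3 → Q) → Prop}
    (h : ∀ Γ', Γ.Le Γ' → ∀ x X, DenVec Γ' x X → (Holds rel Γ' (f x) ↔ p X)) :
    Holds rel Γ (exVec f) ↔ ∃ X, p X := by
  have : (∃ X, p X) ↔ ∃ x y z : Q, p ![x, y, z] := by
    refine ⟨fun ⟨X, hX⟩ => ⟨X 0, X 1, X 2, ?_⟩, fun ⟨x, y, z, h⟩ => ⟨_, h⟩⟩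
    have : ![X 0, X 1, X 2] = X := by ext i; fin_cases i <;> rfl
    rwa [this]
  rw [this]
  exact holds_exQ fun Γ2 h2 b x hb => holds_exQ fun Γ3 h3 c y hc =>
    holds_exQ fun Γ4 h4 d z hd => h Γ4 (h2.trans (h3.trans h4)) _ _
      ⟨hb.mono (h3.trans h4), hc.mono h4, hd⟩

theorem holds_IOb {k : BVar} {b : B} (hk : BV Γ k b) :
    Holds rel Γ (IOb k) ↔ (kin rel).IOb b := by
  refine iff_of_eq ?_
  simp only [Holds, IOb, Sat, kin]
  congr 1
  · funext i; fin_cases i; exact hk.2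
  · funext i; exact i.elim0

theorem holds_Ph {k : BVar} {b : B} (hk : BV Γ k b) :
    Holds rel Γ (Ph k) ↔ (kin rel).Ph b := by
  refine iff_of_eq ?_
  simp only [Holds, Ph, Sat, kin]
  congr 1
  · funext i; fin_cases i; exact hk.2
  · funext i; exact i.elim0

theorem holds_E {rel : RelOn true B Q} {k : BVar} {b : B} (hk : BV Γ k b) :
    Holds rel Γ (E k) ↔ rel Sym.E ![b] ![] := by
  refine iff_of_eq ?_
  simp only [Holds, E, Sat]
  congr 1
  · funext i; fin_cases i; exact hk.2
  · funext i; exact i.elim0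

theorem holds_W {k h : BVar} {b b' : B} (hk : BV Γ k b) (hh : BV Γ h b') {x : Pt} {X : Ev Q}
    (hx : DenPt Γ x X) : Holds rel Γ (W k h x) ↔ (kin rel).W b b' X := by
  refine holds_elim hx.t (p := fun t => rel Sym.W ![b, b'] ![t, X.2 0, X.2 1, X.2 2])
    fun Γ1 h1 t₀ x₀ ht₀ => holds_elim (hx.x.mono h1)
    (p := fun t => rel Sym.W ![b, b'] ![x₀, t, X.2 1, X.2 2])
    fun Γ2 h2 t₁ x₁ ht₁ => holds_elim (hx.y.mono (h1.trans h2))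
    (p := fun t => rel Sym.W ![b, b'] ![x₀, x₁, t, X.2 2])
    fun Γ3 h3 t₂ x₂ ht₂ => holds_elim (hx.z.mono (h1.trans (h2.trans h3)))
    (p := fun t => rel Sym.W ![b, b'] ![x₀, x₁, x₂, t])
    fun Γ4 h4 t₃ x₃ ht₃ => iff_of_eq ?_
  have hΓ := h1.trans (h2.trans (h3.trans h4))
  simp only [Holds, Sat]
  congr 1
  · funext i; fin_cases i
    exacts [(hk.mono hΓ).2, (hh.mono hΓ).2]
  · funext i; fin_cases i
    exacts [(ht₀.mono (h2.trans (h3.trans h4))).eval_eq, (ht₁.mono (h3.trans h4)).eval_eq,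
      (ht₂.mono h4).eval_eq, ht₃.eval_eq]

theorem holds_allIOb {f : BVar → Pre (Sym ε)} {p : B → Prop}
    (h : ∀ Γ', Γ.Le Γ' → ∀ k b, BV Γ' k b → (Holds rel Γ' (f k) ↔ p b)) :
    Holds rel Γ (allIOb f) ↔ ∀ b, (kin rel).IOb b → p b :=
  holds_allB fun Γ' h' k b hk => holds_imp (holds_IOb hk) (h Γ' h' k b hk)

theorem holds_exIOb {f : BVar → Pre (Sym ε)} {p : B → Prop}
    (h : ∀ Γ', Γ.Le Γ' → ∀ k b, BV Γ' k b → (Holds rel Γ' (f k) ↔ p b)) :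
    Holds rel Γ (exIOb f) ↔ ∃ b, (kin rel).IOb b ∧ p b :=
  holds_exB fun Γ' h' k b hk => holds_and (holds_IOb hk) (h Γ' h' k b hk)

theorem holds_eqPt {x y : Pt} {X Y : Ev Q} (hx : DenPt Γ x X) (hy : DenPt Γ y Y) :
    Holds rel Γ (eqPt x y) ↔ X = Y := by
  refine (holds_and (holds_eq hx.t hy.t) (holds_and (holds_eq hx.x hy.x)
    (holds_and (holds_eq hx.y hy.y) (holds_eq hx.z hy.z)))).trans ?_
  constructor
  · rintro ⟨h1, h2, h3, h4⟩
    ext i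
    · exact h1
    · fin_cases i <;> assumption
  · rintro rfl; simp

theorem DenPt.sub {x y : Pt} {X Y : Ev Q} (hx : DenPt Γ x X) (hy : DenPt Γ y Y) :
    DenPt Γ (fun i => x i - y i) (X - Y) :=
  ⟨hx.t.sub hy.t, hx.x.sub hy.x, hx.y.sub hy.y, hx.z.sub hy.z⟩

theorem DenPt.smul {a : Expr} {c : Q} (ha : Den Γ a c) {y : Pt} {Y : Ev Q}
    (hy : DenPt Γ y Y) : DenPt Γ (fun i => a * y i) (c • Y) :=
  ⟨ha.mul hy.t, ha.mul hy.x, ha.mul hy.y, ha.mul hy.z⟩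

theorem den_time {x y : Pt} {X Y : Ev Q} (hx : DenPt Γ x X) (hy : DenPt Γ y Y) :
    Den Γ (time x y) |X.1 - Y.1| := (hx.t.sub hy.t).abs

theorem holds_sameEvent {k h : BVar} {b b' : B} (hk : BV Γ k b) (hh : BV Γ h b') {x y : Pt}
    {X Y : Ev Q} (hx : DenPt Γ x X) (hy : DenPt Γ y Y) :
    Holds rel Γ (sameEvent k h x y) ↔ (kin rel).SameEv b b' X Y :=
  holds_allB fun _ h1 _ _ hl => holds_iff (holds_W (hk.mono h1) hl (hx.mono h1))
    (holds_W (hh.mono h1) hl (hy.mono h1))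

theorem holds_twoPoints {k h : BVar} {b b' : B} (hk : BV Γ k b) (hh : BV Γ h b') :
    Holds rel Γ (exPt fun x => exPt fun y => W k h x ∧' W k h y ∧' ¬' eqPt x y) ↔
      ∃ X Y, (kin rel).W b b' X ∧ (kin rel).W b b' Y ∧ ¬ X = Y :=
  holds_exPt fun _ h1 _ _ hx => holds_exPt fun _ h2 _ _ hy =>
    holds_and (holds_W (hk.mono (h1.trans h2)) (hh.mono (h1.trans h2)) (hx.mono h2))
      (holds_and (holds_W (hk.mono (h1.trans h2)) (hh.mono (h1.trans h2)) hy)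
        (holds_neg (holds_eqPt (hx.mono h2) hy)))

theorem holds_velocity {k h : BVar} {b b' : B} (hk : BV Γ k b) (hh : BV Γ h b') {v : Vec}
    {V : Fin 3 → Q} (hv : DenVec Γ v V) :
    Holds rel Γ (velocity k h v) ↔ (kin rel).Velocity b b' V := by
  refine holds_and (holds_twoPoints hk hh) (holds_allPt fun _ h1 _ X hx =>
    holds_allPt fun _ h2 _ Y hy =>
    holds_imp (holds_and (holds_W (hk.mono (h1.trans h2)) (hh.mono (h1.trans h2)) (hx.mono h2))
      (holds_W (hk.mono (h1.trans h2)) (hh.mono (h1.trans h2)) hy)) ?_)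
  have hv := hv.mono (h1.trans h2)
  have hx := hx.mono h2
  refine (holds_and (holds_eq (hy.x.sub hx.x) (hv.x.mul (hy.t.sub hx.t)))
    (holds_and (holds_eq (hy.y.sub hx.y) (hv.y.mul (hy.t.sub hx.t)))
      (holds_eq (hy.z.sub hx.z) (hv.z.mul (hy.t.sub hx.t))))).trans ?_
  rw [funext_iff, Fin.forall_fin_succ, Fin.forall_fin_succ, Fin.forall_fin_succ]
  simp [mul_comm]

theorem DenPt.affine {m₀ m₁ m₂ m₃ z x : Pt} {M₀ M₁ M₂ M₃ Z X : Ev Q} (h₀ : DenPt Γ m₀ M₀)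
    (h₁ : DenPt Γ m₁ M₁) (h₂ : DenPt Γ m₂ M₂) (h₃ : DenPt Γ m₃ M₃) (hz : DenPt Γ z Z)
    (hx : DenPt Γ x X) : DenPt Γ (affine ![m₀, m₁, m₂, m₃] z x) (aff M₀ M₁ M₂ M₃ Z X) := by
  have key : ∀ {m : Pt} {M : Ev Q} {b : Expr} {w : Q}, DenPt Γ m M → Den Γ b w →
      Den Γ (m 0 * x 0 + m 1 * x 1 + m 2 * x 2 + m 3 * x 3 + b) (M.1 * X.1 + M.2 ⬝ᵥ X.2 + w) := by
    intro m M b w hm hb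
    have := ((((hm.t.mul hx.t).add (hm.x.mul hx.x)).add (hm.y.mul hx.y)).add
      (hm.z.mul hx.z)).add hb
    convert this using 1
    simp [dotProduct, Fin.sum_univ_three]
    ring
  exact ⟨key h₀ hz.t, key h₁ hz.x, key h₂ hz.y, key h₃ hz.z⟩

/-- The value of a map of points. -/
def DenMap (Γ : Ctx B Q) (T : Pt → Pt) (T' : Ev Q → Ev Q) : Prop :=
  ∀ Γ', Γ.Le Γ' → ∀ x X, DenPt Γ' x X → DenPt Γ' (T x) (T' X)

theorem DenMap.mono {Γ' : Ctx B Q} {T : Pt → Pt} {T' : Ev Q → Ev Q} (h : DenMap Γ T T')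
    (hΓ : Γ.Le Γ') : DenMap Γ' T T' := fun Γ'' h' => h Γ'' (hΓ.trans h')

theorem holds_allAffine {f : (Pt → Pt) → Pre (Sym ε)} {p : (Ev Q → Ev Q) → Prop}
    (h : ∀ Γ', Γ.Le Γ' → ∀ T T', DenMap Γ' T T' → (Holds rel Γ' (f T) ↔ p T')) :
    Holds rel Γ (allAffine f) ↔ ∀ T, IsAff T → p T := by
  have : (∀ T, IsAff T → p T) ↔ ∀ m₀ m₁ m₂ m₃ z : Ev Q, p (aff m₀ m₁ m₂ m₃ z) :=
    ⟨fun h _ _ _ _ _ => h _ ⟨_, _, _, _, _, rfl⟩, by rintro h _ ⟨_, _, _, _, _, rfl⟩; apply h⟩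
  rw [this]
  exact holds_allPt fun Γ1 h1 _ _ ha => holds_allPt fun Γ2 h2 _ _ hb =>
    holds_allPt fun Γ3 h3 _ _ hc => holds_allPt fun Γ4 h4 _ _ hd => holds_allPt fun Γ5 h5 _ _ he =>
    h Γ5 (h1.trans (h2.trans (h3.trans (h4.trans h5)))) _ _ fun Γ6 h6 _ _ hx =>
    .affine (ha.mono (h2.trans (h3.trans (h4.trans (h5.trans h6)))))
      (hb.mono (h3.trans (h4.trans (h5.trans h6)))) (hc.mono (h4.trans (h5.trans h6)))
      (hd.mono (h5.trans h6)) (he.mono h6) hx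

theorem holds_exAffine {f : (Pt → Pt) → Pre (Sym ε)} {p : (Ev Q → Ev Q) → Prop}
    (h : ∀ Γ', Γ.Le Γ' → ∀ T T', DenMap Γ' T T' → (Holds rel Γ' (f T) ↔ p T')) :
    Holds rel Γ (exAffine f) ↔ ∃ T, IsAff T ∧ p T := by
  have : (∃ T, IsAff T ∧ p T) ↔ ∃ m₀ m₁ m₂ m₃ z : Ev Q, p (aff m₀ m₁ m₂ m₃ z) :=
    ⟨by rintro ⟨_, ⟨m₀, m₁, m₂, m₃, z, rfl⟩, h⟩; exact ⟨m₀, m₁, m₂, m₃, z, h⟩,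
      by rintro ⟨m₀, m₁, m₂, m₃, z, h⟩; exact ⟨_, ⟨m₀, m₁, m₂, m₃, z, rfl⟩, h⟩⟩
  rw [this]
  exact holds_exPt fun Γ1 h1 _ _ ha => holds_exPt fun Γ2 h2 _ _ hb =>
    holds_exPt fun Γ3 h3 _ _ hc => holds_exPt fun Γ4 h4 _ _ hd => holds_exPt fun Γ5 h5 _ _ he =>
    h Γ5 (h1.trans (h2.trans (h3.trans (h4.trans h5)))) _ _ fun Γ6 h6 _ _ hx =>
    .affine (ha.mono (h2.trans (h3.trans (h4.trans (h5.trans h6)))))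
      (hb.mono (h3.trans (h4.trans (h5.trans h6)))) (hc.mono (h4.trans (h5.trans h6)))
      (hd.mono (h5.trans h6)) (he.mono h6) hx

theorem holds_worldviewIs {k h : BVar} {b b' : B} (hk : BV Γ k b) (hh : BV Γ h b') {T : Pt → Pt}
    {T' : Ev Q → Ev Q} (hT : DenMap Γ T T') :
    Holds rel Γ (worldviewIs k h T) ↔ (kin rel).WorldviewIs b b' T' :=
  holds_allPt fun _ h1 _ _ hx => holds_allPt fun _ h2 _ _ hy =>
    holds_iff (holds_sameEvent (hk.mono (h1.trans h2)) (hh.mono (h1.trans h2)) (hx.mono h2) hy)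
      (holds_eqPt hy (hT _ (h1.trans h2) _ _ (hx.mono h2)))

variable [HasSqrt Q]

theorem dotProduct_self_nonneg' (v : Fin 3 → Q) : 0 ≤ v ⬝ᵥ v :=
  Finset.sum_nonneg fun i _ => mul_self_nonneg (v i)

theorem den_space {x y : Pt} {X Y : Ev Q} (hx : DenPt Γ x X) (hy : DenPt Γ y Y) :
    Den Γ (space x y) (sp X Y) := by
  refine Den.sqrt ?_ (dotProduct_self_nonneg' _)
  have := (((hx.x.sub hy.x).mul (hx.x.sub hy.x)).add ((hx.y.sub hy.y).mul (hx.y.sub hy.y))).add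
    ((hx.z.sub hy.z).mul (hx.z.sub hy.z))
  convert this using 1
  simp [dotProduct, Fin.sum_univ_three]

theorem holds_speed {k h : BVar} {b b' : B} (hk : BV Γ k b) (hh : BV Γ h b') {v : Expr}
    {V : Q} (hv : Den Γ v V) :
    Holds rel Γ (speed k h v) ↔ (kin rel).Speed b b' V :=
  holds_and (holds_twoPoints hk hh) (holds_allPt fun _ h1 _ _ hx =>
    holds_allPt fun _ h2 _ _ hy =>
    holds_imp (holds_and (holds_W (hk.mono (h1.trans h2)) (hh.mono (h1.trans h2)) (hx.mono h2))
      (holds_W (hk.mono (h1.trans h2)) (hh.mono (h1.trans h2)) hy))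
      (holds_eq (den_space (hx.mono h2) hy)
        ((hv.mono (h1.trans h2)).mul (den_time (hx.mono h2) hy))))

theorem holds_lightSpeed {k : BVar} {b : B} (hk : BV Γ k b) {c : Expr} {C : Q}
    (hc : Den Γ c C) : Holds rel Γ (lightSpeed k c) ↔ (kin rel).Light b C :=
  holds_allPt fun _ h1 _ _ hx => holds_allPt fun _ h2 _ _ hy =>
    holds_iff (holds_exB fun _ h3 _ _ hp =>
      have h23 := h2.trans h3
      have h13 := h1.trans h23
      holds_and (holds_Ph hp) (holds_and (holds_W (hk.mono h13) hp (hx.mono h23))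
        (holds_W (hk.mono h13) hp (hy.mono h3))))
      (holds_eq (den_space (hx.mono h2) hy)
        ((hc.mono (h1.trans h2)).mul (den_time (hx.mono h2) hy)))

theorem holds_Ether {k : BVar} {b : B} (hk : BV Γ k b) :
    Holds rel Γ (Ether k) ↔ (kin rel).Ether b :=
  holds_and (holds_IOb hk) (holds_exQ fun _ h1 _ _ hc =>
    holds_and (holds_lt .zero hc) (holds_lightSpeed (hk.mono h1) hc))

theorem holds_isCe {c : Expr} {C : Q} (hc : Den Γ c C) :
    Holds rel Γ (isCe c) ↔ (kin rel).IsCe C :=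
  holds_allB fun _ h1 _ _ he => holds_imp (holds_Ether he) (holds_allB fun _ h2 _ _ hp =>
    holds_imp (holds_Ph hp) (holds_allQ fun _ h3 _ _ hv =>
      holds_imp (holds_speed (he.mono (h2.trans h3)) (hp.mono h3) hv)
        (holds_eq hv (hc.mono (h1.trans (h2.trans h3))))))

theorem holds_isC {c : Expr} {C : Q} (hc : Den Γ c C) :
    Holds rel Γ (isC c) ↔ (kin rel).IsC C :=
  holds_and (holds_lt .zero hc) (holds_allIOb fun _ h1 _ _ hk =>
    holds_lightSpeed hk (hc.mono h1))

theorem holds_Triv {T : Pt → Pt} {T' : Ev Q → Ev Q} (hT : DenMap Γ T T') :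
    Holds rel Γ (Triv T) ↔ IsTriv T' :=
  holds_allPt fun _ h1 _ _ hx => holds_allPt fun _ h2 _ _ hy =>
    have hx := hx.mono h2
    have hTx := hT _ (h1.trans h2) _ _ hx
    have hTy := hT _ (h1.trans h2) _ _ hy
    holds_and (holds_eq (hTx.t.sub hTy.t) (hx.t.sub hy.t))
      (holds_eq (den_space hTx hTy) (den_space hx hy))

theorem holds_TrivReversed {T : Pt → Pt} {T' : Ev Q → Ev Q} (hT : DenMap Γ T T') :
    Holds rel Γ (TrivReversed T) ↔ IsTrivReversed T' :=
  holds_allPt fun _ h1 _ _ hx => holds_allPt fun _ h2 _ _ hy =>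
    have hx := hx.mono h2
    have hTx := hT _ (h1.trans h2) _ _ hx
    have hTy := hT _ (h1.trans h2) _ _ hy
    holds_and (holds_eq (hTx.t.sub hTy.t) (hy.t.sub hx.t))
      (holds_eq (den_space hTx hTy) (den_space hx hy))

/-- In the first case `v 1` and `v 2` are not both zero, and with `hU` both divisors of the matrix
are nonzero. -/
theorem holds_Rot {u : Expr} {U : Q} (hu : Den Γ u U) {v : Vec} {V : Fin 3 → Q}
    (hv : DenVec Γ v V) (hU : U * U = V ⬝ᵥ V) {x y : Pt} {X Y : Ev Q} (hx : DenPt Γ x X)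
    (hy : DenPt Γ y Y) : Holds rel Γ (Rot u v x y) ↔ RotRel U V X Y := by
  have h12 := holds_and (rel := rel) (holds_eq hv.y (.zero (Q := Q))) (holds_eq hv.z .zero)
  refine holds_or (holds_and' (holds_neg h12) fun hne => ?_)
    (holds_or (holds_and (holds_le hv.x .zero) (holds_and (holds_eq hv.y .zero)
      (holds_and (holds_eq hv.z .zero) (holds_eqPt hy hx))))
      (holds_and (holds_lt .zero hv.x) (holds_and (holds_eq hv.y .zero)
      (holds_and (holds_eq hv.z .zero) ?_))))
  · have hr : V 1 * V 1 + V 2 * V 2 ≠ 0 := by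
      intro h0
      have h1 := mul_self_nonneg (V 1)
      have h2 := mul_self_nonneg (V 2)
      exact hne ⟨mul_self_eq_zero.1 (by linarith), mul_self_eq_zero.1 (by linarith)⟩
    have hU0 : U ≠ 0 := by
      rintro rfl
      simp only [dotProduct, Fin.sum_univ_three] at hU
      have h0 := mul_self_nonneg (V 0)
      have h1 := mul_self_nonneg (V 1)
      have h2 := mul_self_nonneg (V 2)
      exact hr (by linarith)
    have dr := (hv.y.mul hv.y).add (hv.z.mul hv.z)
    have da := hu.sub hv.x
    have d12 := (((hv.y.mul hv.z).mul da).div dr hr)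
    have d22 := (((hv.z.mul hv.z).mul da).div dr hr)
    have d11 := (((hv.y.mul hv.y).mul da).div dr hr)
    refine holds_eqPt hy (X := Y) (Y := rot U V X) ⟨hx.t, ?_, ?_, ?_⟩
    · exact ((((Den.zero).sub (hv.x.mul hx.x)).sub (hv.y.mul hx.y)).sub
        (hv.z.mul hx.z)).div hu hU0
    · exact (((hv.y.mul hx.x).add (((Den.zero.sub hv.x).sub d22).mul hx.y)).add
        (d12.mul hx.z)).div hu hU0
    · exact (((hv.z.mul hx.x).add (d12.mul hx.y)).add
        (((Den.zero.sub hv.x).sub d11).mul hx.z)).div hu hU0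
  · refine holds_eqPt hy ⟨hx.t, ?_, ?_, ?_⟩
    · simpa using Den.zero.sub hx.x
    · simpa using Den.zero.sub hx.y
    · simpa using Den.zero.sub hx.z

theorem holds_Rad {c : Expr} {C : Q} (hc : Den Γ c C) {v : Vec} {V : Fin 3 → Q}
    (hv : DenVec Γ v V) {x y : Pt} {X Y : Ev Q} (hx : DenPt Γ x X)
    (hy : DenPt Γ y Y) : Holds rel Γ (Rad c v x y) ↔ RadRel C V X Y := by
  refine holds_exQ fun Γ1 h1 u U hu => ?_
  have hc := hc.mono h1
  have hx := hx.mono h1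
  have hy := hy.mono h1
  have hv := hv.mono h1
  have hsq : Den Γ1 (v 0 * v 0 + v 1 * v 1 + v 2 * v 2) (V ⬝ᵥ V) := by
    have := ((hv.x.mul hv.x).add (hv.y.mul hv.y)).add (hv.z.mul hv.z)
    convert this using 1
    simp [dotProduct, Fin.sum_univ_three]
  refine holds_and' (holds_eq hu (hsq.sqrt (dotProduct_self_nonneg' _))) fun hU =>
    holds_and' (holds_lt hu hc) fun hUC => ?_
  have hU0 : 0 ≤ U := hU ▸ rt_nonneg _
  have hUU : U * U = V ⬝ᵥ V := by rw [hU, rt_mul_self (dotProduct_self_nonneg' _)]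
  have hC0 : 0 < C := hU0.trans_lt hUC
  have hCC : C * C ≠ 0 := (mul_pos hC0 hC0).ne'
  -- The conjuncts already evaluated give `u < c`, so the divisors that follow are positive.
  have ha : 0 < 1 - U * U / (C * C) := by
    rw [sub_pos, div_lt_one (mul_pos hC0 hC0)]
    exact mul_self_lt_mul_self hU0 hUC
  have hrt : rt (1 - U * U / (C * C)) ≠ 0 := by
    intro h0
    have := rt_mul_self ha.le
    rw [h0] at this
    simp only [mul_zero] at this
    exact ha.ne this
  refine holds_exPt fun Γ2 h2 x₁ X₁ hx₁ => holds_exPt fun Γ3 h3 x₂ X₂ hx₂ =>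
    holds_exPt fun Γ4 h4 x₃ X₃ hx₃ => holds_exPt fun Γ5 h5 x₄ X₄ hx₄ => ?_
  have hΓ := h2.trans (h3.trans (h4.trans h5))
  have hc := hc.mono hΓ
  have hx := hx.mono hΓ
  have hy := hy.mono hΓ
  have hv := hv.mono hΓ
  have hu := hu.mono hΓ
  have hx₁ := hx₁.mono (h3.trans (h4.trans h5))
  have hx₂ := hx₂.mono (h4.trans h5)
  have hx₃ := hx₃.mono h5
  have da : Den Γ5 (1 - u * u / (c * c)) (1 - U * U / (C * C)) :=
    Den.one.sub ((hu.mul hu).div (hc.mul hc) hCC)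
  have ds := da.sqrt ha.le
  refine holds_and (holds_Rot hu hv hUU hx hx₁) (holds_and (holds_eqPt hx₂ ⟨hx₁.t, ?_, hx₁.y, hx₁.z⟩)
    (holds_and (holds_eqPt hx₃ ⟨?_, ?_, ?_, ?_⟩) (holds_and (holds_eqPt hx₄ (.smul ds hx₃))
      (holds_Rot hu hv hUU hy hx₄))))
  · exact (hu.mul hx₁.t).add hx₁.x
  · exact (hx₂.t.div da ha.ne').sub (((hu.div (hc.mul hc) hCC).div da ha.ne').mul hx₂.x)
  · exact (hx₂.x.div da ha.ne').sub ((hu.div da ha.ne').mul hx₂.t)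
  · exact hx₂.y.div ds hrt
  · exact hx₂.z.div ds hrt

theorem holds_RadAt {isLight : Expr → Pre (Sym ε)} {p : Q → Prop}
    (hl : ∀ Γ', Γ.Le Γ' → ∀ c C, Den Γ' c C → (Holds rel Γ' (isLight c) ↔ p C))
    {k h : BVar} {b b' : B} (hk : BV Γ k b) (hh : BV Γ h b') {x y : Pt} {X Y : Ev Q}
    (hx : DenPt Γ x X) (hy : DenPt Γ y Y) :
    Holds rel Γ (RadAt isLight k h x y) ↔
      ∃ V, (kin rel).Velocity b b' V ∧ ∃ C, p C ∧ RadRel C V X Y :=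
  holds_exVec fun _ h1 _ _ hv => holds_and (holds_velocity (hk.mono h1) (hh.mono h1) hv)
    (holds_exQ fun _ h2 _ _ hc => holds_and (hl _ (h1.trans h2) _ _ hc)
      (holds_Rad hc (hv.mono h2) (hx.mono (h1.trans h2)) (hy.mono (h1.trans h2))))

end Evaluation

end Kinematics

namespace Kinematics

set_option linter.unusedSectionVars false

/-! ## Models of the two theories -/

section Sat

variable {R : ℕ → ℕ → Type} {M : Struc R} {ρ : ℕ → M.B} {κ : ℕ → M.Q} {φ ψ : Form R}

theorem sat_neg : Sat M ρ κ φ.neg ↔ ¬ Sat M ρ κ φ := Iff.rfl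

theorem sat_and : Sat M ρ κ (φ.and ψ) ↔ Sat M ρ κ φ ∧ Sat M ρ κ ψ := by
  simp only [Form.and, Form.neg, Sat]; tauto

theorem sat_or : Sat M ρ κ (φ.or ψ) ↔ Sat M ρ κ φ ∨ Sat M ρ κ ψ := by
  simp only [Form.or, Form.neg, Sat]; tauto

theorem sat_exQ : Sat M ρ κ φ.exQ ↔ ∃ x, Sat M ρ (scons x κ) φ := not_forall_not

end Sat

/-- The axioms of Euclidean fields. -/
def IsEuclideanField {Q : Type} (add mul : Q → Q → Q) (le : Q → Q → Prop) : Prop :=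
  ∃ o i, (∀ x y z, add (add x y) z = add x (add y z)) ∧ (∀ x y, add x y = add y x) ∧
    (∀ x, add x o = x) ∧ (∀ x, ∃ y, add x y = o) ∧
    (∀ x y z, mul (mul x y) z = mul x (mul y z)) ∧ (∀ x y, mul x y = mul y x) ∧
    (∀ x, mul x i = x) ∧ ¬ i = o ∧ (∀ x, ¬ x = o → ∃ y, mul x y = i) ∧
    (∀ x y z, mul x (add y z) = add (mul x y) (mul x z)) ∧ (∀ x, le x x) ∧
    (∀ x y, le x y ∧ le y x → x = y) ∧ (∀ x y z, le x y ∧ le y z → le x z) ∧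
    (∀ x y, le x y ∨ le y x) ∧ (∀ x y z, le x y → le (add x z) (add y z)) ∧
    (∀ x y, le o x ∧ le o y → le o (mul x y)) ∧ ∀ x, le o x ∧ ¬ o = x → ∃ y, mul y y = x

/-- The only axiom that is evaluated in an arbitrary structure, since the calculus of `Holds`
presupposes the field that this axiom provides. -/
theorem sat_AxEField {ε : Bool} (M : Struc (Sym ε)) (ρ : ℕ → M.B) (κ : ℕ → M.Q) :
    Sat M ρ κ (sentence AxEField) ↔ IsEuclideanField M.add M.mul M.le := by
  simp only [sentence, AxEField, Pre.exQ, Pre.allQ, Pre.and, Pre.or, Pre.neg, Pre.imp, sat_and,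
    sat_or, sat_neg, sat_exQ, Pre.eq, Pre.le, Pre.lt, Expr.elim, Pre.eqT, Pre.leT, Sat, Pre.idxQ,
    QTerm.subst, QTerm.eval, Nat.reduceAdd, Nat.reduceSub, zero_add, scons, Nat.sub_zero]
  exact Iff.rfl

theorem IsEuclideanField.exists_field {Q : Type} {add mul : Q → Q → Q} {le : Q → Q → Prop}
    (h : IsEuclideanField add mul le) : ∃ (_ : Field Q) (_ : LinearOrder Q)
      (_ : IsStrictOrderedRing Q) (_ : HasSqrt Q),
      add = (fun x y => x + y) ∧ mul = (fun x y => x * y) ∧ le = fun x y => x ≤ y := by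
  classical
  obtain ⟨o, i, hadd_assoc, hadd_comm, hadd_zero, hadd_neg, hmul_assoc, hmul_comm, hmul_one,
    hne, hinv, hdistrib, hrefl, hantisymm, htrans, htotal, hadd_le, hmul_le, hsqrt⟩ := h
  choose neg hneg using hadd_neg
  choose inv hinv using hinv
  let _ : Add Q := ⟨add⟩
  let _ : Mul Q := ⟨mul⟩
  let _ : Neg Q := ⟨neg⟩
  -- The default value at zero is the one that a `Field` requires.
  let _ : Inv Q := ⟨fun x => if h : x = o then o else inv x h⟩
  let _ : Zero Q := ⟨o⟩
  let _ : One Q := ⟨i⟩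
  let F : Field Q := Field.ofMinimalAxioms Q hadd_assoc
    (fun a => (hadd_comm o a).trans (hadd_zero a))
    (fun a => (hadd_comm _ a).trans (hneg a)) hmul_assoc hmul_comm
    (fun a => (hmul_comm i a).trans (hmul_one a))
    (fun a ha => by
      have h1 : a⁻¹ = inv a ha := dif_neg ha
      rw [h1]
      exact hinv a ha)
    (dif_pos rfl) hdistrib ⟨i, o, hne⟩
  let L : LinearOrder Q :=
    { le := le
      le_refl := hrefl
      le_trans := fun x y z h h' => htrans x y z ⟨h, h'⟩
      le_antisymm := fun x y h h' => hantisymm x y ⟨h, h'⟩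
      le_total := htotal
      toDecidableLE := Classical.decRel _ }
  have hO : IsOrderedAddMonoid Q :=
    { add_le_add_left := fun x y h z => hadd_le x y z h }
  -- That `0 ≤ 1` is not among the axioms: otherwise `-1` is nonnegative, and so is its square `1`.
  have hZ : ZeroLEOneClass Q := ⟨by
    by_contra h
    have h1 : (1 : Q) ≤ 0 := (le_total _ _).resolve_left h
    have h2 : (0 : Q) ≤ -1 := neg_nonneg.2 h1
    have h3 : (0 : Q) ≤ (-1) * (-1) := hmul_le _ _ ⟨h2, h2⟩
    exact h (by simpa using h3)⟩
  have hS : IsStrictOrderedRing Q := IsStrictOrderedRing.of_mul_pos fun a b ha hb =>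
    lt_of_le_of_ne (hmul_le a b ⟨ha.le, hb.le⟩) (mul_ne_zero ha.ne' hb.ne').symm
  refine ⟨F, L, hS, ⟨fun x hx => ?_⟩, rfl, rfl, rfl⟩
  rcases eq_or_lt_of_le hx with rfl | hx'
  · exact ⟨0, le_rfl, mul_zero _⟩
  · obtain ⟨y, hy⟩ := hsqrt x ⟨hx, hx'.ne⟩
    exact ⟨|y|, abs_nonneg y, (abs_mul_abs_self y).trans hy⟩

/-! ### The axioms and the translations in structures over a field. -/

section

variable {ε : Bool} {B Q : Type} [Field Q] [LinearOrder Q] [IsStrictOrderedRing Q] [HasSqrt Q]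

theorem isEuclideanField : IsEuclideanField (fun x y : Q => x + y) (fun x y => x * y)
    fun x y => x ≤ y := by
  refine ⟨0, 1, add_assoc, add_comm, add_zero, fun x => ⟨-x, add_neg_cancel x⟩, mul_assoc,
    mul_comm, mul_one, one_ne_zero, fun x hx => ⟨x⁻¹, mul_inv_cancel₀ hx⟩, mul_add, le_refl,
    fun x y h => le_antisymm h.1 h.2, fun x y z h => h.1.trans h.2, le_total,
    fun x y z h => by simpa using h, fun x y h => mul_nonneg h.1 h.2, fun x hx => ?_⟩
  obtain ⟨r, -, h⟩ := HasSqrt.exists_sqrt x hx.1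
  exact ⟨r, h⟩

variable {rel : RelOn ε B Q} {Γ : Ctx B Q}

theorem holds_AxEv : Holds rel Γ AxEv ↔ ∀ k, (kin rel).IOb k → ∀ h, (kin rel).IOb h →
    ∀ X, ∃ Y, (kin rel).SameEv k h X Y :=
  holds_allIOb fun _ _ _ _ hk => holds_allIOb fun _ h2 _ _ hh => holds_allPt fun _ h3 _ _ hx =>
    holds_exPt fun _ h4 _ _ hy => holds_sameEvent (hk.mono (h2.trans (h3.trans h4)))
      (hh.mono (h3.trans h4)) (hx.mono h4) hy

theorem holds_AxSelf : Holds rel Γ AxSelf ↔ ∀ k, (kin rel).IOb k → ∀ X, (kin rel).W k k X ↔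
    X.2 0 = 0 ∧ X.2 1 = 0 ∧ X.2 2 = 0 :=
  holds_allIOb fun _ _ _ _ hk => holds_allPt fun _ h3 _ _ hx =>
    holds_iff (holds_W (hk.mono h3) (hk.mono h3) hx) (holds_and (holds_eq hx.x .zero)
      (holds_and (holds_eq hx.y .zero) (holds_eq hx.z .zero)))

theorem holds_AxSymD : Holds rel Γ AxSymD ↔ ∀ k, (kin rel).IOb k → ∀ k', (kin rel).IOb k' →
    ∀ X Y X' Y', |X.1 - Y.1| = 0 ∧ |X'.1 - Y'.1| = 0 ∧ (kin rel).SameEv k k' X X' ∧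
    (kin rel).SameEv k k' Y Y' → sp X Y = sp X' Y' :=
  holds_allIOb fun _ _ _ _ hk => holds_allIOb fun _ h2 _ _ hh => holds_allPt fun _ h3 _ _ hx =>
    holds_allPt fun _ h4 _ _ hy => holds_allPt fun _ h5 _ _ hx' => holds_allPt fun _ h6 _ _ hy' =>
    have hk := hk.mono (h2.trans (h3.trans (h4.trans (h5.trans h6))))
    have hh := hh.mono (h3.trans (h4.trans (h5.trans h6)))
    have hx := hx.mono (h4.trans (h5.trans h6))
    have hy := hy.mono (h5.trans h6)
    have hx' := hx'.mono h6
    holds_imp (holds_and (holds_eq (den_time hx hy) .zero) (holds_and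
      (holds_eq (den_time hx' hy') .zero) (holds_and (holds_sameEvent hk hh hx hx')
      (holds_sameEvent hk hh hy hy')))) (holds_eq (den_space hx hy) (den_space hx' hy'))

theorem holds_AxLine : Holds rel Γ AxLine ↔ ∀ k, (kin rel).IOb k → ∀ h, (kin rel).IOb h →
    ∀ X Y Z, (kin rel).W k h X ∧ (kin rel).W k h Y ∧ (kin rel).W k h Z →
    ∃ a : Q, Z - X = a • (Y - X) ∨ Y - Z = a • (Z - X) :=
  holds_allIOb fun _ _ _ _ hk => holds_allIOb fun _ h2 _ _ hh => holds_allPt fun _ h3 _ _ hx =>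
    holds_allPt fun _ h4 _ _ hy => holds_allPt fun _ h5 _ _ hz =>
    have hk := hk.mono (h2.trans (h3.trans (h4.trans h5)))
    have hh := hh.mono (h3.trans (h4.trans h5))
    have hx := hx.mono (h4.trans h5)
    have hy := hy.mono h5
    holds_imp (holds_and (holds_W hk hh hx) (holds_and (holds_W hk hh hy) (holds_W hk hh hz)))
      (holds_exQ fun _ h6 _ _ ha =>
        holds_or (holds_eqPt ((hz.mono h6).sub (hx.mono h6))
            (.smul ha ((hy.mono h6).sub (hx.mono h6))))
          (holds_eqPt ((hy.mono h6).sub (hz.mono h6))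
            (.smul ha ((hz.mono h6).sub (hx.mono h6)))))

theorem holds_AxTriv : Holds rel Γ AxTriv ↔ ∀ T, IsAff T → IsTriv T → ∀ k, (kin rel).IOb k →
    ∃ k', (kin rel).IOb k' ∧ (kin rel).WorldviewIs k k' T :=
  holds_allAffine fun _ _ _ _ hT => holds_imp (holds_Triv hT) (holds_allIOb fun _ h2 _ _ hk =>
    holds_exIOb fun _ h3 _ _ hh => holds_worldviewIs (hk.mono h3) hh (hT.mono (h2.trans h3)))

theorem holds_AxNoAcc : Holds rel Γ AxNoAcc ↔ ∀ k, (∃ b X, (kin rel).W k b X) →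
    (kin rel).IOb k :=
  holds_allB fun _ _ _ _ hk => holds_imp (holds_exB fun _ h1 _ _ hb =>
    holds_exPt fun _ h2 _ _ hx => holds_W (hk.mono (h1.trans h2)) (hb.mono h2) hx) (holds_IOb hk)

theorem holds_AxAbsTime : Holds rel Γ AxAbsTime ↔ ∀ k, (kin rel).IOb k → ∀ k', (kin rel).IOb k' →
    ∀ X Y X' Y', (kin rel).SameEv k k' X X' ∧ (kin rel).SameEv k k' Y Y' →
    |X.1 - Y.1| = |X'.1 - Y'.1| :=
  holds_allIOb fun _ _ _ _ hk => holds_allIOb fun _ h2 _ _ hh => holds_allPt fun _ h3 _ _ hx =>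
    holds_allPt fun _ h4 _ _ hy => holds_allPt fun _ h5 _ _ hx' => holds_allPt fun _ h6 _ _ hy' =>
    have hk := hk.mono (h2.trans (h3.trans (h4.trans (h5.trans h6))))
    have hh := hh.mono (h3.trans (h4.trans (h5.trans h6)))
    have hx := hx.mono (h4.trans (h5.trans h6))
    have hy := hy.mono (h5.trans h6)
    have hx' := hx'.mono h6
    holds_imp (holds_and (holds_sameEvent hk hh hx hx') (holds_sameEvent hk hh hy hy'))
      (holds_eq (den_time hx hy) (den_time hx' hy'))

theorem holds_AxEther : Holds rel Γ AxEther ↔ ∃ e, (kin rel).Ether e :=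
  holds_exB fun _ _ _ _ he => holds_Ether he

theorem holds_slow {k e : BVar} {b b' : B} (hk : BV Γ k b) (he : BV Γ e b') :
    Holds rel Γ (Pre.exQ fun v => speed e k v ∧' Pre.exQ fun c => isCe c ∧' (v <' c)) ↔
      ∃ v, (kin rel).Speed b' b v ∧ ∃ c, (kin rel).IsCe c ∧ v < c :=
  holds_exQ fun _ h1 _ _ hv => holds_and (holds_speed (he.mono h1) (hk.mono h1) hv)
    (holds_exQ fun _ h2 _ _ hc => holds_and (holds_isCe hc) (holds_lt (hv.mono h2) hc))

theorem holds_AxNoFTL : Holds rel Γ AxNoFTL ↔ ∀ k, (kin rel).IOb k → ∀ e, (kin rel).Ether e →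
    ∃ v, (kin rel).Speed e k v ∧ ∃ c, (kin rel).IsCe c ∧ v < c :=
  holds_allIOb fun _ _ _ _ hk => holds_allB fun _ h2 _ _ he =>
    holds_imp (holds_Ether he) (holds_slow (hk.mono h2) he)

theorem holds_AxThExpSTL : Holds rel Γ AxThExpSTL ↔ (∃ h, (kin rel).IOb h) ∧
    ∀ e, (kin rel).Ether e → ∀ X Y, (∃ c, (kin rel).IsCe c ∧ sp X Y < c * |X.1 - Y.1|) →
    ∃ k, (kin rel).IOb k ∧ (kin rel).W e k X ∧ (kin rel).W e k Y :=
  holds_and (holds_exB fun _ _ _ _ h => holds_IOb h) (holds_allB fun _ _ _ _ he =>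
    holds_imp (holds_Ether he) (holds_allPt fun _ h1 _ _ hx => holds_allPt fun _ h2 _ _ hy =>
    holds_imp (holds_exQ fun _ h3 _ _ hc => holds_and (holds_isCe hc)
      (holds_lt (den_space (hx.mono (h2.trans h3)) (hy.mono h3))
        (hc.mul (den_time (hx.mono (h2.trans h3)) (hy.mono h3)))))
      (holds_exIOb fun _ h3 _ _ hk =>
        have he := he.mono (h1.trans (h2.trans h3))
        holds_and (holds_W he hk (hx.mono (h2.trans h3)))
          (holds_W he hk (hy.mono h3)))))

theorem holds_AxPhc : Holds rel Γ AxPhc ↔ ∃ c, 0 < c ∧ ∀ k, (kin rel).IOb k →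
    (kin rel).Light k c :=
  holds_exQ fun _ _ _ _ hc => holds_and (holds_lt .zero hc) (holds_allIOb fun _ h1 _ _ hk =>
    holds_lightSpeed hk (hc.mono h1))

theorem holds_AxThExp : Holds rel Γ AxThExp ↔ (∃ h, (kin rel).IOb h) ∧
    ∀ e, (kin rel).IOb e → ∀ X Y, (∃ c, (kin rel).IsC c ∧ sp X Y < c * |X.1 - Y.1|) →
    ∃ k, (kin rel).IOb k ∧ (kin rel).W e k X ∧ (kin rel).W e k Y :=
  holds_and (holds_exB fun _ _ _ _ h => holds_IOb h) (holds_allIOb fun _ _ _ _ he =>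
    holds_allPt fun _ h1 _ _ hx => holds_allPt fun _ h2 _ _ hy =>
    holds_imp (holds_exQ fun _ h3 _ _ hc => holds_and (holds_isC hc)
      (holds_lt (den_space (hx.mono (h2.trans h3)) (hy.mono h3))
        (hc.mul (den_time (hx.mono (h2.trans h3)) (hy.mono h3)))))
      (holds_exIOb fun _ h3 _ _ hk =>
        have he := he.mono (h1.trans (h2.trans h3))
        holds_and (holds_W he hk (hx.mono (h2.trans h3)))
          (holds_W he hk (hy.mono h3))))

theorem holds_AxPrimitiveEther {rel : RelOn true B Q} : Holds rel Γ AxPrimitiveEther ↔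
    ∃ e, (kin rel).IOb e ∧ ∀ k, ((kin rel).IOb k ∧ ∃ T, IsAff T ∧
    (IsTriv T ∨ IsTrivReversed T) ∧ (kin rel).WorldviewIs e k T) ↔ rel Sym.E ![k] ![] :=
  holds_exIOb fun _ _ _ _ he => holds_allB fun _ h1 _ _ hk =>
    holds_iff (holds_and (holds_IOb hk) (holds_exAffine fun _ h2 _ _ hT =>
      holds_and (holds_or (holds_Triv hT) (holds_TrivReversed hT))
        (holds_worldviewIs (he.mono (h1.trans h2)) (hk.mono h2) hT))) (holds_E hk)

theorem isModel_classical_iff [Nonempty B] {rel : RelOn false B Q} :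
    IsModel (fieldStruc rel) ClassicalKinSTL ↔ IsClassical (kin rel) := by
  have key : IsModel (fieldStruc rel) ClassicalKinSTL ↔
      ∀ (ρ : ℕ → B) (κ : ℕ → Q), ∀ γ ∈ ClassicalKinSTL, Sat (fieldStruc rel) ρ κ γ :=
    ⟨fun h ρ κ γ hγ => h.sat γ hγ ρ κ, fun h => ⟨inferInstance, ⟨(0 : Q)⟩, fun γ hγ ρ κ => h ρ κ γ hγ⟩⟩
  have key2 : ∀ (ρ : ℕ → B) (κ : ℕ → Q), (∀ γ ∈ ClassicalKinSTL, Sat (fieldStruc rel) ρ κ γ) ↔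
      IsClassical (kin rel) := by
    intro ρ κ
    simp only [ClassicalKinSTL, KinFull, Set.mem_union, Set.mem_insert_iff, Set.mem_singleton_iff,
      or_imp, forall_and, forall_eq]
    have hH : ∀ φ : Pre (Sym false), Sat (fieldStruc rel) ρ κ (sentence φ) ↔
        Holds rel ⟨ρ, 0, κ, 0⟩ φ := fun _ => Iff.rfl
    rw [sat_AxEField]
    simp only [hH, holds_AxEv, holds_AxSelf, holds_AxSymD, holds_AxLine, holds_AxTriv,
      holds_AxNoAcc, holds_AxAbsTime, holds_AxEther, holds_AxNoFTL, holds_AxThExpSTL]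
    constructor
    · rintro ⟨⟨-, h1, h2, h3, h4, h5, h6⟩, h7, h8, h9, h10, h11⟩
      exact ⟨⟨h1, h2, h3, h4, h5, h6⟩, h7, h8, h9, h10, h11⟩
    · rintro ⟨⟨h1, h2, h3, h4, h5, h6⟩, h7, h8, h9, h10, h11⟩
      exact ⟨⟨isEuclideanField, h1, h2, h3, h4, h5, h6⟩, h7, h8, h9, h10, h11⟩
  rw [key]
  refine ⟨fun h => ?_, fun h ρ κ => (key2 ρ κ).2 h⟩
  obtain ⟨b⟩ := ‹Nonempty B›
  exact (key2 (fun _ => b) (fun _ => 0)).1 (h _ _)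

theorem isModel_relativistic_iff [Nonempty B] {rel : RelOn true B Q} :
    IsModel (fieldStruc rel) SpecRelE ↔
      IsRelativistic (kin rel) fun k => rel Sym.E ![k] ![] := by
  have key : IsModel (fieldStruc rel) SpecRelE ↔
      ∀ (ρ : ℕ → B) (κ : ℕ → Q), ∀ γ ∈ SpecRelE, Sat (fieldStruc rel) ρ κ γ :=
    ⟨fun h ρ κ γ hγ => h.sat γ hγ ρ κ, fun h => ⟨inferInstance, ⟨(0 : Q)⟩, fun γ hγ ρ κ => h ρ κ γ hγ⟩⟩
  have key2 : ∀ (ρ : ℕ → B) (κ : ℕ → Q), (∀ γ ∈ SpecRelE, Sat (fieldStruc rel) ρ κ γ) ↔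
      IsRelativistic (kin rel) fun k => rel Sym.E ![k] ![] := by
    intro ρ κ
    simp only [SpecRelE, KinFull, Set.mem_union, Set.mem_insert_iff, Set.mem_singleton_iff,
      or_imp, forall_and, forall_eq]
    have hH : ∀ φ : Pre (Sym true), Sat (fieldStruc rel) ρ κ (sentence φ) ↔
        Holds rel ⟨ρ, 0, κ, 0⟩ φ := fun _ => Iff.rfl
    rw [sat_AxEField]
    simp only [hH, holds_AxEv, holds_AxSelf, holds_AxSymD, holds_AxLine, holds_AxTriv,
      holds_AxNoAcc, holds_AxPhc, holds_AxThExp, holds_AxPrimitiveEther]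
    constructor
    · rintro ⟨⟨-, h1, h2, h3, h4, h5, h6⟩, h7, ⟨h8, h9⟩, h10⟩
      exact ⟨⟨h1, h2, h3, h4, h5, h6⟩, h7, h8, h9, h10⟩
    · rintro ⟨⟨h1, h2, h3, h4, h5, h6⟩, h7, h8, h9, h10⟩
      exact ⟨⟨isEuclideanField, h1, h2, h3, h4, h5, h6⟩, h7, ⟨h8, h9⟩, h10⟩
  rw [key]
  refine ⟨fun h => ?_, fun h ρ κ => (key2 ρ κ).2 h⟩
  obtain ⟨b⟩ := ‹Nonempty B›
  exact (key2 (fun _ => b) (fun _ => 0)).1 (h _ _)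

theorem sat_trPlusForm_IOb {rel : RelOn false B Q} (ρ : ℕ → B) (κ : ℕ → Q) :
    Sat (fieldStruc rel) ρ κ (TrPlus.form Sym.IOb) ↔ (kin rel).IOb (ρ 0) ∧
      ∀ e, (kin rel).Ether e → ∃ v, (kin rel).Speed e (ρ 0) v ∧ ∃ c, (kin rel).IsCe c ∧ v < c :=
  have h0 : BV (Q := Q) ⟨ρ, 1, κ, 0⟩ ⟨0⟩ (ρ 0) := ⟨Nat.zero_lt_one, rfl⟩
  holds_and (Γ := ⟨ρ, 1, κ, 0⟩) (holds_IOb h0) (holds_allB fun _ h1 _ _ he =>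
    holds_imp (holds_Ether he) (holds_slow (h0.mono h1) he))

theorem sat_trPlusForm_E {rel : RelOn false B Q} (ρ : ℕ → B) (κ : ℕ → Q) :
    Sat (fieldStruc rel) ρ κ (TrPlus.form Sym.E) ↔ (kin rel).Ether (ρ 0) :=
  holds_Ether (Γ := ⟨ρ, 1, κ, 0⟩) ⟨Nat.zero_lt_one, rfl⟩

/-- At depth `(2, 4)` the level `l` of a quantity has index `3 - l` and that of a body `1 - l`: `κ
3` is the time and `ρ 1` the observer. -/
theorem sat_trPlusForm_W {rel : RelOn false B Q} (ρ : ℕ → B) (κ : ℕ → Q) :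
    Sat (fieldStruc rel) ρ κ (TrPlus.form Sym.W) ↔ ∀ e, (kin rel).Ether e → ∃ Y,
      (∃ V, (kin rel).Velocity (ρ 1) e V ∧ ∃ C, (kin rel).IsCe C ∧
        RadRel C V Y (κ 3, ![κ 2, κ 1, κ 0])) ∧ (kin rel).W (ρ 1) (ρ 0) Y := by
  have h0 : BV (Q := Q) ⟨ρ, 2, κ, 4⟩ ⟨0⟩ (ρ 1) := ⟨by norm_num, rfl⟩
  have h1 : BV (Q := Q) ⟨ρ, 2, κ, 4⟩ ⟨1⟩ (ρ 0) := ⟨by norm_num, rfl⟩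
  have hx : DenPt (B := B) (Q := Q) ⟨ρ, 2, κ, 4⟩ ![.var 0, .var 1, .var 2, .var 3]
      (κ 3, ![κ 2, κ 1, κ 0]) := by
    refine ⟨⟨?_, rfl⟩, ⟨?_, rfl⟩, ⟨?_, rfl⟩, ⟨?_, rfl⟩⟩ <;> norm_num
  exact holds_allB (Γ := ⟨ρ, 2, κ, 4⟩) fun _ h2 _ _ he =>
    holds_imp (holds_Ether he) (holds_exPt fun _ h3 _ _ hy =>
    holds_and (holds_RadAt (fun _ _ _ _ hc => holds_isCe hc) (h0.mono (h2.trans h3)) (he.mono h3)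
      hy (hx.mono (h2.trans h3))) (holds_W (h0.mono (h2.trans h3)) (h1.mono (h2.trans h3)) hy))

theorem sat_trPlusForm'_W {rel : RelOn true B Q} (ρ : ℕ → B) (κ : ℕ → Q) :
    Sat (fieldStruc rel) ρ κ (TrPlus'.form Sym.W) ↔ ∀ e, rel Sym.E ![e] ![] → ∃ Y,
      (∃ V, (kin rel).Velocity (ρ 1) e V ∧ ∃ C, (kin rel).IsC C ∧
        RadRel C V (κ 3, ![κ 2, κ 1, κ 0]) Y) ∧ (kin rel).W (ρ 1) (ρ 0) Y := by
  have h0 : BV (Q := Q) ⟨ρ, 2, κ, 4⟩ ⟨0⟩ (ρ 1) := ⟨by norm_num, rfl⟩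
  have h1 : BV (Q := Q) ⟨ρ, 2, κ, 4⟩ ⟨1⟩ (ρ 0) := ⟨by norm_num, rfl⟩
  have hx : DenPt (B := B) (Q := Q) ⟨ρ, 2, κ, 4⟩ ![.var 0, .var 1, .var 2, .var 3]
      (κ 3, ![κ 2, κ 1, κ 0]) := by
    refine ⟨⟨?_, rfl⟩, ⟨?_, rfl⟩, ⟨?_, rfl⟩, ⟨?_, rfl⟩⟩ <;> norm_num
  exact holds_allB (Γ := ⟨ρ, 2, κ, 4⟩) fun _ h2 _ _ he =>
    holds_imp (holds_E he) (holds_exPt fun _ h3 _ _ hy =>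
    holds_and (holds_RadAt (fun _ _ _ _ hc => holds_isC hc) (h0.mono (h2.trans h3)) (he.mono h3)
      (hx.mono (h2.trans h3)) hy) (holds_W (h0.mono (h2.trans h3)) (h1.mono (h2.trans h3)) hy))

/-- The interpretation that `Tr₊` defines. -/
abbrev pullPlus (rel : RelOn false B Q) : RelOn true B Q := (TrPlus.pull (fieldStruc rel)).rel

/-- The interpretation that `Tr₊'` defines. -/
abbrev pullPlus' (rel : RelOn true B Q) : RelOn false B Q := (TrPlus'.pull (fieldStruc rel)).rel

theorem pullPlus_IOb (rel : RelOn false B Q) (k : B) : (kin (pullPlus rel)).IOb k ↔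
    (kin rel).IOb k ∧ ∀ e, (kin rel).Ether e → ∃ v, (kin rel).Speed e k v ∧
      ∃ c, (kin rel).IsCe c ∧ v < c :=
  (TrPlus.pull_rel_iff (fieldStruc rel) Sym.IOb ![k] ![] (fun _ => k) (fun _ => (0 : Q))
    (by simp) (by simp)).trans (sat_trPlusForm_IOb _ _)

theorem pullPlus_Ph (rel : RelOn false B Q) (k : B) : (kin (pullPlus rel)).Ph k ↔
    (kin rel).Ph k :=
  (TrPlus.pull_rel_iff (fieldStruc rel) Sym.Ph ![k] ![] (fun _ => k) (fun _ => (0 : Q))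
    (by simp) (by simp)).trans (holds_Ph (Γ := ⟨fun _ => k, 1, _, 0⟩) ⟨Nat.zero_lt_one, rfl⟩)

theorem pullPlus_E (rel : RelOn false B Q) (k : B) : pullPlus rel Sym.E ![k] ![] ↔
    (kin rel).Ether k :=
  (TrPlus.pull_rel_iff (fieldStruc rel) Sym.E ![k] ![] (fun _ => k) (fun _ => (0 : Q))
    (by simp) (by simp)).trans (sat_trPlusForm_E _ _)

theorem pullPlus_W (rel : RelOn false B Q) (k b : B) (X : Ev Q) : (kin (pullPlus rel)).W k b X ↔
    ∀ e, (kin rel).Ether e → ∃ Y, (∃ V, (kin rel).Velocity k e V ∧ ∃ C, (kin rel).IsCe C ∧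
      RadRel C V Y X) ∧ (kin rel).W k b Y := by
  refine (TrPlus.pull_rel_iff (fieldStruc rel) Sym.W _ _ (scons b fun _ => k)
    (scons (X.2 2) (scons (X.2 1) (scons (X.2 0) fun _ => X.1))) ?_ ?_).trans
    ((sat_trPlusForm_W _ _).trans (iff_of_eq ?_))
  · intro i; fin_cases i <;> rfl
  · intro i; fin_cases i <;> rfl
  · have : (X.1, ![X.2 0, X.2 1, X.2 2]) = X := by
      ext i
      · rfl
      · fin_cases i <;> rfl
    simp only [scons, this]

theorem pullPlus'_IOb (rel : RelOn true B Q) (k : B) : (kin (pullPlus' rel)).IOb k ↔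
    (kin rel).IOb k :=
  (TrPlus'.pull_rel_iff (fieldStruc rel) Sym.IOb ![k] ![] (fun _ => k) (fun _ => (0 : Q))
    (by simp) (by simp)).trans (holds_IOb (Γ := ⟨fun _ => k, 1, _, 0⟩) ⟨Nat.zero_lt_one, rfl⟩)

theorem pullPlus'_Ph (rel : RelOn true B Q) (k : B) : (kin (pullPlus' rel)).Ph k ↔
    (kin rel).Ph k :=
  (TrPlus'.pull_rel_iff (fieldStruc rel) Sym.Ph ![k] ![] (fun _ => k) (fun _ => (0 : Q))
    (by simp) (by simp)).trans (holds_Ph (Γ := ⟨fun _ => k, 1, _, 0⟩) ⟨Nat.zero_lt_one, rfl⟩)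

theorem pullPlus'_W (rel : RelOn true B Q) (k b : B) (X : Ev Q) :
    (kin (pullPlus' rel)).W k b X ↔
    ∀ e, rel Sym.E ![e] ![] → ∃ Y, (∃ V, (kin rel).Velocity k e V ∧ ∃ C, (kin rel).IsC C ∧
      RadRel C V X Y) ∧ (kin rel).W k b Y := by
  refine (TrPlus'.pull_rel_iff (fieldStruc rel) Sym.W _ _ (scons b fun _ => k)
    (scons (X.2 2) (scons (X.2 1) (scons (X.2 0) fun _ => X.1))) ?_ ?_).trans
    ((sat_trPlusForm'_W _ _).trans (iff_of_eq ?_))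
  · intro i; fin_cases i <;> rfl
  · intro i; fin_cases i <;> rfl
  · have : (X.1, ![X.2 0, X.2 1, X.2 2]) = X := by
      ext i
      · rfl
      · fin_cases i <;> rfl
    simp only [scons, this]

end

theorem Sym.countable (ε : Bool) (m n : ℕ) : Countable (Sym ε m n) := by
  let f : ∀ {ε m n}, Sym ε m n → ℕ := fun s => match s with
    | .IOb => 0 | .Ph => 1 | .W => 2 | .E => 3
  have : Function.Injective (f : Sym ε m n → ℕ) := by
    intro s t h
    cases s <;> cases t <;> simp_all [f]
  exact this.countable

instance (ε : Bool) : Countable (Form (Sym ε)) := Form.countable (Sym.countable ε)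

theorem isClosedTheory_classicalKinSTL : IsClosedTheory ClassicalKinSTL := by
  simp only [IsClosedTheory, ClassicalKinSTL, KinFull, Set.mem_union, Set.mem_insert_iff,
    Set.mem_singleton_iff, or_imp, forall_and, forall_eq]
  decide +kernel

theorem isClosedTheory_specRelE : IsClosedTheory SpecRelE := by
  simp only [IsClosedTheory, SpecRelE, KinFull, Set.mem_union, Set.mem_insert_iff,
    Set.mem_singleton_iff, or_imp, forall_and, forall_eq]
  decide +kernel

end Kinematics

namespace Kinematics

set_option linter.unusedSectionVars false

/-! ## Boosts -/

section Boosts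

variable {Q : Type} [Field Q] [LinearOrder Q] [IsStrictOrderedRing Q] [HasSqrt Q]

theorem dotProduct_fin3 (x y : Fin 3 → Q) : x ⬝ᵥ y = x 0 * y 0 + x 1 * y 1 + x 2 * y 2 := by
  simp [dotProduct, Fin.sum_univ_three]

theorem eq_zero_of_dotProduct_self {x : Fin 3 → Q} (h : x ⬝ᵥ x = 0) : x = 0 :=
  dotProduct_self_eq_zero.1 h

/-- The Galilean boost that gives the velocity `v` to bodies at rest. -/
def gam (v : Fin 3 → Q) : Ev Q →ₗ[Q] Ev Q where
  toFun X := (X.1, X.2 + X.1 • v)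
  map_add' X Y := by
    ext i
    · rfl
    · simp; ring
  map_smul' a X := by
    ext i
    · rfl
    · simp; ring

/-- The factor of time dilation. -/
noncomputable def dil (c : Q) (v : Fin 3 → Q) : Q := rt (1 - v ⬝ᵥ v / (c * c))

/-- The Lorentz boost that gives the velocity `v` to bodies at rest. -/
noncomputable def lor (c : Q) (v : Fin 3 → Q) : Ev Q →ₗ[Q] Ev Q where
  toFun X := ((X.1 + v ⬝ᵥ X.2 / (c * c)) / dil c v,
    X.2 + (X.1 / dil c v + v ⬝ᵥ X.2 / (c * c * dil c v * (1 + dil c v))) • v)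
  map_add' X Y := by
    ext i
    · simp; ring
    · simp; ring
  map_smul' a X := by
    ext i
    · simp; ring
    · simp; ring

theorem gam_apply (v : Fin 3 → Q) (X : Ev Q) : gam v X = (X.1, X.2 + X.1 • v) := rfl

theorem lor_apply (c : Q) (v : Fin 3 → Q) (X : Ev Q) :
    lor c v X = ((X.1 + v ⬝ᵥ X.2 / (c * c)) / dil c v,
    X.2 + (X.1 / dil c v + v ⬝ᵥ X.2 / (c * c * dil c v * (1 + dil c v))) • v) := rfl

theorem gam_neg_gam (v : Fin 3 → Q) (X : Ev Q) : gam (-v) (gam v X) = X := by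
  ext i
  · rfl
  · simp [gam_apply]

theorem gam_gam_neg (v : Fin 3 → Q) (X : Ev Q) : gam v (gam (-v) X) = X := by
  simpa using gam_neg_gam (-v) X

variable {c : Q} {v : Fin 3 → Q}

theorem dil_neg (c : Q) (v : Fin 3 → Q) : dil c (-v) = dil c v := by simp [dil]

/-- Writing `v ⬝ᵥ v` through `s = dil c v` removes the root: the identities for boosts become
rational in `s` with denominators `s` and `1 + s`. -/
theorem dil_spec (hc : 0 < c) (hv : v ⬝ᵥ v < c * c) :
    0 < dil c v ∧ v ⬝ᵥ v = c * c * (1 - dil c v * dil c v) := by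
  have h0 : 0 < 1 - v ⬝ᵥ v / (c * c) := by
    rw [sub_pos, div_lt_one (mul_pos hc hc)]
    exact hv
  have h1 : dil c v * dil c v = 1 - v ⬝ᵥ v / (c * c) := rt_mul_self h0.le
  refine ⟨(rt_nonneg _).lt_of_ne' fun h => ?_, ?_⟩
  · change dil c v = 0 at h
    rw [h, zero_mul] at h1
    exact h0.ne h1
  · rw [h1]
    field_simp
    ring

theorem lor_neg_lor (hc : 0 < c) (hv : v ⬝ᵥ v < c * c) (X : Ev Q) :
    lor c (-v) (lor c v X) = X := by
  obtain ⟨hs, hvv⟩ := dil_spec hc hv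
  have h1 : 0 < 1 + dil c v := by linarith
  obtain ⟨t, x⟩ := X
  simp only [lor_apply, dil_neg]
  generalize dil c v = s at *
  ext i
  · simp only [neg_dotProduct, dotProduct_add, dotProduct_smul, smul_eq_mul, hvv]
    field_simp
    ring
  · simp only [neg_dotProduct, dotProduct_add, dotProduct_smul, smul_eq_mul, hvv, Pi.add_apply,
      Pi.smul_apply, Pi.neg_apply]
    field_simp
    ring

/-- Lorentz boosts preserve the Minkowski form. -/
theorem lor_form (hc : 0 < c) (hv : v ⬝ᵥ v < c * c) (X : Ev Q) :
    (lor c v X).2 ⬝ᵥ (lor c v X).2 - c * c * ((lor c v X).1 * (lor c v X).1) =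
      X.2 ⬝ᵥ X.2 - c * c * (X.1 * X.1) := by
  obtain ⟨hs, hvv⟩ := dil_spec hc hv
  have h1 : 0 < 1 + dil c v := by linarith
  obtain ⟨t, x⟩ := X
  simp only [lor_apply]
  generalize dil c v = s at *
  simp only [dotProduct_add, add_dotProduct, dotProduct_smul, smul_dotProduct, smul_eq_mul, hvv,
    dotProduct_comm x v]
  field_simp
  ring

theorem lor_zero (hc : 0 < c) (X : Ev Q) : lor c 0 X = X := by
  have h : (0 : Fin 3 → Q) ⬝ᵥ 0 < c * c := by simpa using mul_pos hc hc
  obtain ⟨hs, hvv⟩ := dil_spec hc h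
  have hd : dil c (0 : Fin 3 → Q) = 1 := by
    have h2 : dil c (0 : Fin 3 → Q) * dil c 0 = 1 * 1 := by
      have : c * c * (1 - dil c (0 : Fin 3 → Q) * dil c 0) = 0 := by simpa using hvv.symm
      have := (mul_eq_zero.1 this).resolve_left (mul_pos hc hc).ne'
      linear_combination -this
    exact (mul_self_inj hs.le zero_le_one).1 h2
  ext i <;> simp [lor_apply, hd]

/-- Radarization is the composition of a Galilean and a Lorentz boost. -/
theorem lor_gam_neg (hc : 0 < c) (hv : v ⬝ᵥ v < c * c) (X : Ev Q) :
    lor c v (gam (-v) X) = (dil c v * X.1 + v ⬝ᵥ X.2 / (c * c * dil c v),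
      X.2 + (v ⬝ᵥ X.2 / (c * c * dil c v * (1 + dil c v))) • v) := by
  obtain ⟨hs, hvv⟩ := dil_spec hc hv
  have h1 : 0 < 1 + dil c v := by linarith
  obtain ⟨t, x⟩ := X
  simp only [lor_apply, gam_apply]
  generalize dil c v = s at *
  ext i
  · simp only [dotProduct_add, dotProduct_smul, dotProduct_neg, smul_eq_mul, hvv]
    field_simp
    ring
  · simp only [dotProduct_add, dotProduct_smul, dotProduct_neg, smul_eq_mul, hvv, Pi.add_apply,
      Pi.smul_apply, Pi.neg_apply]
    field_simp
    ring

/-! ### The definition of radarization -/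

/-- All that is needed about `R_v`, uniformly in the cases of its definition: it is linear and
preserves lengths, and it turns `v` into the negative first axis. -/
theorem exists_rotRel {u : Q} (hu : 0 ≤ u) (huv : u * u = v ⬝ᵥ v) :
    ∃ R : (Fin 3 → Q) →ₗ[Q] (Fin 3 → Q), (∀ x, R x ⬝ᵥ R x = x ⬝ᵥ x) ∧ R v = ![-u, 0, 0] ∧
      (∀ x, u * R x 0 = -(v ⬝ᵥ x)) ∧ ∀ X Y : Ev Q, RotRel u v X Y ↔ Y = (X.1, R X.2) := by
  by_cases h12 : v 1 = 0 ∧ v 2 = 0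
  · obtain ⟨h1, h2⟩ := h12
    rw [dotProduct_fin3, h1, h2] at huv
    rcases le_or_gt (v 0) 0 with h0 | h0
    · have hu0 : u = -v 0 := (mul_self_inj hu (by linarith)).1 (by linarith)
      refine ⟨LinearMap.id, fun x => rfl, ?_, fun x => ?_, fun X Y => ?_⟩
      · ext i; fin_cases i <;> simp [hu0, h1, h2]
      · simp [dotProduct_fin3, h1, h2, hu0]
      · simp [RotRel, h1, h2, h0, h0.not_gt]
    · have hu0 : u = v 0 := (mul_self_inj hu h0.le).1 (by linarith)
      refine ⟨-LinearMap.id, fun x => by simp, ?_, fun x => ?_, fun X Y => ?_⟩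
      · ext i; fin_cases i <;> simp [hu0, h1, h2]
      · simp [dotProduct_fin3, h1, h2, hu0]
      · simp [RotRel, h1, h2, h0, h0.not_ge]
  · have hr : 0 < v 1 * v 1 + v 2 * v 2 := by
      have h1 := mul_self_nonneg (v 1)
      have h2 := mul_self_nonneg (v 2)
      refine lt_of_le_of_ne (by linarith) fun h => h12 ?_
      exact ⟨mul_self_eq_zero.1 (by linarith), mul_self_eq_zero.1 (by linarith)⟩
    rw [dotProduct_fin3] at huv
    have hfac : (u - v 0) * (u + v 0) = v 1 * v 1 + v 2 * v 2 := by linear_combination huv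
    have hne : (u - v 0) * (u + v 0) ≠ 0 := by rw [hfac]; exact hr.ne'
    obtain ⟨hm, hp⟩ := mul_ne_zero_iff.1 hne
    have hu0 : u ≠ 0 := by
      rintro rfl
      have := mul_self_nonneg (v 0)
      linarith
    -- The factor `w = 1/(u + v₀)` equals `(u - v₀)/(v₁² + v₂²)`, because `u² - v₀² = v₁² + v₂²`;
    -- with `i = 1/u` the matrix becomes polynomial.
    obtain ⟨w, hw⟩ : ∃ w, w * (u + v 0) = 1 := ⟨_, inv_mul_cancel₀ hp⟩
    have hwr : w * (v 1 * v 1 + v 2 * v 2) = u - v 0 := by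
      rw [← hfac]; linear_combination (u - v 0) * hw
    obtain ⟨i, hi⟩ : ∃ i, i * u = 1 := ⟨_, inv_mul_cancel₀ hu0⟩
    have hdiv : ∀ a : Q, a * (u - v 0) / (v 1 * v 1 + v 2 * v 2) = a * w := by
      intro a
      rw [← hwr, div_eq_iff hr.ne']
      ring
    have hdivu : ∀ a : Q, a / u = a * i := by
      intro a
      rw [div_eq_iff hu0]
      linear_combination -a * hi
    refine ⟨{ toFun := fun x => (rot u v (0, x)).2, map_add' := ?_, map_smul' := ?_ },
      fun x => ?_, ?_, fun x => ?_, fun X Y => ?_⟩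
    · intro x y; ext j; fin_cases j <;> simp [rot, hdiv, hdivu] <;> ring
    · intro a y; ext j; fin_cases j <;> simp [rot, hdiv, hdivu] <;> ring
    · simp only [LinearMap.coe_mk, AddHom.coe_mk, rot, dotProduct_fin3, hdiv, hdivu]
      simp
      linear_combination (i * i) * (v 2 * x 1 - v 1 * x 2) ^ 2 * (w * hwr + hw) +
        (x 0 * x 0 + x 1 * x 1 + x 2 * x 2) * (hi * (i * u + 1) - i * i * huv)
    · ext j
      fin_cases j
      · simp [rot, hdiv, hdivu]
        linear_combination i * huv - u * hi
      · simp [rot, hdiv, hdivu]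
        left; ring
      · simp [rot, hdiv, hdivu]
        left; ring
    · simp [rot, dotProduct_fin3, hdivu]
      linear_combination (- v 0 * x 0 - v 1 * x 1 - v 2 * x 2) * hi
    · simp only [RotRel, h12, not_false_eq_true, true_and]
      have : rot u v X = (X.1, (rot u v (0, X.2)).2) := rfl
      simp only [this, LinearMap.coe_mk, AddHom.coe_mk]
      constructor
      · rintro (h | ⟨-, h1, h2, -⟩ | ⟨-, h1, h2, -⟩)
        · exact h
        · exact absurd ⟨h1, h2⟩ h12
        · exact absurd ⟨h1, h2⟩ h12
      · exact Or.inl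

/-- After rotation by `R` the velocity is `(-u, 0, 0)`, so `G` is `gam (-v)` and `S ∘ E` is the
Lorentz boost, both along the first axis. `R` is injective and `R v` is known, so it can be
cancelled on both sides. -/
theorem radRel_iff (X Y : Ev Q) : RadRel c v X Y ↔
    0 < c ∧ v ⬝ᵥ v < c * c ∧ Y = lor c v (gam (-v) X) := by
  have huv : rt (v ⬝ᵥ v) * rt (v ⬝ᵥ v) = v ⬝ᵥ v := rt_mul_self (dotProduct_self_nonneg' v)
  have hu := rt_nonneg (v ⬝ᵥ v)
  have hcond : rt (v ⬝ᵥ v) < c ↔ 0 < c ∧ v ⬝ᵥ v < c * c := by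
    constructor
    · intro h
      exact ⟨hu.trans_lt h, by rw [← huv]; exact mul_self_lt_mul_self hu h⟩
    · rintro ⟨h0, h⟩
      exact lt_of_mul_self_lt_mul_self₀ h0.le (by rwa [huv])
  unfold RadRel
  simp only [exists_eq_left, hcond, and_assoc]
  refine and_congr_right fun hc => and_congr_right fun hv => ?_
  obtain ⟨R, hR, hRv, hR0, hrot⟩ := exists_rotRel hu huv
  have hinj : Function.Injective R := by
    rw [injective_iff_map_eq_zero]
    intro x hx
    have := hR x
    rw [hx] at this
    exact eq_zero_of_dotProduct_self (by simpa using this.symm)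
  simp only [hrot]
  obtain ⟨hs, hvv⟩ := dil_spec hc hv
  rw [lor_gam_neg hc hv, huv]
  have hd : rt (1 - v ⬝ᵥ v / (c * c)) = dil c v := rfl
  have ha : 1 - v ⬝ᵥ v / (c * c) = dil c v * dil c v := by
    rw [hvv]; field_simp; ring
  rw [hd, ha]
  have h1 : 0 < 1 + dil c v := by linarith
  have hRx := hR0 X.2
  generalize dil c v = s at *
  generalize rt (v ⬝ᵥ v) = u at *
  have hvx : v ⬝ᵥ X.2 = -(u * R X.2 0) := by rw [hRx]; ring
  have huu : u * u = c * c * (1 - s * s) := huv.trans hvv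
  -- The final `R⁻¹` is an equation between images under `R`, to be cancelled by injectivity.
  have key : ∀ Z : Ev Q, Z = (s * X.1 + v ⬝ᵥ X.2 / (c * c * s),
      R (X.2 + (v ⬝ᵥ X.2 / (c * c * s * (1 + s))) • v)) → (Z = (Y.1, R Y.2) ↔
      Y = (s * X.1 + v ⬝ᵥ X.2 / (c * c * s), X.2 + (v ⬝ᵥ X.2 / (c * c * s * (1 + s))) • v)) := by
    rintro Z rfl
    rw [Prod.ext_iff, Prod.ext_iff]
    exact and_congr eq_comm (hinj.eq_iff.trans eq_comm)
  have elim : ∀ (a : Ev Q) (f g h : Ev Q → Ev Q) (P : Ev Q → Prop),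
      (∃ X₁ X₂ X₃ X₄, X₁ = a ∧ X₂ = f X₁ ∧ X₃ = g X₂ ∧ X₄ = h X₃ ∧ P X₄) ↔ P (h (g (f a))) := by
    intro a f g h P
    constructor
    · rintro ⟨_, _, _, _, rfl, rfl, rfl, rfl, h⟩; exact h
    · exact fun h => ⟨_, _, _, _, rfl, rfl, rfl, rfl, h⟩
  refine (elim _ _ _ _ _).trans (key _ ?_)
  rw [map_add, map_smul, hRv, hvx]
  ext j
  · simp
    field_simp
    linear_combination (-X.1) * huu
  · fin_cases j
    · simp
      field_simp
      linear_combination (-R X.2 0) * huu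
    · simp; field_simp
    · simp; field_simp

end Boosts

end Kinematics

namespace Kinematics

set_option linter.unusedSectionVars false

/-! ## Trivial transformations -/

section Trivial

variable {Q : Type} [Field Q] [LinearOrder Q] [IsStrictOrderedRing Q] [HasSqrt Q]

/-- The linear map preserves the scalar product. -/
def IsOrth (A : (Fin 3 → Q) →ₗ[Q] (Fin 3 → Q)) : Prop := ∀ x y, A x ⬝ᵥ A y = x ⬝ᵥ y

theorem IsOrth.injective {A : (Fin 3 → Q) →ₗ[Q] (Fin 3 → Q)} (hA : IsOrth A) :
    Function.Injective A := by
  rw [injective_iff_map_eq_zero]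
  intro x hx
  have := hA x x
  rw [hx] at this
  exact eq_zero_of_dotProduct_self (by simpa using this.symm)

theorem IsOrth.surjective {A : (Fin 3 → Q) →ₗ[Q] (Fin 3 → Q)} (hA : IsOrth A) :
    Function.Surjective A := LinearMap.injective_iff_surjective.1 hA.injective

/-- The defects of additivity and homogeneity have square zero, as one sees by expanding. -/
theorem exists_isOrth_of_dotProduct {h : (Fin 3 → Q) → (Fin 3 → Q)}
    (hd : ∀ x y, h x ⬝ᵥ h y = x ⬝ᵥ y) : ∃ A, IsOrth A ∧ ∀ x, h x = A x := by
  refine ⟨{ toFun := h, map_add' := ?_, map_smul' := ?_ }, hd, fun x => rfl⟩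
  · intro x y
    refine sub_eq_zero.1 (eq_zero_of_dotProduct_self ?_)
    simp only [sub_dotProduct, dotProduct_sub, add_dotProduct, dotProduct_add, hd]
    ring
  · intro a x
    refine sub_eq_zero.1 (eq_zero_of_dotProduct_self ?_)
    simp only [sub_dotProduct, dotProduct_sub, smul_dotProduct, dotProduct_smul, hd,
      RingHom.id_apply, smul_eq_mul]
    ring

/-- Isometries are affine. -/
theorem exists_isOrth_of_isometry {g : (Fin 3 → Q) → (Fin 3 → Q)}
    (hg : ∀ x y, (g x - g y) ⬝ᵥ (g x - g y) = (x - y) ⬝ᵥ (x - y)) :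
    ∃ A, IsOrth A ∧ ∀ x, g x = A x + g 0 := by
  -- Polarization: three distances determine a scalar product.
  obtain ⟨A, hA, h⟩ := exists_isOrth_of_dotProduct (h := fun x => g x - g 0) fun x y => by
    have h1 := hg x 0
    have h2 := hg y 0
    have h3 := hg x y
    simp only [sub_zero] at h1 h2
    rw [← sub_sub_sub_cancel_right (g x) (g y) (g 0)] at h3
    generalize g x - g 0 = a at *
    generalize g y - g 0 = b at *
    simp only [sub_dotProduct, dotProduct_sub, dotProduct_comm y x, dotProduct_comm b a] at h3
    linarith
  exact ⟨A, hA, fun x => by rw [← h x]; simp⟩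

/-- The action of a linear map of space on events. -/
def spat (A : (Fin 3 → Q) →ₗ[Q] (Fin 3 → Q)) : Ev Q →ₗ[Q] Ev Q :=
  LinearMap.prodMap LinearMap.id A

theorem spat_apply (A : (Fin 3 → Q) →ₗ[Q] (Fin 3 → Q)) (X : Ev Q) : spat A X = (X.1, A X.2) := rfl

/-- The map is trivial up to the direction of time. -/
def IsTM (T : Ev Q → Ev Q) : Prop :=
  ∃ (ε : Q) (A : (Fin 3 → Q) →ₗ[Q] (Fin 3 → Q)) (d : Ev Q), ε * ε = 1 ∧ IsOrth A ∧
    ∀ X, T X = (ε * X.1, A X.2) + d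

namespace IsTM

variable {T : Ev Q → Ev Q} (hT : IsTM T)
include hT

theorem surjective : Function.Surjective T := by
  obtain ⟨ε, A, d, hε, hA, h⟩ := hT
  intro Y
  obtain ⟨x, hx⟩ := hA.surjective (Y - d).2
  refine ⟨(ε * (Y - d).1, x), ?_⟩
  rw [h, hx, ← mul_assoc, hε, one_mul]
  ext <;> simp

theorem time_sub (X Y : Ev Q) :
    ((T X).1 - (T Y).1) * ((T X).1 - (T Y).1) = (X.1 - Y.1) * (X.1 - Y.1) := by
  obtain ⟨ε, A, d, hε, hA, h⟩ := hT
  simp only [h, Prod.fst_add]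
  linear_combination (X.1 - Y.1) * (X.1 - Y.1) * hε

theorem space_sub (X Y : Ev Q) :
    ((T X).2 - (T Y).2) ⬝ᵥ ((T X).2 - (T Y).2) = (X.2 - Y.2) ⬝ᵥ (X.2 - Y.2) := by
  obtain ⟨ε, A, d, hε, hA, h⟩ := hT
  simp only [h, Prod.snd_add, add_sub_add_right_eq_sub, ← map_sub, hA _ _]

theorem injective : Function.Injective T := by
  intro X Y h
  have h1 := hT.time_sub X Y
  have h2 := hT.space_sub X Y
  rw [h, sub_self, zero_mul] at h1
  rw [h, sub_self, zero_dotProduct] at h2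
  exact Prod.ext (sub_eq_zero.1 (mul_self_eq_zero.1 h1.symm))
    (sub_eq_zero.1 (eq_zero_of_dotProduct_self h2.symm))

theorem affine (X Y : Ev Q) (a : Q) : T (X + a • (Y - X)) = T X + a • (T Y - T X) := by
  obtain ⟨ε, A, d, hε, hA, h⟩ := hT
  simp only [h]
  ext i
  · simp; ring
  · simp; ring

end IsTM

theorem sp_eq_sp_iff {X Y X' Y' : Ev Q} : sp X Y = sp X' Y' ↔
    (X.2 - Y.2) ⬝ᵥ (X.2 - Y.2) = (X'.2 - Y'.2) ⬝ᵥ (X'.2 - Y'.2) := by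
  rw [sp, sp, ← mul_self_inj (rt_nonneg _) (rt_nonneg _),
    rt_mul_self (dotProduct_self_nonneg' _), rt_mul_self (dotProduct_self_nonneg' _)]

/-- Lightlike vectors. -/
def Null (c : Q) (X : Ev Q) : Prop := X.2 ⬝ᵥ X.2 = c * c * (X.1 * X.1)

/-- Timelike vectors. -/
def Timelike (c : Q) (X : Ev Q) : Prop := X.2 ⬝ᵥ X.2 < c * c * (X.1 * X.1)

theorem sp_eq_iff {c : Q} (hc : 0 ≤ c) (X Y : Ev Q) :
    sp X Y = c * |X.1 - Y.1| ↔ Null c (X - Y) := by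
  rw [sp, ← mul_self_inj (rt_nonneg _) (mul_nonneg hc (abs_nonneg _)),
    rt_mul_self (dotProduct_self_nonneg' _), mul_mul_mul_comm, abs_mul_abs_self]
  rfl

theorem sp_lt_iff {c : Q} (hc : 0 ≤ c) (X Y : Ev Q) :
    sp X Y < c * |X.1 - Y.1| ↔ Timelike c (X - Y) := by
  rw [sp, mul_self_lt_mul_self_iff (rt_nonneg _) (mul_nonneg hc (abs_nonneg _)),
    rt_mul_self (dotProduct_self_nonneg' _), mul_mul_mul_comm, abs_mul_abs_self]
  rfl

theorem IsTM.null_iff {T : Ev Q → Ev Q} (hT : IsTM T) (c : Q) (X Y : Ev Q) :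
    Null c (T X - T Y) ↔ Null c (X - Y) := by
  have h1 := hT.time_sub X Y
  have h2 := hT.space_sub X Y
  simp only [Null, Prod.fst_sub, Prod.snd_sub, h1, h2]

theorem IsTM.timelike_iff {T : Ev Q → Ev Q} (hT : IsTM T) (c : Q) (X Y : Ev Q) :
    Timelike c (T X - T Y) ↔ Timelike c (X - Y) := by
  have h1 := hT.time_sub X Y
  have h2 := hT.space_sub X Y
  simp only [Timelike, Prod.fst_sub, Prod.snd_sub, h1, h2]

theorem lor_null_iff {c : Q} {v : Fin 3 → Q} (hc : 0 < c) (hv : v ⬝ᵥ v < c * c) (X : Ev Q) :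
    Null c (lor c v X) ↔ Null c X := by
  rw [Null, Null, ← sub_eq_zero, lor_form hc hv, sub_eq_zero]

theorem lor_timelike_iff {c : Q} {v : Fin 3 → Q} (hc : 0 < c) (hv : v ⬝ᵥ v < c * c) (X : Ev Q) :
    Timelike c (lor c v X) ↔ Timelike c X := by
  rw [Timelike, Timelike, ← sub_neg, lor_form hc hv, sub_neg]

/-- An event is determined by its light cone. -/
theorem eq_of_null_iff {c : Q} (hc : 0 < c) {X Y : Ev Q}
    (h : ∀ Z, Null c (X - Z) → Null c (Y - Z)) : X = Y := by
  -- Of the cone at `X`, the apex and the point in the direction `(ε, c n)` are compared;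
  -- subtracting their quadratic equations leaves a linear one for `Y - X`. The signs of `ε` then
  -- give equal times, and the coordinate axes equal places.
  have key : ∀ n : Fin 3 → Q, n ⬝ᵥ n = 1 → ∀ ε : Q, ε * ε = 1 →
      (Y.2 - X.2) ⬝ᵥ n = ε * (c * (Y.1 - X.1)) := by
    intro n hn ε hε
    have h0 := h X (by simp [Null])
    have h1 := h (X.1 - ε, X.2 - c • n) (by simp [Null, hn, hε])
    have e1 : (Y - (X.1 - ε, X.2 - c • n)).2 = (Y.2 - X.2) + c • n := by
      show Y.2 - (X.2 - c • n) = _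
      abel
    have e2 : (Y - (X.1 - ε, X.2 - c • n)).1 = (Y.1 - X.1) + ε := by
      show Y.1 - (X.1 - ε) = _
      ring
    rw [Null, e1, e2] at h1
    rw [Null, Prod.fst_sub, Prod.snd_sub] at h0
    simp only [dotProduct_add, add_dotProduct, dotProduct_smul, smul_dotProduct, smul_eq_mul, hn,
      dotProduct_comm n, h0] at h1
    have h2 : 2 * c * ((Y.2 - X.2) ⬝ᵥ n - ε * (c * (Y.1 - X.1))) = 0 := by
      linear_combination h1 + c * c * hε
    have := (mul_eq_zero.1 h2).resolve_left (by positivity)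
    linear_combination this
  have hi : ∀ i : Fin 3, (Pi.single i 1 : Fin 3 → Q) ⬝ᵥ Pi.single i 1 = 1 := by simp
  have ht : Y.1 - X.1 = 0 := by
    have h1 := key _ (hi 0) 1 (by ring)
    have h2 := key _ (hi 0) (-1) (by ring)
    have : 2 * c * (Y.1 - X.1) = 0 := by linear_combination h2 - h1
    exact (mul_eq_zero.1 this).resolve_left (by positivity)
  refine Prod.ext (sub_eq_zero.1 ht).symm (funext fun i => ?_)
  have h1 := key _ (hi i) 1 (by ring)
  rw [ht] at h1
  simp at h1
  exact (sub_eq_zero.1 h1).symm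

theorem IsTriv.exists_spat {T : Ev Q → Ev Q} (hT : IsTriv T) :
    ∃ A d, IsOrth A ∧ ∀ X, T X = spat A X + d := by
  have hsp := fun X Y => sp_eq_sp_iff.1 (hT X Y).2
  obtain ⟨A, hA, h⟩ := exists_isOrth_of_isometry (g := fun x => (T (0, x)).2) fun x y =>
    hsp (0, x) (0, y)
  refine ⟨A, T 0, hA, fun X => Prod.ext ?_ ?_⟩
  · have := (hT X 0).1
    simp only [Prod.fst_zero, sub_zero] at this
    simp [spat_apply, ← this]
  · have h1 := hsp X (0, X.2)
    simp only [sub_self, zero_dotProduct] at h1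
    rw [sub_eq_zero.1 (eq_zero_of_dotProduct_self h1), h]
    rfl

theorem isTriv_of_spat {T : Ev Q → Ev Q} {A : (Fin 3 → Q) →ₗ[Q] (Fin 3 → Q)} {d : Ev Q}
    (hA : IsOrth A) (h : ∀ X, T X = spat A X + d) : IsTriv T := by
  intro X Y
  refine ⟨by simp [h, spat_apply], sp_eq_sp_iff.2 ?_⟩
  simp only [h, spat_apply, Prod.snd_add, add_sub_add_right_eq_sub, ← map_sub, hA _ _]

theorem isAff_of_linear {T : Ev Q → Ev Q} {ε : Q} {A : (Fin 3 → Q) →ₗ[Q] (Fin 3 → Q)} {d : Ev Q}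
    (h : ∀ X, T X = (ε * X.1, A X.2) + d) : IsAff T := by
  have hA : ∀ x i, A x i = (fun j => A (Pi.single j 1) i) ⬝ᵥ x := by
    intro x i
    have : x = x 0 • Pi.single 0 1 + x 1 • Pi.single 1 1 + x 2 • Pi.single 2 1 := by
      ext j; fin_cases j <;> simp
    conv_lhs => rw [this]
    simp [dotProduct_fin3, mul_comm]
  refine ⟨(ε, 0), (0, fun j => A (Pi.single j 1) 0), (0, fun j => A (Pi.single j 1) 1),
    (0, fun j => A (Pi.single j 1) 2), d, funext fun X => ?_⟩
  rw [h]
  ext i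
  · simp [aff]
  · fin_cases i <;> simp [aff, hA X.2]

theorem isAff_of_spat {T : Ev Q → Ev Q} {A : (Fin 3 → Q) →ₗ[Q] (Fin 3 → Q)} {d : Ev Q}
    (h : ∀ X, T X = spat A X + d) : IsAff T :=
  isAff_of_linear (ε := 1) fun X => by rw [h, spat_apply, one_mul]

theorem IsTM.isAff_and_isTriv {T : Ev Q → Ev Q} (hT : IsTM T) :
    IsAff T ∧ (IsTriv T ∨ IsTrivReversed T) := by
  have hs := fun X Y => sp_eq_sp_iff.2 (hT.space_sub X Y)
  obtain ⟨ε, A, d, hε, hA, h⟩ := hT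
  refine ⟨isAff_of_linear h, ?_⟩
  rcases mul_self_eq_one_iff.1 hε with rfl | rfl
  · exact Or.inl fun X Y => ⟨by simp [h], hs X Y⟩
  · exact Or.inr fun X Y => ⟨by simp [h]; ring, hs X Y⟩

end Trivial

/-! ## Families of observers -/

section Families

variable {Q : Type} [Field Q] [LinearOrder Q] [IsStrictOrderedRing Q] [HasSqrt Q]

/-- What Galilean and Lorentz boosts have in common. -/
structure IsBoost (c : Q) (L : (Fin 3 → Q) → Ev Q →ₗ[Q] Ev Q) (f : Q → Q → Q) : Prop where
  inv : ∀ v X, v ⬝ᵥ v < c * c → L (-v) (L v X) = X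
  zero : ∀ X, L 0 X = X
  equivariant : ∀ A v X, IsOrth A → L (A v) (spat A X) = spat A (L v X)
  rest : ∀ v, v ⬝ᵥ v < c * c → ∃ μ : Q, μ ≠ 0 ∧ L v (1, 0) = μ • (1, v)
  form : ∀ v X, v ⬝ᵥ v < c * c → (L v X).1 = 0 →
    (L v X).2 ⬝ᵥ (L v X).2 = f (X.1 * X.1) (X.2 ⬝ᵥ X.2)

/-- The function `f` yields the length of a separation that the boost makes simultaneous. It uses
only the squares of time and length before the boost, which trivial maps preserve; this is what
makes AxSymD hold. -/
theorem isBoost_gam (c : Q) : IsBoost c gam fun _ x => x where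
  inv v X _ := gam_neg_gam v X
  zero X := by simp [gam_apply]
  equivariant A v X _ := by simp [gam_apply, spat_apply]
  rest v _ := ⟨1, one_ne_zero, by simp [gam_apply]⟩
  form v X _ h := by
    have h : X.1 = 0 := h
    simp [gam_apply, h]

theorem isBoost_lor {c : Q} (hc : 0 < c) : IsBoost c (lor c) fun t x => x - c * c * t where
  inv v X hv := lor_neg_lor hc hv X
  zero X := lor_zero hc X
  equivariant A v X hA := by
    have : dil c (A v) = dil c v := by simp [dil, hA v v]
    simp [lor_apply, spat_apply, this, hA v X.2]
  rest v hv := ⟨(dil c v)⁻¹, (inv_pos.2 (dil_spec hc hv).1).ne', by simp [lor_apply]⟩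
  form v X hv h := by
    have := lor_form hc hv X
    rw [h] at this
    simpa using this

/-- The data about observers that classical and relativistic kinematics share: the events of an
ether observer and for every observer `k` its ether velocity and a trivial map `T k`. -/
structure Skel (B Q : Type) [Field Q] [LinearOrder Q] where
  c : Q
  c_pos : 0 < c
  IOb : B → Prop
  Ph : B → Prop
  ev : Ev Q → B → Prop
  v : B → Fin 3 → Q
  T : B → Ev Q → Ev Q
  slow : ∀ k, IOb k → v k ⬝ᵥ v k < c * c
  tm : ∀ k, IOb k → IsTM (T k)
  self : ∀ k, IOb k → ∀ X, ev X k ↔ (T k X).2 = -((T k X).1 • v k)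
  triv : ∀ k, IOb k → ∀ A, IsOrth A → ∀ d, ∃ k', IOb k' ∧ v k' = A (v k) ∧
    ∀ X, T k' X = spat A (T k X) + d
  light : ∀ X Y, (∃ p, Ph p ∧ ev X p ∧ ev Y p) ↔ Null c (X - Y)
  thExp : ∀ X Y, Timelike c (X - Y) → ∃ k, IOb k ∧ ev X k ∧ ev Y k
  origin : ∃ e, IOb e ∧ v e = 0 ∧ ∀ X, T e X = X

variable {B : Type}

/-- The kinematics is the one that arises from the family `N` with the boosts `L`. -/
structure IsRep (N : Skel B Q) (K : Kin B Q) (L : (Fin 3 → Q) → Ev Q →ₗ[Q] Ev Q) : Prop where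
  IOb : ∀ k, K.IOb k ↔ N.IOb k
  Ph : ∀ p, K.Ph p ↔ N.Ph p
  W : ∀ k b X, N.IOb k → (K.W k b (L (N.v k) (N.T k X)) ↔ N.ev X b)
  noAcc : ∀ k b X, K.W k b X → N.IOb k

/-- The light signals through an event determine its light cone, and this the event. -/
theorem Skel.eq_of_ev {N : Skel B Q} {X Y : Ev Q} (h : ∀ b, N.ev X b ↔ N.ev Y b) : X = Y := by
  refine eq_of_null_iff N.c_pos fun Z hZ => ?_
  obtain ⟨p, hp, h1, h2⟩ := (N.light X Z).2 hZ
  exact (N.light Y Z).1 ⟨p, hp, (h p).1 h1, h2⟩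

namespace IsBoost

variable {c : Q} {L : (Fin 3 → Q) → Ev Q →ₗ[Q] Ev Q} {f : Q → Q → Q} (hL : IsBoost c L f)
  {v : Fin 3 → Q}
include hL

theorem inv' (hv : v ⬝ᵥ v < c * c) (X : Ev Q) : L v (L (-v) X) = X := by
  simpa using hL.inv (-v) X (by simpa using hv)

/-- The inverse boost `L (-v)` sends the time axis onto the line spanned by `(1, -v)`. -/
theorem axis_iff (hv : v ⬝ᵥ v < c * c) (X : Ev Q) : (L v X).2 = 0 ↔ X.2 = -(X.1 • v) := by
  obtain ⟨μ, hμ, h⟩ := hL.rest (-v) (by simpa using hv)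
  constructor
  · intro h0
    have h1 : L v X = (L v X).1 • ((1, 0) : Ev Q) := by ext <;> simp [h0]
    have h2 := hL.inv v X hv
    rw [h1, map_smul, h] at h2
    rw [← h2]
    ext i; simp; ring
  · intro h0
    have h1 : X = (X.1 / μ) • L (-v) (1, 0) := by
      rw [h, smul_smul, div_mul_cancel₀ _ hμ]
      ext i
      · simp
      · simp [h0]
    rw [h1, map_smul, hL.inv' hv]
    simp

end IsBoost

namespace IsRep

variable {N : Skel B Q} {K : Kin B Q} {L : (Fin 3 → Q) → Ev Q →ₗ[Q] Ev Q} {f : Q → Q → Q}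
  (h : IsRep N K L) (hL : IsBoost N.c L f)
include h

include hL in
theorem surjective {k : B} (hk : N.IOb k) (Y : Ev Q) : ∃ X, Y = L (N.v k) (N.T k X) := by
  obtain ⟨X, hX⟩ := (N.tm k hk).surjective (L (-N.v k) Y)
  exact ⟨X, by rw [hX, hL.inv' (N.slow k hk)]⟩

include hL in
theorem injective {k : B} (hk : N.IOb k) {X Y : Ev Q}
    (e : L (N.v k) (N.T k X) = L (N.v k) (N.T k Y)) : X = Y := by
  have := congrArg (L (-N.v k)) e
  rw [hL.inv _ _ (N.slow k hk), hL.inv _ _ (N.slow k hk)] at this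
  exact (N.tm k hk).injective this

theorem sameEv_iff {k k' : B} (hk : N.IOb k) (hk' : N.IOb k') (X Y : Ev Q) :
    K.SameEv k k' (L (N.v k) (N.T k X)) (L (N.v k') (N.T k' Y)) ↔ X = Y := by
  simp only [Kin.SameEv, h.W _ _ _ hk, h.W _ _ _ hk']
  exact ⟨Skel.eq_of_ev, by rintro rfl b; rfl⟩

theorem worldline_iff {k k' : B} (hk : N.IOb k) (hk' : N.IOb k') (X : Ev Q) :
    K.W k k' (L (N.v k) (N.T k X)) ↔ (N.T k' X).2 = -((N.T k' X).1 • N.v k') := by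
  rw [h.W _ _ _ hk, N.self _ hk']

include hL in
-- Every coordinate point of `k` is `L (N.v k) (N.T k X)` for exactly one event `X` of the skeleton,
-- and having the same event means having the same `X`. Each axiom becomes a property of the maps
-- `T` and of the linear maps `L`.
theorem isKinFull : IsKinFull K where
  ev k hk k' hk' X := by
    rw [h.IOb] at hk hk'
    obtain ⟨X, rfl⟩ := h.surjective hL hk X
    exact ⟨_, (h.sameEv_iff hk hk' _ _).2 rfl⟩
  self k hk X := by
    rw [h.IOb] at hk
    obtain ⟨X, rfl⟩ := h.surjective hL hk X
    rw [h.worldline_iff hk hk, ← hL.axis_iff (N.slow k hk), funext_iff, Fin.forall_fin_succ,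
      Fin.forall_fin_succ, Fin.forall_fin_succ]
    simp
  symD k hk k' hk' X Y X' Y' := by
    rw [h.IOb] at hk hk'
    obtain ⟨X, rfl⟩ := h.surjective hL hk X
    obtain ⟨Y, rfl⟩ := h.surjective hL hk Y
    obtain ⟨X', rfl⟩ := h.surjective hL hk' X'
    obtain ⟨Y', rfl⟩ := h.surjective hL hk' Y'
    rintro ⟨h1, h2, h3, h4⟩
    rw [h.sameEv_iff hk hk'] at h3 h4
    subst h3 h4
    rw [abs_eq_zero, ← Prod.fst_sub, ← map_sub] at h1 h2
    rw [sp_eq_sp_iff, ← Prod.snd_sub, ← map_sub, ← Prod.snd_sub, ← map_sub,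
      hL.form _ _ (N.slow k hk) h1, hL.form _ _ (N.slow k' hk') h2, Prod.fst_sub, Prod.fst_sub,
      Prod.snd_sub, Prod.snd_sub, (N.tm k hk).time_sub, (N.tm k' hk').time_sub,
      (N.tm k hk).space_sub, (N.tm k' hk').space_sub]
  line k hk k' hk' X Y Z := by
    rw [h.IOb] at hk hk'
    obtain ⟨X, rfl⟩ := h.surjective hL hk X
    obtain ⟨Y, rfl⟩ := h.surjective hL hk Y
    obtain ⟨Z, rfl⟩ := h.surjective hL hk Z
    rw [h.worldline_iff hk hk', h.worldline_iff hk hk', h.worldline_iff hk hk']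
    rintro ⟨hX, hY, hZ⟩
    by_cases hXY : (N.T k' Y).1 = (N.T k' X).1
    · have : X = Y := (N.tm k' hk').injective (Prod.ext hXY.symm (by rw [hX, hY, hXY]))
      subst this
      -- When the first two points coincide, only the second alternative of the axiom is available.
      exact ⟨-1, Or.inr (by simp)⟩
    · have hne : (N.T k' Y).1 - (N.T k' X).1 ≠ 0 := sub_ne_zero.2 hXY
      refine ⟨((N.T k' Z).1 - (N.T k' X).1) / ((N.T k' Y).1 - (N.T k' X).1), Or.inl ?_⟩
      have e : Z = X + (((N.T k' Z).1 - (N.T k' X).1) / ((N.T k' Y).1 - (N.T k' X).1)) •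
          (Y - X) := by
        refine (N.tm k' hk').injective ?_
        rw [(N.tm k' hk').affine]
        ext i
        · simp; field_simp; ring
        · simp only [Prod.snd_add, Prod.smul_snd, Prod.snd_sub, hX, hY, hZ, Pi.add_apply,
            Pi.smul_apply, Pi.sub_apply, Pi.neg_apply, smul_eq_mul]
          field_simp
          ring
      conv_lhs => rw [e]
      rw [(N.tm k hk).affine, map_add, map_smul, map_sub, add_sub_cancel_left]
  triv T _ hT k hk := by
    rw [h.IOb] at hk
    obtain ⟨A, d, hA, hTA⟩ := hT.exists_spat
    have hv : A (N.v k) ⬝ᵥ A (N.v k) < N.c * N.c := by rw [hA]; exact N.slow k hk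
    -- By equivariance `spat A` commutes past the boost, changing its velocity to `A v`; the
    -- translation `d` is pulled back through that boost.
    obtain ⟨k', hk', hv', hT'⟩ := N.triv k hk A hA (L (-A (N.v k)) d)
    refine ⟨k', (h.IOb k').2 hk', fun X Y => ?_⟩
    obtain ⟨X, rfl⟩ := h.surjective hL hk X
    obtain ⟨Y, rfl⟩ := h.surjective hL hk' Y
    have e : T (L (N.v k) (N.T k X)) = L (N.v k') (N.T k' X) := by
      rw [hTA, hT', hv', map_add, hL.equivariant _ _ _ hA, hL.inv' hv]
    rw [h.sameEv_iff hk hk', e]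
    exact ⟨fun h => h ▸ rfl, fun e => (h.injective hL hk' e).symm⟩
  noAcc k := by
    rintro ⟨b, X, hX⟩
    exact (h.IOb k).2 (h.noAcc k b X hX)

include hL in
theorem worldline_ether_iff {k e : B} (hk : N.IOb k) (he : N.IOb e) (h0 : N.v e = 0) (Y : Ev Q) :
    K.W k e (L (N.v k) (N.T k Y)) ↔ (N.T e Y).2 = 0 := by
  rw [h.worldline_iff hk he, h0, smul_zero, neg_zero]

include hL in
-- Between two events of `e`, the map `T k` leaves only a separation in time, since it and `T e`
-- preserve spatial distance; the boost turns this into a multiple of `(1, v)`.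
theorem velocity_iff {k e : B} (hk : N.IOb k) (he : N.IOb e) (h0 : N.v e = 0) (V : Fin 3 → Q) :
    K.Velocity k e V ↔ V = N.v k := by
  have hTe := N.tm e he
  obtain ⟨μ, hμ, hrest⟩ := hL.rest _ (N.slow k hk)
  have key : ∀ X Y, (N.T e X).2 = 0 → (N.T e Y).2 = 0 → ∃ a : Q, (X ≠ Y → a ≠ 0) ∧
      L (N.v k) (N.T k Y) - L (N.v k) (N.T k X) = (a * μ) • (1, N.v k) := by
    intro X Y hX hY
    have h1 := hTe.space_sub Y X
    rw [hX, hY, sub_zero, zero_dotProduct, ← (N.tm k hk).space_sub] at h1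
    have h2 := eq_zero_of_dotProduct_self h1.symm
    refine ⟨(N.T k Y).1 - (N.T k X).1, fun hne h3 => hne ?_, ?_⟩
    · exact (N.tm k hk).injective (Prod.ext (sub_eq_zero.1 h3) (sub_eq_zero.1 h2)).symm
    · rw [← map_sub, mul_smul, ← hrest, ← map_smul]
      congr 1
      ext i
      · simp
      · simp only [Prod.snd_sub, h2]; simp
  obtain ⟨X₀, hX₀⟩ := hTe.surjective (0, 0)
  obtain ⟨X₁, hX₁⟩ := hTe.surjective (1, 0)
  have hX₀' : (N.T e X₀).2 = 0 := by rw [hX₀]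
  have hX₁' : (N.T e X₁).2 = 0 := by rw [hX₁]
  have hne : X₀ ≠ X₁ := by
    rintro rfl
    rw [hX₀] at hX₁
    exact zero_ne_one (congrArg Prod.fst hX₁)
  constructor
  · rintro ⟨-, hV⟩
    have h1 := hV _ _ ⟨(h.worldline_ether_iff hL hk he h0 _).2 hX₀',
      (h.worldline_ether_iff hL hk he h0 _).2 hX₁'⟩
    obtain ⟨a, ha, h2⟩ := key X₀ X₁ hX₀' hX₁'
    rw [← Prod.snd_sub, ← Prod.fst_sub, h2] at h1
    simp only [Prod.smul_fst, Prod.smul_snd, smul_eq_mul, mul_one] at h1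
    exact (smul_right_injective _ (mul_ne_zero (ha hne) hμ) h1).symm
  · rintro rfl
    refine ⟨⟨_, _, (h.worldline_ether_iff hL hk he h0 _).2 hX₀',
      (h.worldline_ether_iff hL hk he h0 _).2 hX₁', fun e => hne (h.injective hL hk e)⟩, ?_⟩
    intro X Y
    obtain ⟨X, rfl⟩ := h.surjective hL hk X
    obtain ⟨Y, rfl⟩ := h.surjective hL hk Y
    rw [h.worldline_ether_iff hL hk he h0, h.worldline_ether_iff hL hk he h0]
    rintro ⟨hX, hY⟩
    obtain ⟨a, -, h2⟩ := key X Y hX hY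
    rw [← Prod.snd_sub, ← Prod.fst_sub, h2]
    simp

include hL in
theorem apply_of_rest {e : B} (h0 : N.v e = 0) (X : Ev Q) : L (N.v e) (N.T e X) = N.T e X := by
  rw [h0, hL.zero]

include hL in
-- In the coordinates of `T k` the observer `k` moves with velocity `-v`. Both `T k` and `T e`
-- preserve spatial distances and time distances, so `e` sees the same speed.
theorem speed_iff {k e : B} (hk : N.IOb k) (he : N.IOb e) (h0 : N.v e = 0) (r : Q) :
    K.Speed e k r ↔ r = rt (N.v k ⬝ᵥ N.v k) := by
  have hTe := N.tm e he
  have hTk := N.tm k hk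
  have hW : ∀ X, K.W e k (N.T e X) ↔ (N.T k X).2 = -((N.T k X).1 • N.v k) := fun X => by
    rw [← h.worldline_iff he hk, h.apply_of_rest hL h0]
  have key : ∀ X Y, (N.T k X).2 = -((N.T k X).1 • N.v k) →
      (N.T k Y).2 = -((N.T k Y).1 • N.v k) →
      sp (N.T e X) (N.T e Y) = rt (N.v k ⬝ᵥ N.v k) * |(N.T e X).1 - (N.T e Y).1| := by
    intro X Y hX hY
    rw [sp_eq_iff (rt_nonneg _), Null, Prod.fst_sub, Prod.snd_sub, hTe.time_sub, hTe.space_sub,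
      ← hTk.time_sub, ← hTk.space_sub, rt_mul_self (dotProduct_self_nonneg' _), hX, hY]
    simp only [sub_dotProduct, dotProduct_sub, neg_dotProduct, dotProduct_neg, smul_dotProduct,
      dotProduct_smul, smul_eq_mul]
    ring
  obtain ⟨X₀, hX₀⟩ := hTk.surjective (0, 0)
  obtain ⟨X₁, hX₁⟩ := hTk.surjective (1, -N.v k)
  have hX₀' : (N.T k X₀).2 = -((N.T k X₀).1 • N.v k) := by simp [hX₀]
  have hX₁' : (N.T k X₁).2 = -((N.T k X₁).1 • N.v k) := by simp [hX₁]
  have hne : |(N.T e X₀).1 - (N.T e X₁).1| ≠ 0 := by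
    rw [abs_ne_zero]
    intro h1
    have h2 := hTe.time_sub X₀ X₁
    rw [← hTk.time_sub X₀ X₁, h1, hX₀, hX₁] at h2
    norm_num at h2
  constructor
  · rintro ⟨-, hr⟩
    have h1 := hr _ _ ⟨(hW X₀).2 hX₀', (hW X₁).2 hX₁'⟩
    rw [key _ _ hX₀' hX₁'] at h1
    exact (mul_right_cancel₀ hne h1).symm
  · rintro rfl
    refine ⟨⟨_, _, (hW X₀).2 hX₀', (hW X₁).2 hX₁', fun e => hne (by rw [e]; simp)⟩, ?_⟩
    intro X Y
    obtain ⟨X, rfl⟩ := hTe.surjective X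
    obtain ⟨Y, rfl⟩ := hTe.surjective Y
    rw [hW, hW]
    exact fun ⟨hX, hY⟩ => key X Y hX hY

theorem light_iff {k : B} (hk : N.IOb k) (X Y : Ev Q) :
    (∃ p, K.Ph p ∧ K.W k p (L (N.v k) (N.T k X)) ∧ K.W k p (L (N.v k) (N.T k Y))) ↔
      Null N.c (X - Y) := by
  rw [← N.light]
  simp only [h.Ph, h.W _ _ _ hk]

end IsRep

/-- The pair of events `(0, 0)` and `(1, (c, 0, 0))` is joined by light for the speed `c` only. -/
theorem Kin.Light.eq {K : Kin B Q} {k : B} {c c' : Q} (h : K.Light k c) (h' : K.Light k c')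
    (hc : 0 < c) : c = c' := by
  have h1 := (h (0, 0) (1, Pi.single 0 c))
  have h2 := (h' (0, 0) (1, Pi.single 0 c))
  have h3 : sp (0, 0) (1, Pi.single 0 c) = c * |(0 : Q) - 1| := by
    rw [sp_eq_iff hc.le]
    simp [Null]
  have h4 := h2.1 (h1.2 h3)
  rw [h3] at h4
  simpa using h4

end Families

end Kinematics

namespace Kinematics

set_option linter.unusedSectionVars false

/-! ### What a skeleton represents with either kind of boost, and the effect of the translations. -/

section Ether

variable {Q : Type} [Field Q] [LinearOrder Q] [IsStrictOrderedRing Q] [HasSqrt Q]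
variable {B : Type} {K : Kin B Q}

theorem Kin.Light.speed_eq {e p : B} {c v : Q} (h : K.Light e c) (hp : K.Ph p)
    (hv : K.Speed e p v) : v = c := by
  obtain ⟨⟨X, Y, hX, hY, hne⟩, hs⟩ := hv
  have h1 := hs X Y ⟨hX, hY⟩
  have h2 := (h X Y).1 ⟨p, hp, hX, hY⟩
  by_cases ht : X.1 - Y.1 = 0
  · rw [ht, abs_zero, mul_zero, sp] at h1
    have h3 := rt_mul_self (dotProduct_self_nonneg' (X.2 - Y.2))
    rw [h1, mul_zero] at h3
    exact absurd (Prod.ext (sub_eq_zero.1 ht)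
      (sub_eq_zero.1 (eq_zero_of_dotProduct_self h3.symm))) hne
  · rw [h1] at h2
    exact mul_right_cancel₀ (abs_ne_zero.2 ht) h2

/-- A light signal between two distinct events exists; without one the universal definition of `𝔠ₑ`
would not determine a value. -/
theorem Kin.Light.exists_speed {e : B} {c : Q} (h : K.Light e c) (hc : 0 < c) :
    ∃ p, K.Ph p ∧ K.Speed e p c := by
  obtain ⟨p, hp, hX, hY⟩ := (h (0, 0) (1, Pi.single 0 c)).2 (by
    rw [sp_eq_iff hc.le]
    simp [Null])
  exact ⟨p, hp, ⟨_, _, hX, hY, fun e => zero_ne_one (congrArg Prod.fst e)⟩,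
    fun X Y hXY => (h X Y).1 ⟨p, hp, hXY⟩⟩

theorem Kin.IsCe.eq {e : B} {c C : Q} (hC : K.IsCe C) (he : K.IOb e) (h : K.Light e c)
    (hc : 0 < c) : C = c := by
  obtain ⟨p, hp, hs⟩ := h.exists_speed hc
  exact (hC e ⟨he, c, hc, h⟩ p hp c hs).symm

namespace IsRep

variable {N : Skel B Q} {L : (Fin 3 → Q) → Ev Q →ₗ[Q] Ev Q} {f : Q → Q → Q}

/-- Trivial maps preserve all cones, so whether light has speed `c` for `k` depends only on how the
linear boost acts on cones. -/
theorem light_iff_null (h : IsRep N K L) (hL : IsBoost N.c L f) {k : B} (hk : N.IOb k) {c : Q}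
    (hc : 0 ≤ c) : K.Light k c ↔ ∀ Z, Null N.c Z ↔ Null c (L (N.v k) Z) := by
  have key : ∀ X Y, (∃ p, K.Ph p ∧ K.W k p (L (N.v k) (N.T k X)) ∧
      K.W k p (L (N.v k) (N.T k Y))) ↔ Null N.c (N.T k X - N.T k Y) := fun X Y => by
    rw [h.light_iff hk, (N.tm k hk).null_iff]
  constructor
  · intro hl Z
    obtain ⟨X, hX⟩ := (N.tm k hk).surjective Z
    obtain ⟨Y, hY⟩ := (N.tm k hk).surjective 0
    have h1 := (key X Y).symm.trans (hl _ _)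
    rwa [sp_eq_iff hc, ← map_sub, hX, hY, sub_zero] at h1
  · intro hl X Y
    obtain ⟨X, rfl⟩ := h.surjective hL hk X
    obtain ⟨Y, rfl⟩ := h.surjective hL hk Y
    rw [key, sp_eq_iff hc, ← map_sub]
    exact hl _

theorem rest_iff (h : IsRep N K L) (hL : IsBoost N.c L f) {e : B} (he : N.IOb e) (h0 : N.v e = 0)
    (hT : ∀ X, N.T e X = X) (k : B) : (K.IOb k ∧ ∃ T, IsAff T ∧ (IsTriv T ∨ IsTrivReversed T) ∧
      K.WorldviewIs e k T) ↔ N.IOb k ∧ N.v k = 0 := by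
  rw [h.IOb]
  have key : ∀ X Y, N.IOb k →
      (K.SameEv e k X Y ↔ Y = L (N.v k) (N.T k X)) := by
    intro X Y hk
    obtain ⟨Y, rfl⟩ := h.surjective hL hk Y
    have := h.sameEv_iff he hk X Y
    rw [h.apply_of_rest hL h0, hT] at this
    rw [this]
    exact ⟨fun e => e ▸ rfl, fun e => (h.injective hL hk e).symm⟩
  constructor
  · rintro ⟨hk, T, -, hT1, hT2⟩
    refine ⟨hk, ?_⟩
    have hTX : ∀ X, T X = L (N.v k) (N.T k X) := fun X =>
      (key X (T X) hk).1 ((hT2 X (T X)).2 rfl)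
    have hs : ∀ X Y, sp (T X) (T Y) = sp X Y := fun X Y => by
      rcases hT1 with hT1 | hT1 <;> exact (hT1 X Y).2
    -- These two events are at spatial distance zero for `e`, and a boost separates them by a
    -- multiple of `v`; an isometry of space therefore forces `v = 0`.
    obtain ⟨X, hX⟩ := (N.tm k hk).surjective (1, 0)
    obtain ⟨Y, hY⟩ := (N.tm k hk).surjective 0
    obtain ⟨μ, hμ, hr⟩ := hL.rest _ (N.slow k hk)
    have h1 := sp_eq_sp_iff.1 (hs X Y)
    rw [← (N.tm k hk).space_sub X Y, hTX, hTX, hX, hY, map_zero, hr] at h1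
    have h2 : μ • N.v k = 0 := eq_zero_of_dotProduct_self (by simpa using h1)
    exact (smul_eq_zero.1 h2).resolve_left hμ
  · rintro ⟨hk, hv⟩
    obtain ⟨h1, h2⟩ := (N.tm k hk).isAff_and_isTriv
    refine ⟨hk, N.T k, h1, h2, fun X Y => ?_⟩
    rw [key X Y hk, h.apply_of_rest hL hv]

section Classical

variable (h : IsRep N K gam)
include h

theorem light_of_rest {e : B} (he : N.IOb e) (h0 : N.v e = 0) : K.Light e N.c := by
  rw [h.light_iff_null (isBoost_gam _) he N.c_pos.le, h0]
  intro Z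
  rw [(isBoost_gam N.c).zero]

/-- For an observer moving through the ether, Galilean addition of velocities gives light different
speeds in opposite directions. -/
theorem ether_iff (k : B) : K.Ether k ↔ N.IOb k ∧ N.v k = 0 := by
  constructor
  · rintro ⟨hk, c, hc, hl⟩
    have hk := (h.IOb k).1 hk
    rw [h.light_iff_null (isBoost_gam _) hk hc.le] at hl
    refine ⟨hk, funext fun i => ?_⟩
    -- The vector `(1, a eᵢ)` is lightlike for `k`, so `(1, a eᵢ - v)` has to be lightlike in the
    -- ether. Comparing `a = c` with `a = -c` gives `vᵢ = 0`.
    have key : ∀ a : Q, a * a = c * c →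
        c * c - 2 * (a * N.v k i) + N.v k ⬝ᵥ N.v k = N.c * N.c := by
      intro a ha
      have h1 := (hl (gam (-N.v k) (1, Pi.single i a))).2 (by
        rw [gam_gam_neg]
        simp [Null, ha])
      have h2 : gam (-N.v k) (1, Pi.single i a) = (1, Pi.single i a - N.v k) := by
        simp [gam_apply, sub_eq_add_neg]
      rw [h2, Null] at h1
      simp only [sub_dotProduct, dotProduct_sub, dotProduct_comm (N.v k) (Pi.single i a)] at h1
      simp [ha] at h1
      linear_combination h1
    have h1 := key c rfl
    have h2 := key (-c) (by ring)
    have h3 : c * N.v k i = 0 := by linear_combination (h2 - h1) / 4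
    exact (mul_eq_zero.1 h3).resolve_left hc.ne'
  · rintro ⟨hk, h0⟩
    exact ⟨(h.IOb k).2 hk, N.c, N.c_pos, h.light_of_rest hk h0⟩

theorem isCe_iff (C : Q) : K.IsCe C ↔ C = N.c := by
  constructor
  · intro hC
    obtain ⟨e, he, h0, -⟩ := N.origin
    exact hC.eq ((h.IOb e).2 he) (h.light_of_rest he h0) N.c_pos
  · rintro rfl e he p hp v hv
    obtain ⟨he, h0⟩ := (h.ether_iff e).1 he
    exact (h.light_of_rest he h0).speed_eq hp hv

theorem noFTL {k e : B} (hk : N.IOb k) (he : K.Ether e) :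
    ∃ v, K.Speed e k v ∧ ∃ c, K.IsCe c ∧ v < c := by
  obtain ⟨he, h0⟩ := (h.ether_iff e).1 he
  refine ⟨_, (h.speed_iff (isBoost_gam _) hk he h0 _).2 rfl, N.c, (h.isCe_iff _).2 rfl, ?_⟩
  rw [mul_self_lt_mul_self_iff (rt_nonneg _) N.c_pos.le, rt_mul_self (dotProduct_self_nonneg' _)]
  exact N.slow k hk

theorem isClassical : IsClassical K where
  toIsKinFull := h.isKinFull (isBoost_gam _)
  absTime k hk k' hk' X Y X' Y' := by
    rw [h.IOb] at hk hk'
    obtain ⟨X, rfl⟩ := h.surjective (isBoost_gam _) hk X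
    obtain ⟨Y, rfl⟩ := h.surjective (isBoost_gam _) hk Y
    obtain ⟨X', rfl⟩ := h.surjective (isBoost_gam _) hk' X'
    obtain ⟨Y', rfl⟩ := h.surjective (isBoost_gam _) hk' Y'
    rintro ⟨h1, h2⟩
    rw [h.sameEv_iff hk hk'] at h1 h2
    subst h1 h2
    rw [abs_eq_iff_mul_self_eq]
    simp only [gam_apply]
    rw [(N.tm k hk).time_sub, (N.tm k' hk').time_sub]
  ether := by
    obtain ⟨e, he, h0, -⟩ := N.origin
    exact ⟨e, (h.ether_iff e).2 ⟨he, h0⟩⟩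
  noFTL k hk e he := h.noFTL ((h.IOb k).1 hk) he
  inhabited := by
    obtain ⟨e, he, -⟩ := N.origin
    exact ⟨e, (h.IOb e).2 he⟩
  thExp e he X Y := by
    rintro ⟨c, hc, hlt⟩
    obtain ⟨he, h0⟩ := (h.ether_iff e).1 he
    obtain rfl := (h.isCe_iff c).1 hc
    obtain ⟨X, rfl⟩ := h.surjective (isBoost_gam _) he X
    obtain ⟨Y, rfl⟩ := h.surjective (isBoost_gam _) he Y
    rw [sp_lt_iff N.c_pos.le, h.apply_of_rest (isBoost_gam _) h0,
      h.apply_of_rest (isBoost_gam _) h0, (N.tm e he).timelike_iff] at hlt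
    obtain ⟨k, hk, h1, h2⟩ := N.thExp X Y hlt
    exact ⟨k, (h.IOb k).2 hk, (h.W _ _ _ he).2 h1, (h.W _ _ _ he).2 h2⟩

end Classical

section Relativistic

variable (h : IsRep N K (lor N.c))
include h

theorem light {k : B} (hk : N.IOb k) : K.Light k N.c :=
  (h.light_iff_null (isBoost_lor N.c_pos) hk N.c_pos.le).2 fun Z =>
    (lor_null_iff N.c_pos (N.slow k hk) Z).symm

theorem isC_iff (C : Q) : K.IsC C ↔ C = N.c := by
  constructor
  · rintro ⟨hC, hl⟩
    obtain ⟨e, he, -⟩ := N.origin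
    exact (hl e ((h.IOb e).2 he)).eq (h.light he) hC
  · rintro rfl
    exact ⟨N.c_pos, fun k hk => h.light ((h.IOb k).1 hk)⟩

theorem isRelativistic {E : B → Prop} (hE : ∀ k, E k ↔ N.IOb k ∧ N.v k = 0) :
    IsRelativistic K E where
  toIsKinFull := h.isKinFull (isBoost_lor N.c_pos)
  phc := ⟨N.c, (h.isC_iff N.c).2 rfl⟩
  inhabited := by
    obtain ⟨e, he, -⟩ := N.origin
    exact ⟨e, (h.IOb e).2 he⟩
  thExp k hk X Y := by
    rintro ⟨c, hc, hlt⟩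
    rw [h.IOb] at hk
    obtain rfl := (h.isC_iff c).1 hc
    obtain ⟨X, rfl⟩ := h.surjective (isBoost_lor N.c_pos) hk X
    obtain ⟨Y, rfl⟩ := h.surjective (isBoost_lor N.c_pos) hk Y
    rw [sp_lt_iff N.c_pos.le, ← map_sub, lor_timelike_iff N.c_pos (N.slow k hk),
      (N.tm k hk).timelike_iff] at hlt
    obtain ⟨k', hk', h1, h2⟩ := N.thExp X Y hlt
    exact ⟨k', (h.IOb k').2 hk', (h.W _ _ _ hk).2 h1, (h.W _ _ _ hk).2 h2⟩
  primitiveEther := by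
    obtain ⟨e, he, h0, hT⟩ := N.origin
    exact ⟨e, (h.IOb e).2 he, fun k => by rw [hE, h.rest_iff (isBoost_lor N.c_pos) he h0 hT]⟩

end Relativistic

/-- Two kinematics that arise from the same family with the same boosts agree. -/
theorem W_iff {K' : Kin B Q} (h : IsRep N K L) (h' : IsRep N K' L) (hL : IsBoost N.c L f)
    (k b : B) (X : Ev Q) : K.W k b X ↔ K'.W k b X := by
  by_cases hk : N.IOb k
  · obtain ⟨X, rfl⟩ := h.surjective hL hk X
    rw [h.W _ _ _ hk, h'.W _ _ _ hk]
  · exact ⟨fun hW => absurd (h.noAcc _ _ _ hW) hk, fun hW => absurd (h'.noAcc _ _ _ hW) hk⟩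

/-- The velocity and the light speed in the translated formula are `N.v k` and `N.c`, and
radarization carries `gam v` to `lor c v`. So only the boosts change. -/
theorem pullPlus {rel : RelOn false B Q} (h : IsRep N (kin rel) gam) :
    IsRep N (kin (pullPlus rel)) (lor N.c) where
  IOb k := by
    rw [pullPlus_IOb, h.IOb]
    exact ⟨fun hk => hk.1, fun hk => ⟨hk, fun e he => h.noFTL hk he⟩⟩
  Ph p := by rw [pullPlus_Ph, h.Ph]
  W k b X hk := by
    rw [pullPlus_W]
    constructor
    · intro hW
      -- The quantifier over ether observers is not vacuous.
      obtain ⟨e, he, h0, -⟩ := N.origin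
      obtain ⟨Y, ⟨V, hV, C, hC, hr⟩, hY⟩ := hW e ((h.ether_iff e).2 ⟨he, h0⟩)
      obtain rfl := (h.velocity_iff (isBoost_gam _) hk he h0 V).1 hV
      obtain rfl := (h.isCe_iff C).1 hC
      have h1 := congrArg (lor N.c (-N.v k)) ((radRel_iff _ _).1 hr).2.2
      rw [lor_neg_lor N.c_pos (N.slow k hk), lor_neg_lor N.c_pos (N.slow k hk)] at h1
      rw [← h.W _ _ _ hk, h1, gam_gam_neg]
      exact hY
    · intro hX e he
      obtain ⟨he, h0⟩ := (h.ether_iff e).1 he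
      refine ⟨gam (N.v k) (N.T k X), ⟨N.v k, (h.velocity_iff (isBoost_gam _) hk he h0 _).2 rfl,
        N.c, (h.isCe_iff _).2 rfl, ?_⟩, (h.W _ _ _ hk).2 hX⟩
      rw [radRel_iff, gam_neg_gam]
      exact ⟨N.c_pos, N.slow k hk, rfl⟩
  noAcc k b X hW := by
    rw [pullPlus_W] at hW
    obtain ⟨e, he, h0, -⟩ := N.origin
    obtain ⟨Y, -, hY⟩ := hW e ((h.ether_iff e).2 ⟨he, h0⟩)
    exact h.noAcc k b Y hY

theorem pullPlus' {rel : RelOn true B Q} (h : IsRep N (kin rel) (lor N.c))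
    (hE : ∀ k, rel Sym.E ![k] ![] ↔ N.IOb k ∧ N.v k = 0) :
    IsRep N (kin (pullPlus' rel)) gam where
  IOb k := by rw [pullPlus'_IOb, h.IOb]
  Ph p := by rw [pullPlus'_Ph, h.Ph]
  W k b X hk := by
    have hL := isBoost_lor N.c_pos
    rw [pullPlus'_W]
    constructor
    · intro hW
      obtain ⟨e, he, h0, -⟩ := N.origin
      obtain ⟨Y, ⟨V, hV, C, hC, hr⟩, hY⟩ := hW e ((hE e).2 ⟨he, h0⟩)
      obtain rfl := (h.velocity_iff hL hk he h0 V).1 hV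
      obtain rfl := (h.isC_iff C).1 hC
      rw [((radRel_iff _ _).1 hr).2.2, gam_neg_gam, h.W _ _ _ hk] at hY
      exact hY
    · intro hX e he
      obtain ⟨he, h0⟩ := (hE e).1 he
      refine ⟨lor N.c (N.v k) (N.T k X), ⟨N.v k, (h.velocity_iff hL hk he h0 _).2 rfl,
        N.c, (h.isC_iff _).2 rfl, ?_⟩, (h.W _ _ _ hk).2 hX⟩
      rw [radRel_iff, gam_neg_gam]
      exact ⟨N.c_pos, N.slow k hk, rfl⟩
  noAcc k b X hW := by
    rw [pullPlus'_W] at hW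
    obtain ⟨e, he, h0, -⟩ := N.origin
    obtain ⟨Y, -, hY⟩ := hW e ((hE e).2 ⟨he, h0⟩)
    exact h.noAcc k b Y hY

end IsRep

end Ether

end Kinematics

namespace Kinematics

set_option linter.unusedSectionVars false

/-! ### Finding skeletons: the general construction and classical models. -/

section Construction

variable {Q : Type} [Field Q] [LinearOrder Q] [IsStrictOrderedRing Q] [HasSqrt Q]
variable {B : Type} {K : Kin B Q}

theorem Kin.SameEv.symm {k h : B} {X Y : Ev Q} (e : K.SameEv k h X Y) : K.SameEv h k Y X :=
  fun b => (e b).symm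

theorem Kin.SameEv.trans {k h l : B} {X Y Z : Ev Q} (e : K.SameEv k h X Y)
    (e' : K.SameEv h l Y Z) : K.SameEv k l X Z := fun b => (e b).trans (e' b)

theorem isOrth_id : IsOrth (LinearMap.id : (Fin 3 → Q) →ₗ[Q] (Fin 3 → Q)) := fun _ _ => rfl

theorem isTM_id : IsTM (id : Ev Q → Ev Q) :=
  ⟨1, LinearMap.id, 0, one_mul 1, isOrth_id, fun X => by simp⟩

theorem IsTM.spat_add {T : Ev Q → Ev Q} (hT : IsTM T) {A : (Fin 3 → Q) →ₗ[Q] (Fin 3 → Q)}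
    (hA : IsOrth A) (d : Ev Q) : IsTM fun X => spat A (T X) + d := by
  obtain ⟨ε, A', d', hε, hA', h⟩ := hT
  refine ⟨ε, A ∘ₗ A', spat A d' + d, hε, fun x y => (hA _ _).trans (hA' x y), fun X => ?_⟩
  show spat A (T X) + d = _
  rw [h, map_add, add_assoc]
  rfl

/-- A boost and a trivial map are determined by their composition. -/
theorem IsBoost.unique {c : Q} {L : (Fin 3 → Q) → Ev Q →ₗ[Q] Ev Q} {f : Q → Q → Q}
    (hL : IsBoost c L f) {v v' : Fin 3 → Q} (hv : v ⬝ᵥ v < c * c) (hv' : v' ⬝ᵥ v' < c * c)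
    {T T' : Ev Q → Ev Q} (hT : IsTM T) (hT' : IsTM T') (h : ∀ X, L v (T X) = L v' (T' X)) :
    v = v' ∧ ∀ X, T X = T' X := by
  obtain ⟨X, hX⟩ := hT.surjective (1, 0)
  obtain ⟨Y, hY⟩ := hT.surjective 0
  obtain ⟨μ, hμ, hr⟩ := hL.rest v hv
  obtain ⟨μ', hμ', hr'⟩ := hL.rest v' hv'
  have h1 := hT.space_sub X Y
  rw [← hT'.space_sub X Y, hX, hY] at h1
  have h2 : (T' X).2 - (T' Y).2 = 0 := eq_zero_of_dotProduct_self (by simpa using h1.symm)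
  have h3 : T' X - T' Y = ((T' X).1 - (T' Y).1) • ((1, 0) : Ev Q) := by
    ext i
    · simp
    · rw [Prod.snd_sub, h2]; simp
  have h4 := h X
  have h5 := h Y
  rw [hX, hr] at h4
  rw [hY, map_zero] at h5
  have h6 : μ • ((1, v) : Ev Q) = (((T' X).1 - (T' Y).1) * μ') • ((1, v') : Ev Q) := by
    rw [mul_smul, ← hr', ← map_smul, ← h3, map_sub, ← h4, ← h5, sub_zero]
  have h7 := congrArg Prod.fst h6
  have h8 := congrArg Prod.snd h6
  simp only [Prod.smul_fst, Prod.smul_snd, smul_eq_mul, mul_one] at h7 h8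
  rw [← h7] at h8
  obtain rfl := smul_right_injective _ hμ h8
  refine ⟨rfl, fun X => ?_⟩
  rw [← hL.inv _ (T X) hv, h, hL.inv _ _ hv]

namespace IsKinFull

variable (hK : IsKinFull K)
include hK

/-- Observers see an event at one place. -/
theorem eq_of_sameEv {k : B} (hk : K.IOb k) {X Y : Ev Q} (h : K.SameEv k k X Y) : X = Y := by
  -- AxTriv for the identity gives an observer `k'` with the same coordinates. Then `X` for `k` is
  -- the event `Y` for `k'`, hence the point `X = Y`.
  obtain ⟨k', -, hw⟩ := hK.triv id (isAff_of_spat (A := LinearMap.id) (d := 0) fun X => by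
    simp [spat_apply]) (fun X Y => ⟨rfl, rfl⟩) k hk
  exact ((hw X Y).1 (h.trans ((hw Y Y).2 rfl))).symm

theorem exists_worldview {e k : B} (he : K.IOb e) (hk : K.IOb k) :
    ∃ f : Ev Q → Ev Q, Function.Injective f ∧ Function.Surjective f ∧
      ∀ X, K.SameEv e k X (f X) := by
  choose f hf using hK.ev e he k hk
  refine ⟨f, fun X Y h => ?_, fun Y => ?_, hf⟩
  · refine hK.eq_of_sameEv he ((hf X).trans ?_)
    rw [h]
    exact (hf Y).symm
  · obtain ⟨X, hX⟩ := hK.ev k hk e he Y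
    exact ⟨X, hK.eq_of_sameEv hk ((hf X).symm.trans hX.symm)⟩

theorem self_iff {k : B} (hk : K.IOb k) (X : Ev Q) : K.W k k X ↔ X.2 = 0 := by
  rw [hK.self k hk, funext_iff, Fin.forall_fin_succ, Fin.forall_fin_succ, Fin.forall_fin_succ]
  simp

/-- Both constructions of skeletons reduce to decomposing each worldview transformation from `e`
into a boost and a trivial map. -/
theorem exists_isRep {e : B} {c : Q} (he : K.IOb e) (hc : 0 < c) (hl : K.Light e c)
    {L : (Fin 3 → Q) → Ev Q →ₗ[Q] Ev Q} {f : Q → Q → Q} (hL : IsBoost c L f)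
    (hth : ∀ X Y, Timelike c (X - Y) → ∃ k, K.IOb k ∧ K.W e k X ∧ K.W e k Y)
    (hw : ∀ k, K.IOb k → ∃ v T, v ⬝ᵥ v < c * c ∧ IsTM T ∧ ∀ X, K.SameEv e k X (L v (T X))) :
    ∃ N : Skel B Q, N.c = c ∧ IsRep N K L ∧ N.IOb e ∧ N.v e = 0 ∧ ∀ X, N.T e X = X := by
  choose! v T hv hT hs using hw
  -- Velocities and trivial maps are chosen for each observer separately. The uniqueness of the
  -- decomposition identifies the choices for `e` and for the observers from AxTriv with the
  -- expected ones.
  have huniq : ∀ k, K.IOb k → ∀ v' T', v' ⬝ᵥ v' < c * c → IsTM T' →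
      (∀ X, K.SameEv e k X (L v' (T' X))) → v k = v' ∧ ∀ X, T k X = T' X :=
    fun k hk v' T' hv' hT' hs' => hL.unique (hv k hk) hv' (hT k hk) hT' fun X =>
      hK.eq_of_sameEv hk ((hs k hk X).symm.trans (hs' X))
  have h0 := huniq e he 0 id (by simpa using mul_pos hc hc) isTM_id fun X => by
    rw [hL.zero]
    exact fun b => Iff.rfl
  refine ⟨{ c := c, c_pos := hc, IOb := K.IOb, Ph := K.Ph, ev := fun X b => K.W e b X, v := v,
            T := T, slow := hv, tm := hT, self := ?_, triv := ?_, light := ?_, thExp := hth,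
            origin := ⟨e, he, h0⟩ }, rfl, ⟨fun _ => Iff.rfl, fun _ => Iff.rfl, ?_, ?_⟩, he, h0⟩
  · intro k hk X
    rw [hs k hk X k, hK.self_iff hk, hL.axis_iff (hv k hk)]
  · intro k hk A hA d
    obtain ⟨k', hk', hw⟩ := hK.triv (fun Y => spat A Y + L (A (v k)) d)
      (isAff_of_spat fun _ => rfl) (isTriv_of_spat hA fun _ => rfl) k hk
    refine ⟨k', hk', huniq k' hk' _ _ ?_ ((hT k hk).spat_add hA d) fun X => ?_⟩
    · rw [hA]
      exact hv k hk
    · refine (hs k hk X).trans ((hw _ _).2 ?_)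
      rw [map_add, hL.equivariant _ _ _ hA]
  · intro X Y
    rw [hl X Y, sp_eq_iff hc.le]
  · exact fun k b X hk => (hs k hk X b).symm
  · exact fun k b X h => hK.noAcc k ⟨b, X, h⟩

end IsKinFull

/-- Isometries of the line. -/
theorem exists_eq_add_mul_of_isometry {φ : Q → Q}
    (h : ∀ s t, (φ s - φ t) * (φ s - φ t) = (s - t) * (s - t)) :
    ∃ ε, ε * ε = 1 ∧ ∀ t, φ t = φ 0 + ε * t := by
  have h1 := h 1 0
  refine ⟨φ 1 - φ 0, by rw [h1]; ring, fun t => ?_⟩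
  have h2 := h t 0
  have h3 := h t 1
  have h4 : (φ t - φ 0) * (φ 1 - φ 0) = t := by
    linear_combination (h1 + h2 - h3) / 2
  linear_combination (φ 1 - φ 0) * h4 - (φ t - φ 0) * h1

/-- Collinear points at linearly changing times. -/
theorem snd_eq_of_collinear {G : Q → Ev Q} {φ₀ ε : Q} (hε : ε ≠ 0) (hG : ∀ t, (G t).1 = φ₀ + ε * t)
    (hl : ∀ t, ∃ a : Q, G t - G 0 = a • (G 1 - G 0) ∨ G 1 - G t = a • (G t - G 0)) (t : Q) :
    (G t).2 = (G 0).2 + t • ((G 1).2 - (G 0).2) := by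
  -- In either alternative of AxLine the time coordinates fix `a`: it is `t` in the first, and `(1 +
  -- a) t = 1` in the second.
  obtain ⟨a, ha | ha⟩ := hl t
  · have h2 := congrArg Prod.fst ha
    have h3 := congrArg Prod.snd ha
    simp only [Prod.fst_sub, Prod.snd_sub, Prod.smul_fst, Prod.smul_snd, smul_eq_mul,
      hG] at h2 h3
    have h4 : t = a := mul_left_cancel₀ hε (by linear_combination h2)
    rw [h4] at h3 ⊢
    rw [← h3]
    abel
  · have h2 := congrArg Prod.fst ha
    have h3 := congrArg Prod.snd ha
    simp only [Prod.fst_sub, Prod.snd_sub, Prod.smul_fst, Prod.smul_snd, smul_eq_mul,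
      hG] at h2 h3
    have h4 : 1 = (1 + a) * t := mul_left_cancel₀ hε (by linear_combination h2)
    have h5 : (G 1).2 - (G 0).2 = (1 + a) • ((G t).2 - (G 0).2) := by
      rw [add_smul, one_smul, ← h3]
      abel
    rw [h5, smul_smul, mul_comm t, ← h4, one_smul]
    abel

namespace IsClassical

variable (hK : IsClassical K) {e : B} {c : Q} (he : K.IOb e) (hc : 0 < c) (hl : K.Light e c)
include hK he hc hl

/-- The ether observer is itself an inertial observer, and AxNoFTL for it asserts that `𝔠ₑ` exists.
-/
theorem isCe : K.IsCe c := by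
  obtain ⟨v, -, C, hC, -⟩ := hK.noFTL e he e ⟨he, c, hc, hl⟩
  rwa [hC.eq he hl hc] at hC

theorem exists_observer {X Y : Ev Q} (h : Timelike c (X - Y)) :
    ∃ k, K.IOb k ∧ K.W e k X ∧ K.W e k Y :=
  hK.thExp e ⟨he, c, hc, hl⟩ X Y ⟨c, hK.isCe he hc hl, (sp_lt_iff hc.le X Y).2 h⟩

/-- Places are world lines of observers. -/
theorem exists_static (x : Fin 3 → Q) : ∃ h, K.IOb h ∧ ∀ t, K.W e h (t, x) := by
  obtain ⟨h, hh, h0, h1⟩ := hK.exists_observer he hc hl (X := (0, x)) (Y := (1, x)) (by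
    simpa [Timelike] using mul_pos hc hc)
  refine ⟨h, hh, fun t => ?_⟩
  obtain ⟨f, hf, hfs, hfe⟩ := hK.exists_worldview he hh
  have habs : ∀ X Y, ((f X).1 - (f Y).1) * ((f X).1 - (f Y).1) =
      (X.1 - Y.1) * (X.1 - Y.1) := fun X Y =>
    (abs_eq_iff_mul_self_eq.1 (hK.absTime e he h hh X Y _ _ ⟨hfe X, hfe Y⟩)).symm
  -- The event `Z` of `h` simultaneous with `(t, x)`. Absolute time gives it the time `t`, and
  -- collinearity with two events at the place `x` gives it that place.
  obtain ⟨Z, hZ⟩ := hfs ((f (t, x)).1, 0)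
  have hZW : K.W e h Z := by
    rw [hfe Z h, hK.self_iff hh, hZ]
  have hZt : Z.1 = t := by
    have := habs Z (t, x)
    rw [hZ, sub_self, zero_mul] at this
    exact sub_eq_zero.1 (mul_self_eq_zero.1 this.symm)
  have hZx : Z.2 = x := by
    obtain ⟨a, ha | ha⟩ := hK.line e he h hh _ _ _ ⟨h0, h1, hZW⟩
    · have := congrArg Prod.snd ha
      simpa [sub_eq_zero] using this
    · have h2 := congrArg Prod.fst ha
      have h3 := congrArg Prod.snd ha
      simp only [Prod.fst_sub, Prod.snd_sub, Prod.smul_fst, Prod.smul_snd, smul_eq_mul,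
        sub_zero] at h2 h3
      have h4 : (1 + a) • (Z.2 - x) = 0 := by
        rw [add_smul, one_smul, ← h3]
        abel
      refine sub_eq_zero.1 ((smul_eq_zero.1 h4).resolve_left fun h5 => ?_)
      have : (1 : Q) = 0 := by linear_combination h2 + Z.1 * h5
      exact one_ne_zero this
  have : Z = (t, x) := Prod.ext hZt hZx
  rwa [this] at hZW

/-- Absolute time makes the new time an isometry of the old; AxSymD makes each time slice an
isometry; the observers at rest make each place a straight line. The lines have a common direction
because every slice is isometric, and this direction is the boost. -/
theorem exists_boost {k : B} (hk : K.IOb k) :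
    ∃ v T, v ⬝ᵥ v < c * c ∧ IsTM T ∧ ∀ X, K.SameEv e k X (gam v (T X)) := by
  obtain ⟨f, hf, hfs, hfe⟩ := hK.exists_worldview he hk
  have habs : ∀ X Y, ((f X).1 - (f Y).1) * ((f X).1 - (f Y).1) =
      (X.1 - Y.1) * (X.1 - Y.1) := fun X Y =>
    (abs_eq_iff_mul_self_eq.1 (hK.absTime e he k hk X Y _ _ ⟨hfe X, hfe Y⟩)).symm
  obtain ⟨ε, hε, hφ⟩ := exists_eq_add_mul_of_isometry (φ := fun t => (f (t, 0)).1)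
    fun s t => habs (s, 0) (t, 0)
  set φ₀ := (f (0, 0)).1
  have htime : ∀ t x, (f (t, x)).1 = φ₀ + ε * t := by
    intro t x
    have := habs (t, x) (t, 0)
    rw [sub_self, zero_mul] at this
    rw [sub_eq_zero.1 (mul_self_eq_zero.1 this)]
    exact hφ t
  have hiso : ∀ t x y, ((f (t, x)).2 - (f (t, y)).2) ⬝ᵥ ((f (t, x)).2 - (f (t, y)).2) =
      (x - y) ⬝ᵥ (x - y) := by
    intro t x y
    refine (sp_eq_sp_iff.1 (hK.symD e he k hk (t, x) (t, y) _ _ ⟨?_, ?_, hfe _, hfe _⟩)).symm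
    · simp
    · simp [htime]
  have hline : ∀ t x, (f (t, x)).2 = (f (0, x)).2 + t • ((f (1, x)).2 - (f (0, x)).2) := by
    intro t x
    obtain ⟨h, hh, hW⟩ := hK.exists_static he hc hl x
    have hW' : ∀ t, K.W k h (f (t, x)) := fun t => (hfe _ h).1 (hW t)
    exact snd_eq_of_collinear (G := fun t => f (t, x)) (left_ne_zero_of_mul_eq_one hε)
      (fun t => htime t x) (fun t => hK.line k hk h hh _ _ _ ⟨hW' 0, hW' 1, hW' t⟩) t
  set u : (Fin 3 → Q) → (Fin 3 → Q) := fun x => (f (1, x)).2 - (f (0, x)).2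
  -- The slices at `0`, `1` and `-1` are all isometric. With `p` and `q` the differences of
  -- positions and of velocities this says `|p + q|² = |p - q|² = |p|²`, so `q = 0`.
  have hu : ∀ x, u x = u 0 := by
    intro x
    have h0 := hiso 0 x 0
    have h1 := hiso 1 x 0
    have h2 := hiso (-1) x 0
    rw [hline 1 x, hline 1 0] at h1
    rw [hline (-1) x, hline (-1) 0] at h2
    refine sub_eq_zero.1 (eq_zero_of_dotProduct_self ?_)
    change ((f (0, x)).2 + (1 : Q) • u x - ((f (0, 0)).2 + (1 : Q) • u 0)) ⬝ᵥ
      ((f (0, x)).2 + (1 : Q) • u x - ((f (0, 0)).2 + (1 : Q) • u 0)) = _ at h1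
    change ((f (0, x)).2 + (-1 : Q) • u x - ((f (0, 0)).2 + (-1 : Q) • u 0)) ⬝ᵥ
      ((f (0, x)).2 + (-1 : Q) • u x - ((f (0, 0)).2 + (-1 : Q) • u 0)) = _ at h2
    have e1 : (f (0, x)).2 + (1 : Q) • u x - ((f (0, 0)).2 + (1 : Q) • u 0) =
        ((f (0, x)).2 - (f (0, 0)).2) + (u x - u 0) := by
      rw [one_smul, one_smul]; abel
    have e2 : (f (0, x)).2 + (-1 : Q) • u x - ((f (0, 0)).2 + (-1 : Q) • u 0) =
        ((f (0, x)).2 - (f (0, 0)).2) - (u x - u 0) := by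
      rw [neg_one_smul, neg_one_smul]; abel
    rw [e1] at h1
    rw [e2] at h2
    rw [← h0] at h1 h2
    generalize (f (0, x)).2 - (f (0, 0)).2 = p at *
    generalize u x - u 0 = q at *
    simp only [add_dotProduct, dotProduct_add, sub_dotProduct, dotProduct_sub] at h1 h2
    linear_combination (h1 + h2) / 2
  obtain ⟨A, hA, hg⟩ := exists_isOrth_of_isometry (g := fun x => (f (0, x)).2) (hiso 0)
  set b := (f (0, 0)).2
  -- The displacement `u 0` is per unit of the time of `e`; the sign `ε` converts it to the time of
  -- `k`. The offset in `T` undoes what the boost does to the initial time `φ₀`.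
  set v := ε • u 0
  set T : Ev Q → Ev Q := fun X => (ε * X.1, A X.2) + (φ₀, b - φ₀ • v) with hTdef
  have hT : IsTM T := ⟨ε, A, _, hε, hA, fun _ => rfl⟩
  have hfT : ∀ X, f X = gam v (T X) := by
    rintro ⟨t, x⟩
    rw [gam_apply]
    refine Prod.ext ?_ ?_
    · rw [htime]
      simp [hTdef]; ring
    · rw [hline]
      change (f (0, x)).2 + t • u x = _
      have hg' : (f (0, x)).2 = A x + b := hg x
      have hεt : t • u 0 = (ε * t) • v := by
        rw [smul_smul, mul_right_comm, hε, one_mul]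
      rw [hu, hg', hεt]
      simp only [hTdef, Prod.snd_add, Prod.fst_add, add_smul]
      abel
  refine ⟨v, T, ?_, hT, fun X => hfT X ▸ hfe X⟩
  have hW : ∀ X, (T X).2 = -((T X).1 • v) → K.W e k X := by
    intro X hX
    rw [hfe X k, hK.self_iff hk, hfT, gam_apply, hX]
    simp
  -- Two events of `k` one unit of time apart, from which the speed in AxNoFTL is read off to be
  -- `|v|`.
  obtain ⟨X₀, hX₀⟩ := hT.surjective (0, 0)
  obtain ⟨X₁, hX₁⟩ := hT.surjective (1, -v)
  obtain ⟨r, ⟨-, hr⟩, C, hC, hrC⟩ := hK.noFTL k hk e ⟨he, c, hc, hl⟩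
  rw [hC.eq he hl hc] at hrC
  have h1 := hr X₀ X₁ ⟨hW _ (by simp [hX₀]), hW _ (by simp [hX₁])⟩
  have h2 := hT.time_sub X₀ X₁
  have h3 := hT.space_sub X₀ X₁
  rw [hX₀, hX₁] at h2 h3
  have h4 : |X₀.1 - X₁.1| = 1 := by
    rw [← abs_one, abs_eq_iff_mul_self_eq, ← h2]
    ring
  rw [h4, mul_one] at h1
  have hr0 : 0 ≤ r := h1 ▸ rt_nonneg _
  have h5 : r * r = v ⬝ᵥ v := by
    rw [← h1, sp, rt_mul_self (dotProduct_self_nonneg' _), ← h3]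
    simp
  rw [← h5]
  exact mul_self_lt_mul_self hr0 hrC

omit he hc hl in
theorem exists_isRep_gam : ∃ N : Skel B Q, IsRep N K gam := by
  obtain ⟨e, he, c, hc, hl⟩ := hK.ether
  obtain ⟨N, -, h, -⟩ := hK.toIsKinFull.exists_isRep he hc hl (isBoost_gam c)
    (fun X Y h => hK.exists_observer he hc hl h) fun k hk => hK.exists_boost he hc hl hk
  exact ⟨N, h⟩

end IsClassical

end Construction

end Kinematics

namespace Kinematics

set_option linter.unusedSectionVars false

/-! ### Maps that preserve light cones and the time axis. -/

section Radar

variable {Q : Type} [Field Q] [LinearOrder Q] [IsStrictOrderedRing Q] [HasSqrt Q]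

theorem exists_unit_orthogonal (v : Fin 3 → Q) : ∃ m : Fin 3 → Q, m ⬝ᵥ m = 1 ∧ v ⬝ᵥ m = 0 := by
  obtain ⟨n, hn, hv⟩ : ∃ n : Fin 3 → Q, n ≠ 0 ∧ v ⬝ᵥ n = 0 := by
    by_cases h : v 0 = 0
    · exact ⟨![1, 0, 0], fun e => one_ne_zero (congrFun e 0), by rw [dotProduct_fin3]; simp [h]⟩
    · exact ⟨![-v 1, v 0, 0], fun e => h (congrFun e 1), by
        rw [dotProduct_fin3]; simp; ring⟩
  have h1 : n ⬝ᵥ n ≠ 0 := fun h => hn (eq_zero_of_dotProduct_self h)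
  have h2 := rt_mul_self (dotProduct_self_nonneg' n)
  have h3 : rt (n ⬝ᵥ n) ≠ 0 := fun h => h1 (by rw [← h2, h, zero_mul])
  refine ⟨(rt (n ⬝ᵥ n))⁻¹ • n, ?_, by simp [hv]⟩
  rw [smul_dotProduct, dotProduct_smul, smul_eq_mul, smul_eq_mul, ← mul_assoc, ← mul_inv, h2,
    inv_mul_cancel₀ h1]

theorem exists_radius {c : Q} (hc : 0 < c) (x : Fin 3 → Q) : ∃ r, x ⬝ᵥ x = c * c * (r * r) := by
  refine ⟨rt (x ⬝ᵥ x) / c, ?_⟩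
  rw [div_mul_div_comm, rt_mul_self (dotProduct_self_nonneg' x),
    mul_div_cancel₀ _ (mul_pos hc hc).ne']

/-- Antipodal points of the radar sphere are characterized by light signals. -/
theorem eq_or_eq_neg_of_null {c r t : Q} (hc : 0 < c) (hr : r ≠ 0) {α β : Fin 3 → Q}
    (hα : α ⬝ᵥ α = c * c * (r * r)) (hβ : β ⬝ᵥ β = c * c * (r * r))
    (h : ∀ X : Ev Q, Null c (X - (t - r, 0)) → Null c (X - (t, α)) →
      ∃ Y : Ev Q, Null c (Y - (t, β)) ∧ Null c (Y - (t + r, 0)) ∧ Null c (Y - X)) :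
    α = β ∨ α = -β := by
  by_cases hs : c * c * (r * r) + α ⬝ᵥ β = 0
  · right
    refine eq_neg_of_add_eq_zero_left (eq_zero_of_dotProduct_self ?_)
    simp only [dotProduct_add, add_dotProduct, dotProduct_comm β α]
    linear_combination hα + hβ + 2 * hs
  left
  -- Take `X` with parameter `l` on the ray from `(t - r, 0)` through `(t, α)`, and `Y` on the ray
  -- from `(t, β)` to `(t + r, 0)`, with time `t + r + z`. That they are joined by light is a linear
  -- condition in `z`. This `l` makes the coefficient of `z` vanish, and what remains is `l = 1`.
  obtain ⟨l, hl⟩ : ∃ l, l * (c * c * (r * r) + α ⬝ᵥ β) = 2 * (c * c * (r * r)) :=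
    ⟨_, div_mul_cancel₀ _ hs⟩
  obtain ⟨⟨y₀, y⟩, h1, h2, h3⟩ := h (t - r + l * r, l • α) (by
      simp only [Null, Prod.mk_sub_mk, sub_zero, dotProduct_smul, smul_dotProduct, smul_eq_mul]
      linear_combination l * l * hα) (by
      have e : l • α - α = (l - 1) • α := by rw [sub_smul, one_smul]
      simp only [Null, Prod.mk_sub_mk, e, dotProduct_smul, smul_dotProduct, smul_eq_mul]
      linear_combination (l - 1) * (l - 1) * hα)
  simp only [Null, Prod.mk_sub_mk, sub_zero, dotProduct_smul, smul_dotProduct, smul_eq_mul,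
    sub_dotProduct, dotProduct_sub, dotProduct_comm β y, dotProduct_comm α y] at h1 h2 h3
  obtain ⟨z, rfl⟩ : ∃ z, y₀ = t + r + z := ⟨y₀ - t - r, by ring⟩
  have h4 : y ⬝ᵥ β = -(c * c * (z * r)) := by
    linear_combination (h2 + hβ - h1) / 2
  -- The event `Y` is null related to both `(t, β)` and `(t + r, 0)`, and these are null related to
  -- each other; so it lies on their common ray.
  have h5 : r • y + z • β = 0 := by
    refine eq_zero_of_dotProduct_self ?_
    simp only [dotProduct_add, add_dotProduct, dotProduct_smul, smul_dotProduct, smul_eq_mul,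
      dotProduct_comm β y]
    linear_combination r * r * h2 + z * z * hβ + 2 * r * z * h4
  have h6 : r * (y ⬝ᵥ α) + z * (α ⬝ᵥ β) = 0 := by
    have := congrArg (fun w => w ⬝ᵥ α) h5
    simpa [dotProduct_comm β α] using this
  have h7 : (c * c * (r * r)) * r * (l - 1) = 0 := by
    linear_combination (r / 4) * (h3 - h2) + (l / 2) * h6 - (z / 2) * hl - (r / 4) * l * l * hα
  have hcr : c * c * (r * r) * r ≠ 0 := by positivity
  have h8 : l = 1 := sub_eq_zero.1 ((mul_eq_zero.1 h7).resolve_left hcr)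
  rw [h8, one_mul] at hl
  refine sub_eq_zero.1 (eq_zero_of_dotProduct_self ?_)
  simp only [dotProduct_sub, sub_dotProduct, dotProduct_comm β α]
  linear_combination hα + hβ - 2 * hl

/-- A map of events preserves light signals and the world line of the origin. -/
structure PreservesLight (c : Q) (F : Ev Q → Ev Q) : Prop where
  injective : Function.Injective F
  surjective : Function.Surjective F
  null : ∀ X Y, Null c (F X - F Y) ↔ Null c (X - Y)
  axis : ∀ X, X.2 = 0 → (F X).2 = 0

/-- The map preserves distances of simultaneous events in some plane. -/
def PreservesDistances (v : Fin 3 → Q) (F : Ev Q → Ev Q) : Prop :=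
  ∀ X Y, X.1 = Y.1 → (F X).1 = (F Y).1 → v ⬝ᵥ ((F X).2 - (F Y).2) = 0 →
    ((F X).2 - (F Y).2) ⬝ᵥ ((F X).2 - (F Y).2) = (X.2 - Y.2) ⬝ᵥ (X.2 - Y.2)

namespace PreservesLight

variable {c : Q} {F : Ev Q → Ev Q} (h : PreservesLight c F)
include h

theorem apply_axis (t : Q) : F (t, 0) = ((F (t, 0)).1, 0) := Prod.ext rfl (h.axis _ rfl)

/-- A duration `2r` on the axis goes to a duration `2R`. Light signals from and to its ends cut out
a sphere of radius `c r` at the middle time, whose image contains the antipodal points `±c R m`.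
Being antipodal is expressed by light, so their preimages are antipodal too, and the preserved
distance gives `R² = r²`. -/
theorem time_isometry_of_radius (hc : 0 < c) {v : Fin 3 → Q} (hD : PreservesDistances v F) (t : Q)
    {r : Q} (hr : r ≠ 0) :
    ((F (t + r, 0)).1 - (F (t - r, 0)).1) * ((F (t + r, 0)).1 - (F (t - r, 0)).1) =
      4 * (r * r) := by
  set q := (F (t + r, 0)).1
  set p := (F (t - r, 0)).1
  have hFq : F (t + r, 0) = (q, 0) := h.apply_axis _
  have hFp : F (t - r, 0) = (p, 0) := h.apply_axis _
  obtain ⟨R, hR⟩ : ∃ R, q = p + 2 * R := ⟨(q - p) / 2, by ring⟩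
  have hR0 : R ≠ 0 := by
    rintro rfl
    have := h.injective (hFq.trans ((by rw [hR]; simp : ((q, 0) : Ev Q) = (p, 0)).trans hFp.symm))
    have h1 := congrArg Prod.fst this
    exact hr (by simp only at h1; linear_combination h1 / 2)
  -- Distances are only known to be preserved orthogonally to `v`.
  obtain ⟨m, hm, hvm⟩ := exists_unit_orthogonal v
  have key : ∀ s : Q, s * s = c * c * (R * R) → ∃ α : Fin 3 → Q,
      α ⬝ᵥ α = c * c * (r * r) ∧ F (t, α) = (p + R, s • m) := by
    intro s hs
    obtain ⟨⟨t', α⟩, ha⟩ := h.surjective (p + R, s • m)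
    have h1 := (h.null (t', α) (t - r, 0)).1 (by
      rw [ha, hFp]
      simp only [Null, Prod.mk_sub_mk, sub_zero, dotProduct_smul, smul_dotProduct, smul_eq_mul, hm]
      linear_combination hs)
    have h2 := (h.null (t', α) (t + r, 0)).1 (by
      rw [ha, hFq, hR]
      simp only [Null, Prod.mk_sub_mk, sub_zero, dotProduct_smul, smul_dotProduct, smul_eq_mul, hm]
      linear_combination hs)
    simp only [Null, Prod.mk_sub_mk, sub_zero] at h1 h2
    have h3 : (c * c * r) * (t' - t) = 0 := by linear_combination (h2 - h1) / 4
    have h4 := sub_eq_zero.1 ((mul_eq_zero.1 h3).resolve_left (by positivity))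
    subst h4
    exact ⟨α, by linear_combination h1, ha⟩
  obtain ⟨α, hα, ha⟩ := key (c * R) (by ring)
  obtain ⟨β, hβ, hb⟩ := key (-(c * R)) (by ring)
  have hcR : c * R ≠ 0 := mul_ne_zero hc.ne' hR0
  have hanti : ∀ X : Ev Q, Null c (X - (t - r, 0)) → Null c (X - (t, α)) →
      ∃ Y : Ev Q, Null c (Y - (t, β)) ∧ Null c (Y - (t + r, 0)) ∧ Null c (Y - X) := by
    intro X hXp hXa
    rw [← h.null, hFp] at hXp
    rw [← h.null, ha] at hXa
    -- In the image, the ray to one point and the ray from its antipode are parallel: translation by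
    -- the lightlike vector `(R, -c R m)` takes the first to the second.
    obtain ⟨Y, hY⟩ := h.surjective (F X + ((p + R, -(c * R) • m) - (p, 0)))
    refine ⟨Y, ?_, ?_, ?_⟩
    · rw [← h.null, hb, hY]
      convert hXp using 1
      abel
    · rw [← h.null, hFq, hY]
      convert hXa using 1
      rw [hR]
      ext i
      · simp; ring
      · simp; ring
    · rw [← h.null, hY, add_sub_cancel_left]
      simp only [Null, Prod.mk_sub_mk, sub_zero, dotProduct_smul, smul_dotProduct, smul_eq_mul, hm]
      ring
  rcases eq_or_eq_neg_of_null (t := t) hc hr hα hβ hanti with hαβ | hαβ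
  · exfalso
    rw [hαβ, hb] at ha
    have h1 := congrArg (fun X : Ev Q => X.2 ⬝ᵥ m) ha
    simp only [smul_dotProduct, hm, smul_eq_mul, mul_one] at h1
    exact hcR (by linear_combination -h1 / 2)
  · have h1 := hD (t, α) (t, β) rfl (by rw [ha, hb]) (by
      rw [ha, hb]
      simp [hvm])
    rw [ha, hb, hαβ] at h1
    simp only [sub_dotProduct, dotProduct_sub, neg_dotProduct, dotProduct_neg, dotProduct_smul,
      smul_dotProduct, smul_eq_mul, hm, hβ] at h1
    have h2 : (c * c) * (R * R - r * r) = 0 := by linear_combination h1 / 4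
    have h3 := (mul_eq_zero.1 h2).resolve_left (by positivity)
    rw [hR]
    linear_combination 4 * h3

/-- Times on the axis are known to change by an isometry; any other event is located by the two
moments `X.1 ± r` of the axis with which it exchanges light. -/
theorem exists_time (hc : 0 < c) {v : Fin 3 → Q} (hD : PreservesDistances v F) :
    ∃ φ₀ ε : Q, ε * ε = 1 ∧ ∀ X, (F X).1 = φ₀ + ε * X.1 ∧ (F X).2 ⬝ᵥ (F X).2 = X.2 ⬝ᵥ X.2 := by
  obtain ⟨ε, hε, hφ⟩ := exists_eq_add_mul_of_isometry (φ := fun t => (F (t, 0)).1) fun s t => by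
    by_cases hst : s = t
    · simp [hst]
    · have h1 := h.time_isometry_of_radius hc hD ((s + t) / 2) (r := (s - t) / 2)
        (div_ne_zero (sub_ne_zero.2 hst) two_ne_zero)
      have e1 : (s + t) / 2 + (s - t) / 2 = s := by ring
      have e2 : (s + t) / 2 - (s - t) / 2 = t := by ring
      rw [e1, e2] at h1
      linear_combination h1
  refine ⟨(F (0, 0)).1, ε, hε, fun X => ?_⟩
  have hFt : ∀ t, F (t, 0) = ((F (0, 0)).1 + ε * t, 0) := fun t => by
    rw [h.apply_axis, ← hφ t]
  obtain ⟨r, hr⟩ := exists_radius hc X.2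
  by_cases hr0 : r = 0
  · rw [hr0, mul_zero, mul_zero] at hr
    have hX : X = (X.1, 0) := Prod.ext rfl (eq_zero_of_dotProduct_self hr)
    rw [hX, hFt]
    simp
  have key : ∀ s : Q, s * s = r * r →
      (F X).2 ⬝ᵥ (F X).2 = c * c * (((F X).1 - ((F (0, 0)).1 + ε * (X.1 + s))) *
        ((F X).1 - ((F (0, 0)).1 + ε * (X.1 + s)))) := by
    intro s hs
    have := (h.null X (X.1 + s, 0)).2 (by
      simp only [Null, Prod.fst_sub, Prod.snd_sub, sub_zero, hr]
      linear_combination -(c * c) * hs)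
    rw [hFt] at this
    simpa [Null] using this
  have h1 := key r rfl
  have h2 := key (-r) (by ring)
  have hε0 : ε ≠ 0 := left_ne_zero_of_mul_eq_one hε
  have h3 : (c * c * ε * r) * ((F X).1 - ((F (0, 0)).1 + ε * X.1)) = 0 := by
    linear_combination (h1 - h2) / 4
  have h4 := (mul_eq_zero.1 h3).resolve_left
    (mul_ne_zero (mul_ne_zero (mul_pos hc hc).ne' hε0) hr0)
  have h5 := sub_eq_zero.1 h4
  refine ⟨h5, ?_⟩
  rw [h1, hr, h5]
  linear_combination c * c * r * r * hε

/-- Along the image of a line at rest the distance from the axis is constant, by `exists_time`. A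
straight line with this property, evaluated at `0`, `1` and `-1`, has no spatial direction. Then
spatial distances can be measured by light. -/
theorem isTM (hc : 0 < c) {v : Fin 3 → Q} (hD : PreservesDistances v F)
    (hl : ∀ x t, ∃ a : Q, F (t, x) - F (0, x) = a • (F (1, x) - F (0, x)) ∨
      F (1, x) - F (t, x) = a • (F (t, x) - F (0, x))) : IsTM F := by
  obtain ⟨φ₀, ε, hε, hF⟩ := h.exists_time hc hD
  have hconst : ∀ t x, (F (t, x)).2 = (F (0, x)).2 := by
    intro t x
    have hline := snd_eq_of_collinear (G := fun t => F (t, x)) (left_ne_zero_of_mul_eq_one hε)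
      (fun t => (hF (t, x)).1) (hl x)
    have h0 := (hF (0, x)).2
    have h1 := (hF (1, x)).2
    have h2 := (hF (-1, x)).2
    rw [hline t]
    rw [show (F (1, x)).2 = (F (0, x)).2 + ((F (1, x)).2 - (F (0, x)).2) by abel] at h1
    rw [hline (-1), neg_one_smul] at h2
    generalize (F (1, x)).2 - (F (0, x)).2 = u at *
    have hu : u = 0 := by
      refine eq_zero_of_dotProduct_self ?_
      simp only [add_dotProduct, dotProduct_add, neg_dotProduct, dotProduct_neg] at h1 h2
      linear_combination (h1 + h2) / 2 - h0
    simp [hu]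
  obtain ⟨A, hA, hg⟩ := exists_isOrth_of_isometry (g := fun x => (F (0, x)).2) fun x y => by
    -- The events `(0, x)` and `(r, y)` are joined by light, and the place of the second does not
    -- depend on its time.
    obtain ⟨r, hr⟩ := exists_radius hc (x - y)
    have h1 := (h.null (0, x) (r, y)).2 (by
      simp only [Null, Prod.mk_sub_mk, hr]
      ring)
    simp only [Null, Prod.fst_sub, Prod.snd_sub, (hF _).1] at h1
    rw [hconst r y] at h1
    rw [h1, hr]
    linear_combination c * c * r * r * hε
  refine ⟨ε, A, (φ₀, (F (0, 0)).2), hε, hA, fun X => Prod.ext ?_ ?_⟩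
  · rw [(hF X).1]
    simp [add_comm]
  · rw [hconst X.1 X.2]
    exact hg X.2

end PreservesLight

end Radar

end Kinematics

namespace Kinematics

set_option linter.unusedSectionVars false

/-! ### Relativistic models. -/

section Relativity

variable {Q : Type} [Field Q] [LinearOrder Q] [IsStrictOrderedRing Q] [HasSqrt Q]
variable {B : Type} {K : Kin B Q} {c : Q}

theorem Kin.SameEv.null_iff {k h : B} (hc : 0 < c) (hk : K.Light k c) (hh : K.Light h c)
    {X Y X' Y' : Ev Q} (hX : K.SameEv k h X X') (hY : K.SameEv k h Y Y') :
    Null c (X' - Y') ↔ Null c (X - Y) := by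
  rw [← sp_eq_iff hc.le, ← sp_eq_iff hc.le, ← hk X Y, ← hh X' Y']
  simp only [hX _, hY _]

namespace IsRelativistic

variable {E : B → Prop} (hK : IsRelativistic K E) (hC : K.IsC c)
include hK hC

/-- The world lines of observers are straight, slower than light and without end. -/
theorem exists_worldline {k h : B} (hk : K.IOb k) (hh : K.IOb h) :
    ∃ y v, v ⬝ᵥ v < c * c ∧ ∀ Z, K.W k h Z ↔ Z.2 = y + Z.1 • v := by
  have hc := hC.1
  obtain ⟨f, hf, hfs, hfe⟩ := hK.exists_worldview hh hk
  have hN : ∀ X Y, Null c (f X - f Y) ↔ Null c (X - Y) := fun X Y =>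
    (hfe X).null_iff hc (hC.2 h hh) (hC.2 k hk) (hfe Y)
  have hW : ∀ X, K.W k h (f X) ↔ X.2 = 0 := fun X => by rw [← hfe X h, hK.self_iff hh]
  obtain ⟨p, hp⟩ : ∃ p, p = f (0, 0) := ⟨_, rfl⟩
  obtain ⟨d, hd⟩ : ∃ d, d = f (1, 0) - f (0, 0) := ⟨_, rfl⟩
  have hd0 : d ≠ 0 := fun h0 => by
    have := hf (sub_eq_zero.1 (hd.symm.trans h0))
    exact one_ne_zero (congrArg Prod.fst this)
  have hcol : ∀ t, ∃ s : Q, f (t, 0) = p + s • d := by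
    intro t
    obtain ⟨a, ha | ha⟩ := hK.line k hk h hh _ _ _
      ⟨(hW (0, 0)).2 rfl, (hW (1, 0)).2 rfl, (hW (t, 0)).2 rfl⟩
    · exact ⟨a, by rw [hp, hd, ← ha]; abel⟩
    · have h1 : d = (1 + a) • (f (t, 0) - f (0, 0)) := by
        rw [add_smul, one_smul, ← ha, hd]
        abel
      have h2 : 1 + a ≠ 0 := fun h2 => hd0 (by rw [h1, h2, zero_smul])
      exact ⟨(1 + a)⁻¹, by rw [h1, smul_smul, inv_mul_cancel₀ h2, hp, one_smul]; abel⟩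
  -- Every event is joined by light to some event of `h`, as `h` sees in its own coordinates.
  have hnull : ∀ X : Ev Q, ∃ t : Q, Null c (f X - f (t, 0)) := by
    intro X
    obtain ⟨r, hr⟩ := exists_radius hc X.2
    refine ⟨X.1 + r, (hN _ _).2 ?_⟩
    simp only [Null, Prod.fst_sub, Prod.snd_sub, sub_zero, hr]
    ring
  -- If the direction `d` were not timelike, the point at unit distance from `p` orthogonally to `d`
  -- would be joined by light to no point of the line.
  have htime : d.2 ⬝ᵥ d.2 < c * c * (d.1 * d.1) := by
    by_contra hle
    rw [not_lt] at hle
    obtain ⟨m, hm, hdm⟩ := exists_unit_orthogonal d.2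
    obtain ⟨X, hX⟩ := hfs (p + (0, m))
    obtain ⟨t, ht⟩ := hnull X
    obtain ⟨s, hs⟩ := hcol t
    rw [hX, hs, add_sub_add_left_eq_sub] at ht
    simp only [Null, Prod.fst_sub, Prod.snd_sub, Prod.smul_fst, Prod.smul_snd, smul_eq_mul,
      sub_dotProduct, dotProduct_sub, smul_dotProduct, dotProduct_smul, hm, hdm,
      dotProduct_comm m d.2] at ht
    have h1 := mul_nonneg (mul_self_nonneg s) (sub_nonneg.2 hle)
    have : (1 : Q) ≤ 0 := by linear_combination h1 + ht
    exact absurd this (not_le.2 one_pos)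
  have hd1 : d.1 ≠ 0 := fun h0 => by
    rw [h0, mul_zero, mul_zero] at htime
    exact absurd htime (not_lt.2 (dotProduct_self_nonneg' _))
  obtain ⟨v, hv⟩ : ∃ v, d.2 = d.1 • v := ⟨d.1⁻¹ • d.2, by
    rw [smul_smul, mul_inv_cancel₀ hd1, one_smul]⟩
  have hslow : v ⬝ᵥ v < c * c := by
    rw [hv, smul_dotProduct, dotProduct_smul, smul_eq_mul, smul_eq_mul] at htime
    have h1 : (d.1 * d.1) * (v ⬝ᵥ v) < (d.1 * d.1) * (c * c) := by linear_combination htime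
    exact lt_of_mul_lt_mul_left h1 (mul_self_nonneg _)
  have hline : ∀ t, (f (t, 0)).2 = (p.2 - p.1 • v) + (f (t, 0)).1 • v := by
    intro t
    obtain ⟨s, hs⟩ := hcol t
    rw [hs, Prod.snd_add, Prod.fst_add, Prod.smul_snd, Prod.smul_fst, hv, smul_smul, add_smul,
      smul_eq_mul]
    abel
  refine ⟨p.2 - p.1 • v, v, hslow, fun Z => ?_⟩
  obtain ⟨X, rfl⟩ := hfs Z
  rw [hW]
  constructor
  · intro hX
    have : X = (X.1, 0) := Prod.ext rfl hX
    rw [this]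
    exact hline _
  · intro hX
    -- The line has no gaps: a point of it is joined by light to an event of `h` on the same line,
    -- and since `(1, v)` is timelike the two coincide.
    obtain ⟨t, ht⟩ := hnull X
    have h1 : (f X).2 - (f (t, 0)).2 = ((f X).1 - (f (t, 0)).1) • v := by
      rw [hX, hline t, sub_smul]
      abel
    rw [Null, Prod.snd_sub, Prod.fst_sub, h1] at ht
    simp only [smul_dotProduct, dotProduct_smul, smul_eq_mul] at ht
    have h2 : (c * c - v ⬝ᵥ v) * (((f X).1 - (f (t, 0)).1) * ((f X).1 - (f (t, 0)).1)) = 0 := by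
      linear_combination -ht
    have h3 := mul_self_eq_zero.1 ((mul_eq_zero.1 h2).resolve_left (sub_pos.2 hslow).ne')
    rw [h3, zero_smul] at h1
    rw [hf (Prod.ext (sub_eq_zero.1 h3) (sub_eq_zero.1 h1) : f X = f (t, 0))]

theorem exists_observer {k : B} (hk : K.IOb k) {X Y : Ev Q} (h : Timelike c (X - Y)) :
    ∃ k', K.IOb k' ∧ K.W k k' X ∧ K.W k k' Y :=
  hK.thExp k hk X Y ⟨c, hC, (sp_lt_iff hC.1.le X Y).2 h⟩

theorem exists_static {e : B} (he : K.IOb e) (x : Fin 3 → Q) :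
    ∃ h, K.IOb h ∧ ∀ t, K.W e h (t, x) := by
  obtain ⟨h, hh, h0, h1⟩ := hK.exists_observer hC he (X := (0, x)) (Y := (1, x)) (by
    simpa [Timelike] using mul_pos hC.1 hC.1)
  obtain ⟨y, v, -, hW⟩ := hK.exists_worldline hC he hh
  refine ⟨h, hh, fun t => (hW _).2 ?_⟩
  have h2 : x = y + (0 : Q) • v := (hW _).1 h0
  have h3 : x = y + (1 : Q) • v := (hW _).1 h1
  rw [zero_smul, add_zero] at h2
  rw [one_smul, ← h2] at h3
  rw [← h2, left_eq_add.1 h3, smul_zero, add_zero]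

/-- The Lorentz boost that brings the world line of `e` in the view of `k` to rest turns the
worldview transformation into a map `F` that preserves light and the time axis, to which the radar
argument applies. -/
theorem exists_boost {e k : B} (he : K.IOb e) (hk : K.IOb k) :
    ∃ v T, v ⬝ᵥ v < c * c ∧ IsTM T ∧ ∀ X, K.SameEv e k X (lor c v (T X)) := by
  have hc := hC.1
  obtain ⟨f, hf, hfs, hfe⟩ := hK.exists_worldview he hk
  obtain ⟨y, v, hv, hW⟩ := hK.exists_worldline hC hk he
  have hv' : -v ⬝ᵥ -v < c * c := by simpa using hv
  have hL := isBoost_lor hc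
  set F : Ev Q → Ev Q := fun X => lor c (-v) (f X - (0, y)) with hFdef
  have hlorF : ∀ X, lor c v (F X) = f X - (0, y) := fun X => hL.inv' hv _
  have hsub : ∀ X Y, F X - F Y = lor c (-v) (f X - f Y) := fun X Y => by
    rw [hFdef, ← map_sub, sub_sub_sub_cancel_right]
  have hF : PreservesLight c F := by
    refine ⟨fun X Y h => ?_, fun Z => ?_, fun X Y => ?_, fun X hX => ?_⟩
    · have := congrArg (lor c v) h
      rw [hlorF, hlorF] at this
      exact hf (sub_left_injective this)
    · obtain ⟨X, hX⟩ := hfs (lor c v Z + (0, y))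
      refine ⟨X, ?_⟩
      rw [hFdef]
      simp only [hX, add_sub_cancel_right]
      exact hL.inv v Z hv
    · rw [hsub, lor_null_iff hc hv']
      exact (hfe X).null_iff hc (hC.2 e he) (hC.2 k hk) (hfe Y)
    · have h1 : (f X).2 = y + (f X).1 • v := (hW _).1 ((hfe X e).1 ((hK.self_iff he X).2 hX))
      rw [hFdef, hL.axis_iff hv']
      simp [h1]
  -- The boost leaves separations unchanged that are simultaneous and orthogonal to `v`; for these
  -- AxSymD speaks about `F`.
  have hD : PreservesDistances v F := by
    intro X Y h1 h2 h3
    have h4 : f X - f Y = (0, (F X).2 - (F Y).2) := by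
      have h5 : f X - f Y = lor c v (F X - F Y) := by
        rw [map_sub, hlorF, hlorF, sub_sub_sub_cancel_right]
      rw [h5, lor_apply, Prod.fst_sub, Prod.snd_sub, sub_eq_zero.2 h2, h3]
      simp
    have h5 : (f X).1 - (f Y).1 = 0 := congrArg Prod.fst h4
    have h6 : (f X).2 - (f Y).2 = (F X).2 - (F Y).2 := congrArg Prod.snd h4
    rw [← h6]
    exact (sp_eq_sp_iff.1 (hK.symD e he k hk X Y _ _
      ⟨by rw [h1]; simp, by rw [h5]; simp, hfe X, hfe Y⟩)).symm
  -- Observers at rest for `e` have straight world lines for `k`, and the boost is linear.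
  have hT := hF.isTM hc hD fun x t => by
    obtain ⟨h, hh, hWh⟩ := hK.exists_static hC he x
    obtain ⟨a, ha⟩ := hK.line k hk h hh (f (0, x)) (f (1, x)) (f (t, x))
      ⟨(hfe _ h).1 (hWh 0), (hfe _ h).1 (hWh 1), (hfe _ h).1 (hWh t)⟩
    refine ⟨a, ?_⟩
    simp only [hsub, ← map_smul]
    exact ha.imp (congrArg _) (congrArg _)
  -- The offset `(0, y)` of the world line is absorbed into the trivial map, pulled back through the
  -- boost.
  refine ⟨v, _, hv, hT.spat_add isOrth_id (lor c (-v) (0, y)), fun X => ?_⟩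
  have : lor c v (spat LinearMap.id (F X) + lor c (-v) (0, y)) = f X := by
    rw [map_add, hL.inv' hv]
    show lor c v (F X) + _ = _
    rw [hlorF, sub_add_cancel]
  rw [this]
  exact hfe X

omit hC in
theorem exists_isRep_lor : ∃ N : Skel B Q, IsRep N K (lor N.c) ∧
    ∀ k, E k ↔ N.IOb k ∧ N.v k = 0 := by
  obtain ⟨c, hc, hl⟩ := hK.phc
  have hC : K.IsC c := ⟨hc, hl⟩
  obtain ⟨e, he, hE⟩ := hK.primitiveEther
  obtain ⟨N, rfl, h, he', h0, hT⟩ := hK.toIsKinFull.exists_isRep he hc (hl e he) (isBoost_lor hc)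
    (fun X Y h => hK.exists_observer hC he h) fun k hk => hK.exists_boost hC he hk
  exact ⟨N, h, fun k => by rw [← hE, h.rest_iff (isBoost_lor N.c_pos) he' h0 hT]⟩

end IsRelativistic

end Relativity

/-! ### Reduction of arbitrary models to structures over a field. -/

section Equivalence

variable {ε : Bool} {B Q : Type}

theorem IsModel.exists_fieldStruc {M : Struc (Sym ε)} {Γ : Set (Form (Sym ε))} (hM : IsModel M Γ)
    (hΓ : sentence AxEField ∈ Γ) : ∃ (B Q : Type) (_ : Field Q) (_ : LinearOrder Q)
      (_ : IsStrictOrderedRing Q) (_ : HasSqrt Q) (rel : RelOn ε B Q),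
      Nonempty B ∧ M = fieldStruc rel := by
  have h1 : IsEuclideanField M.add M.mul M.le :=
    (sat_AxEField M (fun _ => hM.nonempty_B.some) fun _ => hM.nonempty_Q.some).1 (hM.sat _ hΓ _ _)
  have h2 := hM.nonempty_B
  obtain ⟨B, Q, add, mul, le, rel⟩ := M
  change IsEuclideanField add mul le at h1
  obtain ⟨i₁, i₂, i₃, i₄, rfl, rfl, rfl⟩ := h1.exists_field
  exact ⟨B, Q, i₁, i₂, i₃, i₄, @rel, h2, rfl⟩

theorem rel_iff_of_kin {rel rel' : RelOn false B Q}
    (hI : ∀ k, (kin rel).IOb k ↔ (kin rel').IOb k) (hP : ∀ k, (kin rel).Ph k ↔ (kin rel').Ph k)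
    (hW : ∀ k b X, (kin rel).W k b X ↔ (kin rel').W k b X) {m n : ℕ} (r : Sym false m n)
    (bs : Fin m → B) (qs : Fin n → Q) : rel r bs qs ↔ rel' r bs qs := by
  cases r with
  | IOb =>
    rw [show bs = ![bs 0] from funext fun i => by fin_cases i; rfl, Subsingleton.elim qs ![]]
    exact hI _
  | Ph =>
    rw [show bs = ![bs 0] from funext fun i => by fin_cases i; rfl, Subsingleton.elim qs ![]]
    exact hP _
  | W =>
    rw [show bs = ![bs 0, bs 1] from funext fun i => by fin_cases i <;> rfl,
      show qs = ![qs 0, qs 1, qs 2, qs 3] from funext fun i => by fin_cases i <;> rfl]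
    exact hW (bs 0) (bs 1) (qs 0, ![qs 1, qs 2, qs 3])

theorem rel_iff_of_kin_of_ether {rel rel' : RelOn true B Q}
    (hI : ∀ k, (kin rel).IOb k ↔ (kin rel').IOb k) (hP : ∀ k, (kin rel).Ph k ↔ (kin rel').Ph k)
    (hW : ∀ k b X, (kin rel).W k b X ↔ (kin rel').W k b X)
    (hE : ∀ k, rel Sym.E ![k] ![] ↔ rel' Sym.E ![k] ![]) {m n : ℕ} (r : Sym true m n)
    (bs : Fin m → B) (qs : Fin n → Q) : rel r bs qs ↔ rel' r bs qs := by
  cases r with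
  | IOb =>
    rw [show bs = ![bs 0] from funext fun i => by fin_cases i; rfl, Subsingleton.elim qs ![]]
    exact hI _
  | Ph =>
    rw [show bs = ![bs 0] from funext fun i => by fin_cases i; rfl, Subsingleton.elim qs ![]]
    exact hP _
  | W =>
    rw [show bs = ![bs 0, bs 1] from funext fun i => by fin_cases i <;> rfl,
      show qs = ![qs 0, qs 1, qs 2, qs 3] from funext fun i => by fin_cases i <;> rfl]
    exact hW (bs 0) (bs 1) (qs 0, ![qs 1, qs 2, qs 3])
  | E =>
    rw [show bs = ![bs 0] from funext fun i => by fin_cases i; rfl, Subsingleton.elim qs ![]]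
    exact hE _

end Equivalence

end Kinematics

theorem mainTheorem2 :
    Kinematics.IsDefinitionalEquivalenceWith
      Kinematics.SpecRelE Kinematics.ClassicalKinSTL
      Kinematics.TrPlus Kinematics.TrPlus' := by
  open Kinematics in
  have hc : sentence AxEField ∈ ClassicalKinSTL := by simp [ClassicalKinSTL, KinFull]
  have hr : sentence AxEField ∈ SpecRelE := by simp [SpecRelE, KinFull]
  refine isDefinitionalEquivalenceWith_of_models isClosedTheory_specRelE
    isClosedTheory_classicalKinSTL (fun M hM => ?_) (fun M hM => ?_) (fun M hM => ?_)
    fun M hM => ?_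
  · obtain ⟨B, Q, i₁, i₂, i₃, i₄, rel, hB, rfl⟩ := hM.exists_fieldStruc hc
    obtain ⟨N, h⟩ := (isModel_classical_iff.1 hM).exists_isRep_gam
    exact isModel_relativistic_iff.2 (h.pullPlus.isRelativistic fun k =>
      (pullPlus_E rel k).trans (h.ether_iff k))
  · obtain ⟨B, Q, i₁, i₂, i₃, i₄, rel, hB, rfl⟩ := hM.exists_fieldStruc hr
    obtain ⟨N, h, hE⟩ := (isModel_relativistic_iff.1 hM).exists_isRep_lor
    exact isModel_classical_iff.2 (h.pullPlus' hE).isClassical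
  · obtain ⟨B, Q, i₁, i₂, i₃, i₄, rel, hB, rfl⟩ := hM.exists_fieldStruc hr
    obtain ⟨N, h, hE⟩ := (isModel_relativistic_iff.1 hM).exists_isRep_lor
    -- After both translations the same skeleton `N` is read with the same boosts as at the start,
    -- so `W` agrees; the ether is again where the velocity `N.v` vanishes.
    have h' := h.pullPlus' hE
    intro m n r bs qs
    exact rel_iff_of_kin_of_ether (fun k => (h'.pullPlus.IOb k).trans (h.IOb k).symm)
      (fun k => (h'.pullPlus.Ph k).trans (h.Ph k).symm)
      (h'.pullPlus.W_iff h (isBoost_lor N.c_pos))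
      (fun k => ((pullPlus_E _ k).trans (h'.ether_iff k)).trans (hE k).symm) r bs qs
  · obtain ⟨B, Q, i₁, i₂, i₃, i₄, rel, hB, rfl⟩ := hM.exists_fieldStruc hc
    obtain ⟨N, h⟩ := (isModel_classical_iff.1 hM).exists_isRep_gam
    have h' := h.pullPlus.pullPlus' fun k => (pullPlus_E rel k).trans (h.ether_iff k)
    intro m n r bs qs
    exact rel_iff_of_kin (fun k => (h'.IOb k).trans (h.IOb k).symm)
      (fun k => (h'.Ph k).trans (h.Ph k).symm) (h'.W_iff h (isBoost_gam N.c)) r bs qs
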